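/- Let $\Gamma$ be a finite, connected, undirected graph without loops or multiple edges, with vertex set $X$, path-length distance $\partial$ and diameter $D$. Suppose $\Gamma$ is bipartite and distance-regular, i.e. for all $0\le h,i,j\le D$ the number $p^h_{ij}=|\{z\in X:\partial(x,z)=i,\ \partial(z,y)=j\}|$ is the same for all $x,y\in X$ with $\partial(x,y)=h$. Write $b_i=p^i_{1,i+1}$, $c_i=p^i_{1,i-1}$, and let $k=b_0$ be the valency. Let $\theta_0>\theta_1>\cdots>\theta_D$ be the distinct eigenvalues of the adjacency matrix $A$ of $\Gamma$, and put $d=\lfloor D/2\rfloor$ and $\Delta=(k-2)(c_3-1)-(c_2-1)p^2_{22}$. We use the following terms. - $\Gamma$ is *taut* if $\Delta\neq 0$ and $$b_3\bigl(b_2(k-2)-(c_2-1)\theta_1^2\bigr)\bigl(b_2(k-2)-(c_2-1)\theta_d^2\bigr)=b_1\Delta(\theta_1^2-b_2)(b_2-\theta_d^2).$$ - $\Gamma$ is *2-homogeneous* (in the sense of Nomura) if for all integers $r,s,i,j \ge 0$ and all $x,y,z\in X$ with $\partial(x,y)=2$, $\partial(x,z)=r$, $\partial(y,z)=s$, the number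 of neighbours $w$ of $z$ with $\partial(x,w)=i$ and $\partial(y,w)=j$ depends only on $r,s,i,j$. - $\Gamma$ is an *antipodal 2-cover* if for every $y\in X$ there is a unique $z\in X$ with $\partial(y,z)=D$. - For $x\in X$ and $0\le i\le D$ let $E_i^*$ be the diagonal matrix whose $(y,y)$ entry is $1$ if $\partial(x,y)=i$ and $0$ otherwise, and let $T(x)$ be the subalgebra of $\mathrm{Mat}_X(\mathbb C)$ generated by $A,E_0^*,\dots,E_D^*$. A $T(x)$-module is a $T(x)$-invariant subspace of $\mathbb C^X$; it is irreducible if it is nonzero and contains no $T(x)$-modules other than $0$ and itself. The endpoint of an irreducible $T(x)$-module $W$ is $\min\{i: 0\le i\le D,\ E_i^*W\ne0\}$, and $W$ is thin if $\dim E_i^*W\le1$ for $0\le i\le D$. $\Gamma$ is *2-thin with respect to $x$* if every irreducible $T(x)$-module with endpoint $2$ is thin. **Theorem.** Assume $D\ge4$, $D$ is odd, and $k\ge3$. Then the following are equivalent: (i) $\Gamma$ is taut or 2-homogeneous; (ii) $\Gamma$ is an antipodal 2-cover and is 2-thin with respect to every vertex; (iii) $\Gamma$ is an antipodal 2-cover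 and is 2-thin with respect to at least one vertex. -/

import Mathlib

namespace DRG

variable {V : Type*} [Fintype V] [DecidableEq V]

/-! ### Distance-regular graphs and their parameters -/

/-- The number of vertices `z` with `∂(x,z) = i` and `∂(z,y) = j`. -/
noncomputable def sphereCount (G : SimpleGraph V) (i j : ℕ) (x y : V) : ℕ :=
  (Finset.univ.filter fun z : V => G.dist x z = i ∧ G.dist z y = j).card

/-- A finite connected graph is distance-regular when, for all `h, i, j` between `0` and the
diameter, the number of `z` with `∂(x,z) = i` and `∂(z,y) = j` is the same for all pairs `x, y`
with `∂(x,y) = h`. -/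
structure IsDistanceRegular (G : SimpleGraph V) : Prop where
  connected : G.Connected
  count_eq : ∀ h i j : ℕ, h ≤ G.diam → i ≤ G.diam → j ≤ G.diam →
    ∀ x y x' y' : V, G.dist x y = h → G.dist x' y' = h →
      sphereCount G i j x y = sphereCount G i j x' y'

/-- The intersection number `p^h_{ij}`: the common value of `sphereCount G i j x y` over the pairs
`x, y` with `∂(x,y) = h` (see `intersectionNumber_eq`). -/
noncomputable def intersectionNumber (G : SimpleGraph V) (h i j : ℕ) : ℕ :=
  sInf {n | ∃ x y : V, G.dist x y = h ∧ sphereCount G i j x y = n}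

theorem intersectionNumber_eq {G : SimpleGraph V} (hG : IsDistanceRegular G) {h i j : ℕ}
    (hh : h ≤ G.diam) (hi : i ≤ G.diam) (hj : j ≤ G.diam) {x y : V} (hxy : G.dist x y = h) :
    intersectionNumber G h i j = sphereCount G i j x y := by
  have hset : {n | ∃ x y : V, G.dist x y = h ∧ sphereCount G i j x y = n}
      = {sphereCount G i j x y} := by
    ext n
    constructor
    · rintro ⟨x', y', h', rfl⟩
      exact hG.count_eq h i j hh hi hj x' y' x y h' hxy
    · rintro rfl
      exact ⟨x, y, hxy, rfl⟩
  rw [intersectionNumber, hset, csInf_singleton]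

/-- `b_i = p^i_{1,i+1}`. -/
noncomputable def b (G : SimpleGraph V) (i : ℕ) : ℕ := intersectionNumber G i 1 (i + 1)

/-- `c_i = p^i_{1,i-1}`, for `i ≥ 1`. -/
noncomputable def c (G : SimpleGraph V) (i : ℕ) : ℕ := intersectionNumber G i 1 (i - 1)

/-- The valency `k = b_0` of a distance-regular graph. -/
noncomputable def valency (G : SimpleGraph V) : ℕ := b G 0

/-- `θ_i`, the `i`-th largest (starting from `i = 0`) of the distinct eigenvalues of the adjacency
matrix. -/
noncomputable def eigenvalue (G : SimpleGraph V) [DecidableRel G.Adj] (i : ℕ) : ℝ :=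
  ((G.adjMatrix ℝ).charpoly.roots.toFinset.sort (fun s t => t ≤ s)).getD i 0

/-! ### The taut condition, 2-homogeneity, antipodal 2-covers -/

/-- `Δ = (k-2)(c_3-1) - (c_2-1) p^2_{22}`. -/
noncomputable def Delta (G : SimpleGraph V) : ℝ :=
  ((valency G : ℝ) - 2) * ((c G 3 : ℝ) - 1)
    - ((c G 2 : ℝ) - 1) * (intersectionNumber G 2 2 2 : ℝ)

/-- A bipartite distance-regular graph is taut when `Δ ≠ 0` and
`b_3 (b_2(k-2) - (c_2-1)θ_1²) (b_2(k-2) - (c_2-1)θ_d²) = b_1 Δ (θ_1² - b_2) (b_2 - θ_d²)`,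
where `d = ⌊D/2⌋`. -/
def IsTaut (G : SimpleGraph V) [DecidableRel G.Adj] : Prop :=
  Delta G ≠ 0 ∧
    (b G 3 : ℝ)
        * ((b G 2 : ℝ) * ((valency G : ℝ) - 2) - ((c G 2 : ℝ) - 1) * eigenvalue G 1 ^ 2)
        * ((b G 2 : ℝ) * ((valency G : ℝ) - 2)
            - ((c G 2 : ℝ) - 1) * eigenvalue G (G.diam / 2) ^ 2)
      = (b G 1 : ℝ) * Delta G * (eigenvalue G 1 ^ 2 - (b G 2 : ℝ))
          * ((b G 2 : ℝ) - eigenvalue G (G.diam / 2) ^ 2)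

/-- 2-homogeneous in the sense of Nomura: for vertices `x, y` at distance 2 and a vertex `z` with
`∂(x,z) = r`, `∂(y,z) = s`, the number of neighbours `w` of `z` with `∂(x,w) = i`, `∂(y,w) = j`
depends only on `r, s, i, j`. -/
def IsTwoHomogeneous (G : SimpleGraph V) [DecidableRel G.Adj] : Prop :=
  ∀ r s i j : ℕ, ∃ n : ℕ, ∀ x y z : V,
    G.dist x y = 2 → G.dist x z = r → G.dist y z = s →
      (Finset.univ.filter fun w : V => G.Adj z w ∧ G.dist x w = i ∧ G.dist y w = j).card = n

/-- Every vertex has exactly one vertex at distance `D` from it. -/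
def IsAntipodalTwoCover (G : SimpleGraph V) : Prop :=
  ∀ y : V, ∃! z : V, G.dist y z = G.diam

/-! ### The subconstituent (Terwilliger) algebra and its modules -/

/-- The dual idempotent `E*_i(x)`, the projection onto the `i`-th subconstituent. -/
noncomputable def dualIdempotent (G : SimpleGraph V) (x : V) (i : ℕ) : Matrix V V ℂ :=
  Matrix.diagonal fun y => if G.dist x y = i then 1 else 0

/-- The subconstituent algebra `T(x)`, generated by `A, E*_0(x), …, E*_D(x)`. -/
noncomputable def subconstituentAlgebra (G : SimpleGraph V) [DecidableRel G.Adj] (x : V) :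
    Subalgebra ℂ (Matrix V V ℂ) :=
  Algebra.adjoin ℂ ({G.adjMatrix ℂ} ∪ {B | ∃ i, i ≤ G.diam ∧ B = dualIdempotent G x i})

/-- `W` is a `T(x)`-module: a subspace of `ℂ^X` invariant under `T(x)`. -/
def IsTModule (G : SimpleGraph V) [DecidableRel G.Adj] (x : V) (W : Submodule ℂ (V → ℂ)) : Prop :=
  ∀ B ∈ subconstituentAlgebra G x, ∀ w ∈ W, B.mulVec w ∈ W

/-- `W` is an irreducible `T(x)`-module. -/
def IsIrreducibleTModule (G : SimpleGraph V) [DecidableRel G.Adj] (x : V)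
    (W : Submodule ℂ (V → ℂ)) : Prop :=
  IsTModule G x W ∧ W ≠ ⊥ ∧
    ∀ W' : Submodule ℂ (V → ℂ), IsTModule G x W' → W' ≤ W → W' = ⊥ ∨ W' = W

/-- The subspace `E*_i(x) W`. -/
noncomputable def component (G : SimpleGraph V) (x : V) (W : Submodule ℂ (V → ℂ)) (i : ℕ) :
    Submodule ℂ (V → ℂ) :=
  W.map (dualIdempotent G x i).mulVecLin

/-- The endpoint `min {i | 0 ≤ i ≤ D, E*_i W ≠ 0}` of a nonzero `T(x)`-module. -/
noncomputable def endpoint (G : SimpleGraph V) (x : V) (W : Submodule ℂ (V → ℂ)) : ℕ :=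
  sInf {i | i ≤ G.diam ∧ component G x W i ≠ ⊥}

/-- `dim E*_i W ≤ 1` for `0 ≤ i ≤ D`. -/
def IsThin (G : SimpleGraph V) (x : V) (W : Submodule ℂ (V → ℂ)) : Prop :=
  ∀ i ≤ G.diam, Module.finrank ℂ (component G x W i) ≤ 1

/-- `G` is 2-thin with respect to `x`: every irreducible `T(x)`-module with endpoint 2 is thin. -/
def IsTwoThin (G : SimpleGraph V) [DecidableRel G.Adj] (x : V) : Prop :=
  ∀ W : Submodule ℂ (V → ℂ), IsIrreducibleTModule G x W → endpoint G x W = 2 → IsThin G x W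

end DRG

set_option linter.unusedSectionVars false
set_option linter.unusedSimpArgs false

/-! ### Combinatorics of distances and intersection numbers. -/

namespace DRG
open Finset

variable {V : Type*} [Fintype V] [DecidableEq V] {G : SimpleGraph V} [DecidableRel G.Adj]

/-! All three conditions are compared with one equation: `fundamental G θ₁ θ_d = 0`, where
`fundamental` is the difference of the two sides of the taut equation.

Fix x. A local vector lives on the second subconstituent and is killed by lowering to the first
(`localSpace`). Up to a positive scalar, the cosine matrix Φ_θ is the projection onto the
θ-eigenspace, so it is positive semidefinite. Compressed to the local space it is, for |θ| < k, a
positive multiple of an operator Q_θ that is linear in the local adjacency map N (`localQuad`,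
`levelPart_cosMatrix_mulVec`). Since θ_d² < b_2 < θ_1², the forms Q_{θ_1} and Q_{θ_d} bound N from
opposite sides, and Q_{θ_1} Q_{θ_d} is positive semidefinite (`localQuad_mul_estimate`). Its value
on the projection of any δ_z is a positive multiple of `fundamental` (`projVec_localQuad`). So the
equation holds exactly when Q_{θ_1} Q_{θ_d} = 0 on the local space, that is, when all eigenvalues of
N there are extremal.

The equation implies 2-thinness: a module of endpoint 2 contains a nonzero local v with Q_θ v = 0
for an extremal θ, hence Φ_θ v = 0. The latter makes the two natural families of vectors generated
by v proportional level by level, and one of them then spans a thin module containing the given one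
(`isTwoThin`).

The equation implies an antipodal 2-cover: the entrywise product of Φ_{θ_1} and Φ_{θ_d} is positive
semidefinite, and a 3 by 3 Hankel determinant of its moments is a multiple of `fundamental`. Its
vanishing gives a quadratic recurrence for the products of cosines, then a first-order relation
(`deviation_eq_zero`), and this forces c_i = b_{D-i} (`reversal`) and a last sphere of size one.

Conversely, suppose a local v lies in an A-invariant subspace of dimension at most D-2. Then Φ_θ v =
0 for some eigenvalue θ other than ±k, because there are D+1 eigenvalues. Hence Q_θ v = 0, and
monotonicity in θ² gives Q_{θ_1} Q_{θ_d} v = 0. In a 2-thin antipodal 2-cover such subspaces are the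
irreducible modules, which occupy only levels 2 to D-1 (`fundamental_of_twoThin`). In a
2-homogeneous graph they are built by hand (`fundamental_of_twoHomogeneous`).

When the equation holds and Δ ≠ 0 the graph is taut. When Δ = 0, a single Q_θ vanishes on every
local space, and the resulting linear relations determine the counts needed for 2-homogeneity
(`isTwoHomogeneous`). -/

/-- The standing assumptions: a bipartite distance-regular graph of odd diameter at least four
and valency at least three. -/
structure OddBipartite (G : SimpleGraph V) : Prop where
  reg : IsDistanceRegular G
  bip : G.IsBipartite
  four_le : 4 ≤ G.diam
  odd : Odd G.diam
  three_le : 3 ≤ valency G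

namespace OddBipartite

variable (H : OddBipartite G)
include H

theorem five_le : 5 ≤ G.diam := by
  have := H.four_le
  obtain ⟨m, hm⟩ := H.odd
  omega

theorem dist_le (x y : V) : G.dist x y ≤ G.diam := by
  have : Nonempty V := ⟨x⟩
  exact SimpleGraph.dist_le_diam (SimpleGraph.connected_iff_ediam_ne_top.mp H.reg.connected)

theorem dist_triangle (x y z : V) : G.dist x z ≤ G.dist x y + G.dist y z :=
  H.reg.connected.dist_triangle

theorem even_dist_add (x y z : V) : Even (G.dist x y + G.dist y z + G.dist x z) := by
  obtain ⟨col⟩ := H.bip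
  let col' : G.Coloring Bool := SimpleGraph.Coloring.mk (fun v => decide (col v = 0)) (by
    intro v w hvw h
    have := col.valid hvw
    simp only [decide_eq_decide] at h
    omega)
  have key : ∀ u v : V, Even (G.dist u v) ↔ (col' u ↔ col' v) := by
    intro u v
    obtain ⟨p, hp⟩ := H.reg.connected.exists_walk_length_eq_dist u v
    rw [← hp, col'.even_length_iff_congr]
  rw [Nat.even_add, Nat.even_add, key, key, key]
  tauto

theorem dist_adj {x y : V} (h : G.Adj x y) (z : V) :
    G.dist x z = G.dist y z + 1 ∨ G.dist y z = G.dist x z + 1 := by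
  have h1 := H.dist_triangle x y z
  have h2 := H.dist_triangle y x z
  have h3 : G.dist x y = 1 := SimpleGraph.dist_eq_one_iff_adj.mpr h
  have h4 : G.dist y x = 1 := by rw [SimpleGraph.dist_comm, h3]
  obtain ⟨m, hm⟩ := H.even_dist_add x y z
  omega

theorem dist_eq_zero {x y : V} : G.dist x y = 0 ↔ x = y := H.reg.connected.dist_eq_zero_iff

theorem card_sphere {h i j : ℕ} (hh : h ≤ G.diam) (hi : i ≤ G.diam) (hj : j ≤ G.diam) {x y : V}
    (hxy : G.dist x y = h) :
    #{z | G.dist x z = i ∧ G.dist z y = j} = intersectionNumber G h i j := by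
  rw [intersectionNumber_eq H.reg hh hi hj hxy, sphereCount]

theorem card_b (z y : V) :
    #{w | G.Adj z w ∧ G.dist w y = G.dist z y + 1} = b G (G.dist z y) := by
  have h5 := H.five_le
  by_cases hi : G.dist z y + 1 ≤ G.diam
  · rw [b, ← H.card_sphere (by omega) (by omega) hi (rfl : G.dist z y = _)]
    simp only [SimpleGraph.dist_eq_one_iff_adj]
  -- At distance D the number `b` refers to spheres of radius D+1, outside the range covered by
  -- regularity; these are empty, so the infimum defining it is zero.
  · have h1 : b G (G.dist z y) = 0 := by
      unfold b intersectionNumber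
      rw [Nat.sInf_eq_zero]
      left
      refine ⟨z, y, rfl, ?_⟩
      rw [sphereCount, card_eq_zero, filter_eq_empty_iff]
      rintro w - ⟨-, hw⟩
      have := H.dist_le w y
      omega
    rw [h1, card_eq_zero, filter_eq_empty_iff]
    rintro w - ⟨-, hw⟩
    have := H.dist_le w y
    omega

theorem card_c (z y : V) :
    #{w | G.Adj z w ∧ G.dist w y + 1 = G.dist z y} = c G (G.dist z y) := by
  have h5 := H.five_le
  have hd := H.dist_le z y
  rw [c, ← H.card_sphere hd (by omega) (by omega) (rfl : G.dist z y = _)]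
  simp only [SimpleGraph.dist_eq_one_iff_adj]
  congr 1
  ext w
  simp only [mem_filter, mem_univ, true_and]
  constructor
  · rintro ⟨h1, h2⟩; exact ⟨h1, by omega⟩
  · rintro ⟨h1, h2⟩
    refine ⟨h1, ?_⟩
    rcases H.dist_adj h1 y with h | h <;> omega

/-- Bipartiteness excludes neighbours of z at the same distance from y, so only two values occur.
When z = y the truncated index is harmless because `c G 0` is zero. -/
theorem sum_neighbor {K : Type*} [CommRing K] (h : ℕ → K) (z y : V) :
    ∑ w ∈ G.neighborFinset z, h (G.dist w y)
      = c G (G.dist z y) * h (G.dist z y - 1) + b G (G.dist z y) * h (G.dist z y + 1) := by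
  rw [← H.card_b z y, ← H.card_c z y]
  rw [← Finset.sum_filter_add_sum_filter_not _ (fun w => G.dist w y + 1 = G.dist z y)]
  congr 1
  · rw [Finset.sum_congr rfl (g := fun _ => h (G.dist z y - 1)), sum_const, nsmul_eq_mul]
    · congr 2
      congr 1
      ext w; simp
    · intro w hw
      simp only [mem_filter] at hw
      congr 1; omega
  · rw [Finset.sum_congr rfl (g := fun _ => h (G.dist z y + 1)), sum_const, nsmul_eq_mul]
    · congr 2
      congr 1
      ext w
      simp only [mem_filter, SimpleGraph.mem_neighborFinset, mem_univ, true_and]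
      refine and_congr_right fun hw => ?_
      rcases H.dist_adj hw y with h | h <;> omega
    · intro w hw
      simp only [mem_filter, SimpleGraph.mem_neighborFinset] at hw
      congr 1
      rcases H.dist_adj hw.1 y with h | h <;> omega

theorem exists_adj_closer {z y : V} (h : z ≠ y) :
    ∃ w, G.Adj z w ∧ G.dist w y + 1 = G.dist z y := by
  obtain ⟨p, hp⟩ := H.reg.connected.exists_walk_length_eq_dist z y
  cases p with
  | nil => exact absurd rfl h
  | @cons _ w _ hw p =>
    refine ⟨w, hw, ?_⟩
    have h1 := SimpleGraph.dist_le p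
    simp only [SimpleGraph.Walk.length_cons] at hp
    rcases H.dist_adj hw y with h | h <;> omega

theorem exists_dist_sub (x y : V) {i : ℕ} (hi : i ≤ G.dist x y) :
    ∃ z, G.dist x z = i ∧ G.dist z y + i = G.dist x y := by
  induction i with
  | zero => exact ⟨x, by simp, by simp⟩
  | succ i ih =>
    obtain ⟨z, h1, h2⟩ := ih (by omega)
    have hne : z ≠ y := by
      rintro rfl
      simp at h2; omega
    obtain ⟨w, hw, hwy⟩ := H.exists_adj_closer hne
    refine ⟨w, ?_, by omega⟩
    have h3 := H.dist_triangle x w y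
    have h4 := H.dist_triangle x z w
    rw [SimpleGraph.dist_eq_one_iff_adj.mpr hw] at h4
    omega

theorem nonempty : Nonempty V := H.reg.connected.nonempty

theorem exists_pair {i : ℕ} (hi : i ≤ G.diam) : ∃ x y : V, G.dist x y = i := by
  have := H.nonempty
  obtain ⟨x, y, h⟩ := G.exists_dist_eq_diam
  obtain ⟨z, hz, -⟩ := H.exists_dist_sub x y (h ▸ hi)
  exact ⟨x, z, hz⟩

theorem c_pos {i : ℕ} (h1 : 1 ≤ i) (hi : i ≤ G.diam) : 0 < c G i := by
  obtain ⟨x, y, rfl⟩ := H.exists_pair hi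
  rw [← H.card_c, card_pos]
  obtain ⟨w, hw⟩ := H.exists_adj_closer (z := x) (y := y) (by rintro rfl; simp at h1)
  exact ⟨w, by simpa using hw⟩

theorem b_pos {i : ℕ} (hi : i < G.diam) : 0 < b G i := by
  obtain ⟨x, y, h⟩ := H.exists_pair (i := i + 1) hi
  obtain ⟨w, hw, hwy⟩ := H.exists_adj_closer (z := x) (y := y) (by rintro rfl; simp at h)
  obtain rfl : G.dist w y = i := by omega
  rw [← H.card_b, card_pos]
  exact ⟨x, by simpa [hw.symm] using h⟩

theorem exists_adj_farther {z y : V} (h : G.dist z y < G.diam) :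
    ∃ w, G.Adj z w ∧ G.dist w y = G.dist z y + 1 := by
  have := H.b_pos h
  rw [← H.card_b, card_pos] at this
  obtain ⟨w, hw⟩ := this
  exact ⟨w, by simpa using hw⟩

theorem c_zero : c G 0 = 0 := by
  obtain ⟨x⟩ := H.nonempty
  have := H.card_c x x
  rw [SimpleGraph.dist_self] at this
  rw [← this, card_eq_zero, filter_eq_empty_iff]
  intro w _; simp

theorem b_diam : b G G.diam = 0 := by
  obtain ⟨x, y, h⟩ := H.exists_pair le_rfl
  rw [← h, ← H.card_b, card_eq_zero, filter_eq_empty_iff]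
  rintro w - ⟨-, hw⟩
  have := H.dist_le w y
  omega

theorem degree_eq (x : V) : #(G.neighborFinset x) = valency G := by
  have := H.card_b x x
  rw [SimpleGraph.dist_self] at this
  rw [valency, ← this]
  congr 1
  ext w
  simp only [SimpleGraph.mem_neighborFinset, mem_filter, mem_univ, true_and, zero_add]
  rw [SimpleGraph.dist_eq_one_iff_adj]
  exact ⟨fun h => ⟨h, h.symm⟩, fun h => h.1⟩

theorem c_add_b {i : ℕ} (hi : i ≤ G.diam) : c G i + b G i = valency G := by
  obtain ⟨x, y, rfl⟩ := H.exists_pair hi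
  rw [← H.degree_eq x]
  have := H.sum_neighbor (K := ℤ) (fun _ => 1) x y
  simp only [sum_const, nsmul_eq_mul, mul_one] at this
  exact_mod_cast this.symm

theorem c_one : c G 1 = 1 := by
  have h5 := H.five_le
  obtain ⟨x, y, h⟩ := H.exists_pair (i := 1) (by omega)
  have := H.card_c x y
  rw [h] at this
  rw [← this, card_eq_one]
  refine ⟨y, ?_⟩
  ext w
  simp only [mem_filter, mem_univ, true_and, mem_singleton, Nat.add_eq_right, H.dist_eq_zero]
  constructor
  · rintro ⟨-, h⟩; exact h
  · rintro rfl; exact ⟨SimpleGraph.dist_eq_one_iff_adj.mp h, rfl⟩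

theorem c_diam : c G G.diam = valency G := by
  have := H.c_add_b le_rfl
  rw [H.b_diam] at this
  omega

/-- If y' is the step from y towards x, a neighbour of x that is closer to y' is also closer to y.
-/
theorem c_le_succ {i : ℕ} (hi : i + 1 ≤ G.diam) : c G i ≤ c G (i + 1) := by
  obtain ⟨x, y, h⟩ := H.exists_pair hi
  obtain ⟨y', hy, hxy⟩ := H.exists_adj_closer (z := y) (y := x) (by rintro rfl; simp at h)
  rw [SimpleGraph.dist_comm] at h
  have h' : G.dist x y' = i := by rw [SimpleGraph.dist_comm]; omega
  have e : c G (i + 1) = c G (G.dist x y) := by rw [SimpleGraph.dist_comm, h]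
  rw [e, ← h', ← H.card_c, ← H.card_c]
  apply card_le_card
  intro w
  simp only [mem_filter, mem_univ, true_and]
  rintro ⟨hw, h2⟩
  refine ⟨hw, ?_⟩
  have h3 := H.dist_triangle w y' y
  have h4 : G.dist y' y = 1 := SimpleGraph.dist_eq_one_iff_adj.mpr hy.symm
  have h5 := H.dist_adj hw y
  rw [SimpleGraph.dist_comm] at h
  omega

/-- Take z on a geodesic of length five, at distance 3 from one end x and 2 from the other end y: a
neighbour of z closer to y is farther from x. -/
theorem c_two_le_b_three : c G 2 ≤ b G 3 := by
  obtain ⟨x, y, h⟩ := H.exists_pair H.five_le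
  obtain ⟨z, h1, h2⟩ := H.exists_dist_sub x y (i := 3) (by omega)
  have h3 : G.dist z y = 2 := by omega
  have h4 : G.dist z x = 3 := by rw [SimpleGraph.dist_comm, h1]
  rw [← h3, ← h4, ← H.card_c, ← H.card_b]
  apply card_le_card
  intro w
  simp only [mem_filter, mem_univ, true_and]
  rintro ⟨hw, h5⟩
  refine ⟨hw, ?_⟩
  have h6 := H.dist_triangle x w y
  rw [SimpleGraph.dist_comm (u := x) (v := w)] at h6
  have h7 := H.dist_adj hw x
  omega

theorem c_le_of_le {i j : ℕ} (hij : i ≤ j) (hj : j ≤ G.diam) : c G i ≤ c G j := by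
  induction j, hij using Nat.le_induction with
  | base => exact le_rfl
  | succ j _ ih => exact (ih (by omega)).trans (H.c_le_succ hj)

/-- If b_2 ≤ 1 then c_2 ≥ k-1, and both c_3 and b_3 are at least c_2, giving k ≥ 2(k-1), impossible
for k ≥ 3. The bound is needed because b_2 - 1 appears as a divisor. -/
theorem two_le_b_two : 2 ≤ b G 2 := by
  have h5 := H.five_le
  have h1 := H.c_two_le_b_three
  have h2 := H.c_add_b (i := 2) (by omega)
  have h3 := H.c_add_b (i := 3) (by omega)
  have h4 : c G 2 ≤ c G 3 := H.c_le_succ (by omega)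
  have h6 := H.three_le
  omega

/-- For every vertex `z` there are two vertices at distance two from each other and at distance `i`
from `z`. -/
theorem exists_triple {i : ℕ} (h1 : 1 ≤ i) (hi : i < G.diam) :
    ∃ x y z : V, G.dist x y = 2 ∧ G.dist x z = i ∧ G.dist y z = i := by
  have key : ∃ u z : V, 2 ≤ #{w | G.Adj u w ∧ G.dist w z = i} := by
    by_cases h : 2 ≤ c G (i + 1)
    · obtain ⟨u, z, huz⟩ := H.exists_pair (i := i + 1) hi
      refine ⟨u, z, ?_⟩
      rw [← huz, ← H.card_c] at h
      refine h.trans_eq (congrArg card (filter_congr fun w _ => ?_))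
      rw [huz, Nat.add_right_cancel_iff]
    -- Otherwise c_{i-1} ≤ c_{i+1} ≤ 1, so b_{i-1} = k - c_{i-1} is at least 2 and a vertex at
    -- distance i-1 serves as u.
    · have h2 := H.c_le_of_le (i := i - 1) (j := i + 1) (by omega) (by omega)
      have h3 := H.c_add_b (i := i - 1) (by omega)
      have h4 := H.three_le
      obtain ⟨u, z, huz⟩ := H.exists_pair (i := i - 1) (by omega)
      refine ⟨u, z, ?_⟩
      have h5 : 2 ≤ b G (i - 1) := by omega
      rw [← huz, ← H.card_b] at h5
      refine h5.trans_eq (congrArg card (filter_congr fun w _ => ?_))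
      rw [huz, Nat.sub_add_cancel h1]
  obtain ⟨u, z, h⟩ := key
  obtain ⟨x, hx, y, hy, hne⟩ := one_lt_card.mp h
  simp only [mem_filter, mem_univ, true_and] at hx hy
  refine ⟨x, y, z, ?_, hx.2, hy.2⟩
  have h3 := H.dist_adj hx.1 y
  have h4 : G.dist u y = 1 := SimpleGraph.dist_eq_one_iff_adj.mpr hy.1
  have h5 : G.dist x y ≠ 0 := fun h => hne (H.dist_eq_zero.mp h)
  omega

/-- One triple shows that p^2_{ii} is nonzero; regularity then supplies a vertex for any given pair.
-/
theorem exists_equidistant {i : ℕ} (h1 : 1 ≤ i) (hi : i < G.diam) {x y : V}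
    (hxy : G.dist x y = 2) : ∃ z, G.dist x z = i ∧ G.dist y z = i := by
  have h5 := H.five_le
  obtain ⟨x', y', z, h2, h3, h4⟩ := H.exists_triple h1 hi
  have e1 := H.card_sphere (i := i) (j := i) (by omega) hi.le hi.le hxy
  have e2 := H.card_sphere (i := i) (j := i) (by omega) hi.le hi.le h2
  have : 0 < #{z | G.dist x z = i ∧ G.dist z y = i} := by
    rw [e1, ← e2, card_pos]
    exact ⟨z, by simp [h3, SimpleGraph.dist_comm (u := z), h4]⟩
  obtain ⟨w, hw⟩ := card_pos.mp this
  simp only [mem_filter, mem_univ, true_and] at hw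
  exact ⟨w, hw.1, by rw [SimpleGraph.dist_comm, hw.2]⟩

end OddBipartite
end DRG

/-! ### Distance matrices, cosine sequences and eigenvectors. -/

namespace DRG
open Finset Matrix

variable {V : Type*} [Fintype V] [DecidableEq V] {G : SimpleGraph V} [DecidableRel G.Adj]

/-- The distance-`l` matrix. -/
noncomputable def distMatrix (G : SimpleGraph V) (K : Type*) [Zero K] [One K] (l : ℕ) : Matrix V V K :=
  of fun z y => if G.dist z y = l then 1 else 0

theorem distMatrix_mulVec_apply {K : Type*} [CommRing K] (l : ℕ) (v : V → K) (z : V) :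
    (distMatrix G K l *ᵥ v) z = ∑ y, if G.dist z y = l then v y else 0 := by
  simp [distMatrix, mulVec, dotProduct]

theorem distMatrix_one {K : Type*} [CommRing K] : distMatrix G K 1 = G.adjMatrix K := by
  ext z y
  simp [distMatrix, SimpleGraph.dist_eq_one_iff_adj, SimpleGraph.adjMatrix_apply]

theorem distMatrix_transpose {K : Type*} [CommRing K] (l : ℕ) :
    (distMatrix G K l)ᵀ = distMatrix G K l := by
  ext z y
  simp [distMatrix, SimpleGraph.dist_comm]

/-- The number of vertices at distance `l` from any given vertex, as a real number. -/
noncomputable def sphereSize (G : SimpleGraph V) : ℕ → ℝ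
  | 0 => 1
  | l + 1 => sphereSize G l * b G l / c G (l + 1)

/-- The cosine sequence of the real number `θ`. -/
noncomputable def cosine (G : SimpleGraph V) (θ : ℝ) : ℕ → ℝ
  | 0 => 1
  | 1 => θ / valency G
  | l + 2 => (θ * cosine G θ (l + 1) - c G (l + 1) * cosine G θ l) / b G (l + 1)

/-- The real number `θ` is an eigenvalue of the adjacency matrix. -/
def IsEigenvalue (G : SimpleGraph V) [DecidableRel G.Adj] (θ : ℝ) : Prop :=
  ∃ e : V → ℝ, e ≠ 0 ∧ G.adjMatrix ℝ *ᵥ e = θ • e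

/-- The set of eigenvalues of the adjacency matrix. -/
noncomputable def eigenvalues (G : SimpleGraph V) [DecidableRel G.Adj] : Finset ℝ :=
  (G.adjMatrix ℝ).charpoly.roots.toFinset

theorem mem_eigenvalues {θ : ℝ} : θ ∈ eigenvalues G ↔ IsEigenvalue G θ := by
  rw [eigenvalues, Multiset.mem_toFinset,
    Polynomial.mem_roots (Matrix.charpoly_monic _).ne_zero,
    ← Matrix.mem_spectrum_iff_isRoot_charpoly, ← Matrix.spectrum_toLin',
    ← Module.End.hasEigenvalue_iff_mem_spectrum]
  constructor
  · intro h
    obtain ⟨e, he⟩ := h.exists_hasEigenvector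
    exact ⟨e, he.2, by simpa using he.apply_eq_smul⟩
  · rintro ⟨e, he, h⟩
    exact Module.End.hasEigenvalue_of_hasEigenvector (x := e)
      ⟨by rw [Module.End.mem_eigenspace_iff]; simpa using h, he⟩

/-- The matrix whose `(z, y)` entry is the cosine of `θ` at `∂(z, y)`. -/
noncomputable def cosMatrix (G : SimpleGraph V) (K : Type*) [RCLike K] (θ : ℝ) : Matrix V V K :=
  of fun z y => (cosine G θ (G.dist z y) : K)

theorem cosMatrix_transpose {K : Type*} [RCLike K] (θ : ℝ) :
    (cosMatrix G K θ)ᵀ = cosMatrix G K θ := by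
  ext z y
  simp [cosMatrix, SimpleGraph.dist_comm]

namespace OddBipartite

variable (H : OddBipartite G)
include H

theorem adjMatrix_mul_distMatrix {K : Type*} [CommRing K] (l : ℕ) :
    G.adjMatrix K * distMatrix G K (l + 1)
      = (c G (l + 2) : K) • distMatrix G K (l + 2) + (b G l : K) • distMatrix G K l := by
  ext z y
  rw [SimpleGraph.adjMatrix_mul_apply]
  simp only [distMatrix, of_apply, Matrix.add_apply, Matrix.smul_apply, smul_eq_mul, mul_ite,
    mul_one, mul_zero]
  rw [H.sum_neighbor (fun d => if d = l + 1 then (1 : K) else 0)]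
  rcases Nat.eq_zero_or_pos (G.dist z y) with h | h
  · rw [h]
    simp only [H.c_zero]
    by_cases hl : l = 0
    · subst hl; simp
    · have h1 : ¬ (0 : ℕ) + 1 = l + 1 := by omega
      have h2 : ¬ 0 = l := by omega
      simp [h1, h2, hl]
  · by_cases h1 : G.dist z y = l + 2
    · simp [h1]
    · by_cases h2 : G.dist z y = l
      · subst h2
        have : G.dist z y - 1 ≠ G.dist z y + 1 := by omega
        simp [this]
      · have h3 : ¬ G.dist z y - 1 = l + 1 := by omega
        simp [h1, h2, h3]

theorem distMatrix_zero {K : Type*} [CommRing K] : distMatrix G K 0 = 1 := by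
  ext z y
  simp [distMatrix, Matrix.one_apply, H.dist_eq_zero]

theorem distMatrix_eq_zero {K : Type*} [CommRing K] {l : ℕ} (hl : G.diam < l) :
    distMatrix G K l = 0 := by
  ext z y
  have := H.dist_le z y
  simp only [distMatrix, of_apply, Matrix.zero_apply, ite_eq_right_iff]
  omega

theorem cast_c_ne {K : Type*} [RCLike K] {i : ℕ} (h1 : 1 ≤ i) (hi : i ≤ G.diam) :
    (c G i : K) ≠ 0 := by
  have := H.c_pos h1 hi
  exact_mod_cast this.ne'

theorem cast_b_pos {i : ℕ} (hi : i < G.diam) : (0 : ℝ) < b G i := by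
  exact_mod_cast H.b_pos hi

theorem cast_c_pos {i : ℕ} (h1 : 1 ≤ i) (hi : i ≤ G.diam) : (0 : ℝ) < c G i := by
  exact_mod_cast H.c_pos h1 hi

theorem cast_valency_ge : (3 : ℝ) ≤ valency G := by exact_mod_cast H.three_le

theorem cast_c_add_b {i : ℕ} (hi : i ≤ G.diam) : (c G i : ℝ) + b G i = valency G := by
  exact_mod_cast H.c_add_b hi

theorem sphereSize_pos {l : ℕ} (hl : l ≤ G.diam) : 0 < sphereSize G l := by
  induction l with
  | zero => simp [sphereSize]
  | succ l ih =>
    rw [sphereSize]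
    have := ih (by omega)
    have := H.cast_b_pos (i := l) (by omega)
    have := H.cast_c_pos (i := l + 1) (by omega) hl
    positivity

theorem sphereSize_succ {l : ℕ} (hl : l < G.diam) :
    sphereSize G (l + 1) * c G (l + 1) = sphereSize G l * b G l := by
  rw [sphereSize, div_mul_cancel₀]
  exact H.cast_c_ne (by omega) hl

theorem cosine_succ_succ {θ : ℝ} {l : ℕ} (hl : l + 1 < G.diam) :
    (c G (l + 1) : ℝ) * cosine G θ l + b G (l + 1) * cosine G θ (l + 2)
      = θ * cosine G θ (l + 1) := by
  have := (H.cast_b_pos hl).ne'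
  rw [cosine]
  field_simp
  ring

/-- A subspace invariant under the adjacency matrix is invariant under all distance matrices. -/
theorem distMatrix_mulVec_mem {K : Type*} [RCLike K] {W : Submodule K (V → K)}
    (hW : ∀ w ∈ W, G.adjMatrix K *ᵥ w ∈ W) (l : ℕ) {w : V → K} (hw : w ∈ W) :
    distMatrix G K l *ᵥ w ∈ W := by
  induction l using Nat.twoStepInduction generalizing w with
  | zero => rwa [H.distMatrix_zero, one_mulVec]
  | one => rw [distMatrix_one]; exact hW w hw
  | more l ih1 ih2 =>
    by_cases hl : l + 2 ≤ G.diam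
    · have h1 := congrArg (· *ᵥ w) (H.adjMatrix_mul_distMatrix (K := K) l)
      simp only [add_mulVec, smul_mulVec, ← mulVec_mulVec] at h1
      have h2 : (c G (l + 2) : K) • (distMatrix G K (l + 2) *ᵥ w) ∈ W := by
        rw [eq_sub_of_add_eq h1.symm]
        exact W.sub_mem (hW _ (ih2 hw)) (W.smul_mem _ (ih1 hw))
      exact (Submodule.smul_mem_iff _ (H.cast_c_ne (by omega) hl)).mp h2
    · rw [H.distMatrix_eq_zero (by omega), zero_mulVec]
      exact W.zero_mem

/-- The distance matrices act on an eigenvector through the cosine sequence. -/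
theorem distMatrix_mulVec_eigenvector {K : Type*} [RCLike K] {θ : ℝ} {e : V → K}
    (he : G.adjMatrix K *ᵥ e = (θ : K) • e) {l : ℕ} (hl : l ≤ G.diam) :
    distMatrix G K l *ᵥ e = ((sphereSize G l * cosine G θ l : ℝ) : K) • e := by
  have h5 := H.five_le
  induction l using Nat.twoStepInduction with
  | zero => simp [H.distMatrix_zero, sphereSize, cosine]
  | one =>
    rw [distMatrix_one, he]
    have h0 : (valency G : ℝ) ≠ 0 := by have := H.cast_valency_ge; positivity
    congr 2
    rw [sphereSize, sphereSize, cosine, H.c_one, ← valency]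
    field_simp
    simp
  | more l ih1 ih2 =>
    have h1 := congrArg (· *ᵥ e) (H.adjMatrix_mul_distMatrix (K := K) l)
    simp only [add_mulVec, smul_mulVec, ← mulVec_mulVec] at h1
    rw [ih1 (by omega), ih2 (by omega), mulVec_smul, he] at h1
    have h2 := H.cast_c_ne (K := K) (i := l + 2) (by omega) hl
    have h3 := H.sphereSize_succ (l := l) (by omega)
    have h4 := H.sphereSize_succ (l := l + 1) (by omega)
    have h6 := H.cosine_succ_succ (θ := θ) (l := l) (by omega)
    have h7 : sphereSize G (l + 1) * cosine G θ (l + 1) * θ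
        = c G (l + 2) * (sphereSize G (l + 2) * cosine G θ (l + 2))
          + b G l * (sphereSize G l * cosine G θ l) := by
      linear_combination (-sphereSize G (l + 1)) * h6 + cosine G θ l * h3 - cosine G θ (l + 2) * h4
    have h8 : (c G (l + 2) : K) • (distMatrix G K (l + 2) *ᵥ e)
        = (c G (l + 2) : K) • (((sphereSize G (l + 2) * cosine G θ (l + 2) : ℝ) : K) • e) := by
      have h9 := congrArg (fun t : ℝ => (t : K)) h7
      push_cast at h9 h1 ⊢
      rw [smul_smul, h9] at h1
      rw [smul_smul] at h1 ⊢
      rw [add_smul] at h1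
      exact (add_right_cancel h1).symm
    exact smul_right_injective _ h2 h8

/-- Below level D the recurrence is the definition of the cosines and holds for every real θ. At
level D it is a condition on θ, read off an eigenvector from A_{D+1} = 0. -/
theorem cosine_rec_diam {θ : ℝ} (hθ : IsEigenvalue G θ) :
    (c G G.diam : ℝ) * cosine G θ (G.diam - 1) = θ * cosine G θ G.diam := by
  have h5 := H.five_le
  obtain ⟨e, he0, he⟩ := hθ
  obtain ⟨l, hl⟩ : ∃ l, G.diam = l + 1 := ⟨G.diam - 1, by omega⟩
  have h1 := congrArg (· *ᵥ e) (H.adjMatrix_mul_distMatrix (K := ℝ) l)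
  rw [H.distMatrix_eq_zero (l := l + 2) (by omega)] at h1
  simp only [add_mulVec, smul_mulVec, ← mulVec_mulVec, zero_mulVec, smul_zero, zero_add] at h1
  rw [H.distMatrix_mulVec_eigenvector (K := ℝ) he (l := l) (by omega),
    H.distMatrix_mulVec_eigenvector (K := ℝ) he (l := l + 1) (by omega), mulVec_smul, he] at h1
  simp only [RCLike.ofReal_real_eq_id, id] at h1
  rw [smul_smul, smul_smul] at h1
  have h2 := smul_left_injective ℝ he0 h1
  have h3 := H.sphereSize_succ (l := l) (by omega)
  have h4 := H.sphereSize_pos (l := l + 1) (by omega)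
  rw [hl, Nat.add_sub_cancel]
  apply mul_left_cancel₀ h4.ne'
  linear_combination cosine G θ l * h3 - h2

/-- The three-term recurrence for the cosines of an eigenvalue. -/
theorem cosine_rec {θ : ℝ} (hθ : IsEigenvalue G θ) {i : ℕ} (hi : i ≤ G.diam) :
    (c G i : ℝ) * cosine G θ (i - 1) + b G i * cosine G θ (i + 1) = θ * cosine G θ i := by
  have h5 := H.five_le
  rcases Nat.eq_zero_or_pos i with rfl | h
  · rw [H.c_zero]
    have h0 : (valency G : ℝ) ≠ 0 := by have := H.cast_valency_ge; positivity
    rw [show b G 0 = valency G from rfl]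
    simp only [cosine]
    field_simp
    simp
  · rcases hi.lt_or_eq with h1 | rfl
    · obtain ⟨l, rfl⟩ : ∃ l, i = l + 1 := ⟨i - 1, by omega⟩
      exact H.cosine_succ_succ h1
    · rw [H.b_diam, H.cosine_rec_diam hθ]
      simp

/-- By the three-term recurrence every column of Φ_θ is an eigenvector. Being also a combination of
distance matrices, Φ_θ turns out to be a scaled projection onto the eigenspace. -/
theorem adjMatrix_mul_cosMatrix {K : Type*} [RCLike K] {θ : ℝ} (hθ : IsEigenvalue G θ) :
    G.adjMatrix K * cosMatrix G K θ = (θ : K) • cosMatrix G K θ := by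
  ext z y
  rw [SimpleGraph.adjMatrix_mul_apply]
  simp only [cosMatrix, of_apply, Matrix.smul_apply, smul_eq_mul]
  rw [H.sum_neighbor (fun d => (cosine G θ d : K))]
  have := congrArg (fun t : ℝ => (t : K)) (H.cosine_rec hθ (H.dist_le z y))
  push_cast at this
  exact this

theorem cosMatrix_eq_sum {K : Type*} [RCLike K] (θ : ℝ) :
    cosMatrix G K θ = ∑ l ∈ range (G.diam + 1), (cosine G θ l : K) • distMatrix G K l := by
  ext z y
  have := H.dist_le z y
  simp only [cosMatrix, distMatrix, of_apply, Matrix.sum_apply, Matrix.smul_apply, smul_eq_mul,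
    mul_ite, mul_one, mul_zero, Finset.sum_ite_eq, mem_range]
  rw [if_pos (by omega)]

theorem cosMatrix_mulVec_mem {K : Type*} [RCLike K] {W : Submodule K (V → K)}
    (hW : ∀ w ∈ W, G.adjMatrix K *ᵥ w ∈ W) (θ : ℝ) {w : V → K} (hw : w ∈ W) :
    cosMatrix G K θ *ᵥ w ∈ W := by
  rw [H.cosMatrix_eq_sum, sum_mulVec]
  refine W.sum_mem fun l _ => ?_
  rw [smul_mulVec]
  exact W.smul_mem _ (H.distMatrix_mulVec_mem hW l hw)

theorem adjMatrix_mulVec_cosMatrix_mulVec {K : Type*} [RCLike K] {θ : ℝ} (hθ : IsEigenvalue G θ)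
    (v : V → K) :
    G.adjMatrix K *ᵥ (cosMatrix G K θ *ᵥ v) = (θ : K) • (cosMatrix G K θ *ᵥ v) := by
  rw [mulVec_mulVec, H.adjMatrix_mul_cosMatrix hθ, smul_mulVec]

/-- The number of eigenvalues in the support of a vector is at most the dimension of any invariant
subspace containing the vector. -/
theorem card_support_le_finrank {K : Type*} [RCLike K] {W : Submodule K (V → K)}
    (hW : ∀ w ∈ W, G.adjMatrix K *ᵥ w ∈ W) {v : V → K} (hv : v ∈ W) :
    #{θ ∈ eigenvalues G | cosMatrix G K θ *ᵥ v ≠ 0} ≤ Module.finrank K W := by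
  set S := {θ ∈ eigenvalues G | cosMatrix G K θ *ᵥ v ≠ 0} with hS
  have hmem : ∀ θ ∈ S, IsEigenvalue G θ ∧ cosMatrix G K θ *ᵥ v ≠ 0 := fun θ hθ => by
    rw [hS, mem_filter, mem_eigenvalues] at hθ
    exact hθ
  -- The nonzero vectors Φ_θ v are eigenvectors for distinct eigenvalues, and they stay in W because
  -- Φ_θ is a combination of distance matrices.
  have hli : LinearIndependent K fun θ : S => cosMatrix G K θ *ᵥ v := by
    refine Module.End.eigenvectors_linearIndependent' (Matrix.toLin' (G.adjMatrix K))
      (fun θ : S => ((θ : ℝ) : K)) (fun x y h => Subtype.ext (RCLike.ofReal_injective h)) _ ?_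
    rintro ⟨θ, hθ⟩
    refine ⟨?_, (hmem θ hθ).2⟩
    rw [Module.End.mem_eigenspace_iff, toLin'_apply,
      H.adjMatrix_mulVec_cosMatrix_mulVec (hmem θ hθ).1]
  have hli' : LinearIndependent K fun θ : S =>
      (⟨cosMatrix G K θ *ᵥ v, H.cosMatrix_mulVec_mem hW θ hv⟩ : W) :=
    LinearIndependent.of_comp W.subtype hli
  have := hli'.fintype_card_le_finrank
  simpa using this

end OddBipartite
end DRG

/-! ### The spectrum: positivity of the cosine matrices, number and symmetry of the eigenvalues. -/

namespace DRG
open Finset Matrix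

variable {V : Type*} [Fintype V] [DecidableEq V] {G : SimpleGraph V} [DecidableRel G.Adj]

theorem exists_eigenbasis (G : SimpleGraph V) [DecidableRel G.Adj] :
    ∃ (e : V → V → ℝ) (lam : V → ℝ), (∀ j, G.adjMatrix ℝ *ᵥ e j = lam j • e j) ∧
      (∀ i j, e i ⬝ᵥ e j = if i = j then 1 else 0) ∧ ∀ v : V → ℝ, v = ∑ j, (e j ⬝ᵥ v) • e j := by
  have hA : (G.adjMatrix ℝ).IsHermitian := by
    rw [IsHermitian, conjTranspose_eq_transpose_of_trivial, SimpleGraph.transpose_adjMatrix]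
  have hip : ∀ a c : EuclideanSpace ℝ V, inner ℝ a c = (⇑a : V → ℝ) ⬝ᵥ ⇑c := by
    intro a c
    simp [PiLp.inner_apply, dotProduct, mul_comm]
  refine ⟨fun j => ⇑(hA.eigenvectorBasis j), hA.eigenvalues,
    fun j => hA.mulVec_eigenvectorBasis j, fun i j => ?_, fun v => ?_⟩
  · rw [← hip, orthonormal_iff_ite.mp hA.eigenvectorBasis.orthonormal]
  · have h := hA.eigenvectorBasis.sum_repr' (WithLp.toLp 2 v)
    have h2 := congrArg (fun u : EuclideanSpace ℝ V => (⇑u : V → ℝ)) h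
    simp only [hip] at h2
    rw [eq_comm]
    convert h2 using 1
    simp

theorem eigenvalue_eq_getElem {i : ℕ} (hi : i < #(eigenvalues G)) :
    eigenvalue G i = ((eigenvalues G).sort (fun s t => t ≤ s))[i]'(by rwa [length_sort]) :=
  List.getD_eq_getElem _ _ _

theorem exists_index_of_mem_eigenvalues {θ : ℝ} (hθ : θ ∈ eigenvalues G) :
    ∃ i < #(eigenvalues G), eigenvalue G i = θ := by
  have h1 : θ ∈ (eigenvalues G).sort (fun s t => t ≤ s) := by rwa [mem_sort]
  obtain ⟨i, hi, h⟩ := List.mem_iff_getElem.mp h1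
  rw [length_sort] at hi
  refine ⟨i, hi, ?_⟩
  rw [← h]
  exact eigenvalue_eq_getElem hi

theorem eigenvalue_mem {i : ℕ} (hi : i < #(eigenvalues G)) : eigenvalue G i ∈ eigenvalues G := by
  have h1 : i < ((eigenvalues G).sort (fun s t => t ≤ s)).length := by rwa [length_sort]
  rw [eigenvalue_eq_getElem hi, ← mem_sort (fun s t => t ≤ s)]
  exact List.getElem_mem h1

theorem eigenvalue_lt {i j : ℕ} (hij : i < j) (hj : j < #(eigenvalues G)) :
    eigenvalue G j < eigenvalue G i := by
  rw [eigenvalue_eq_getElem hj, eigenvalue_eq_getElem (hij.trans hj)]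
  have h4 := List.pairwise_iff_getElem.mp
    (pairwise_sort (eigenvalues G) (fun s t => t ≤ s)) i j (by rw [length_sort]; omega)
    (by rwa [length_sort]) hij
  refine lt_of_le_of_ne h4 fun h => ?_
  have := (List.Nodup.getElem_inj_iff (sort_nodup (eigenvalues G) (fun s t => t ≤ s))).mp h
  omega

theorem dotProduct_adjMatrix_mulVec {K : Type*} [CommRing K] (v w : V → K) :
    v ⬝ᵥ (G.adjMatrix K *ᵥ w) = (G.adjMatrix K *ᵥ v) ⬝ᵥ w := by
  rw [dotProduct_mulVec, ← mulVec_transpose, SimpleGraph.transpose_adjMatrix]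

theorem dotProduct_cosMatrix_mulVec {K : Type*} [RCLike K] (θ : ℝ) (v w : V → K) :
    v ⬝ᵥ (cosMatrix G K θ *ᵥ w) = (cosMatrix G K θ *ᵥ v) ⬝ᵥ w := by
  rw [dotProduct_mulVec, ← mulVec_transpose, cosMatrix_transpose]

namespace OddBipartite

variable (H : OddBipartite G)
include H

/-- The squared norm of the cosine sequence with respect to the sphere sizes. -/
theorem sum_sphereSize_cosine_pos (θ : ℝ) :
    0 < ∑ l ∈ range (G.diam + 1), cosine G θ l * (sphereSize G l * cosine G θ l) := by
  refine Finset.sum_pos' (fun l hl => ?_) ⟨0, by simp, by simp [cosine, sphereSize]⟩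
  have := H.sphereSize_pos (l := l) (by rw [mem_range] at hl; omega)
  nlinarith [mul_nonneg this.le (sq_nonneg (cosine G θ l))]

theorem cosMatrix_mulVec_eigenvector {θ : ℝ} {e : V → ℝ}
    (he : G.adjMatrix ℝ *ᵥ e = θ • e) :
    cosMatrix G ℝ θ *ᵥ e
      = (∑ l ∈ range (G.diam + 1), cosine G θ l * (sphereSize G l * cosine G θ l)) • e := by
  rw [H.cosMatrix_eq_sum, sum_mulVec, sum_smul]
  refine sum_congr rfl fun l hl => ?_
  rw [smul_mulVec, H.distMatrix_mulVec_eigenvector (K := ℝ) (θ := θ) he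
    (by rw [mem_range] at hl; omega), smul_smul]
  rfl

theorem cosMatrix_mul_self {θ : ℝ} (hθ : IsEigenvalue G θ) :
    cosMatrix G ℝ θ * cosMatrix G ℝ θ
      = (∑ l ∈ range (G.diam + 1), cosine G θ l * (sphereSize G l * cosine G θ l)) •
        cosMatrix G ℝ θ := by
  have key : ∀ v : V → ℝ, (cosMatrix G ℝ θ * cosMatrix G ℝ θ) *ᵥ v
      = ((∑ l ∈ range (G.diam + 1), cosine G θ l * (sphereSize G l * cosine G θ l)) •
        cosMatrix G ℝ θ) *ᵥ v := by
    intro v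
    rw [← mulVec_mulVec, H.cosMatrix_mulVec_eigenvector, smul_mulVec]
    exact H.adjMatrix_mulVec_cosMatrix_mulVec hθ v
  exact Matrix.ext_of_mulVec_single fun i => key _

/-- Φ_θ is symmetric and its square is a positive multiple of itself, so it is a positive multiple
of a Gram matrix. -/
theorem cosMatrix_posSemidef {θ : ℝ} (hθ : IsEigenvalue G θ) : (cosMatrix G ℝ θ).PosSemidef := by
  have hc := H.sum_sphereSize_cosine_pos θ
  have h1 : cosMatrix G ℝ θ = (∑ l ∈ range (G.diam + 1),
      cosine G θ l * (sphereSize G l * cosine G θ l))⁻¹ •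
        ((cosMatrix G ℝ θ)ᴴ * cosMatrix G ℝ θ) := by
    rw [conjTranspose_eq_transpose_of_trivial, cosMatrix_transpose, H.cosMatrix_mul_self hθ,
      smul_smul, inv_mul_cancel₀ hc.ne', one_smul]
  rw [h1]
  exact (posSemidef_conjTranspose_mul_self _).smul (inv_nonneg.mpr hc.le)

theorem dotProduct_eigenvector_eq_zero {θ : ℝ} {e v : V → ℝ}
    (he : G.adjMatrix ℝ *ᵥ e = θ • e) (hv : cosMatrix G ℝ θ *ᵥ v = 0) : e ⬝ᵥ v = 0 := by
  have h1 := dotProduct_cosMatrix_mulVec (G := G) θ e v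
  rw [hv, dotProduct_zero, H.cosMatrix_mulVec_eigenvector he, smul_dotProduct, smul_eq_mul] at h1
  exact (mul_eq_zero.mp h1.symm).resolve_left (H.sum_sphereSize_cosine_pos θ).ne'

/-- A Rayleigh-type estimate for the square of the adjacency matrix, with the case of equality. -/
theorem adjMatrix_sq_estimate {s t : ℝ} {v : V → ℝ}
    (h : ∀ θ ∈ eigenvalues G, cosMatrix G ℝ θ *ᵥ v ≠ 0 → 0 ≤ s * (t - θ ^ 2)) :
    0 ≤ s * (t * (v ⬝ᵥ v) - v ⬝ᵥ (G.adjMatrix ℝ *ᵥ (G.adjMatrix ℝ *ᵥ v))) ∧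
    (s ≠ 0 → t * (v ⬝ᵥ v) = v ⬝ᵥ (G.adjMatrix ℝ *ᵥ (G.adjMatrix ℝ *ᵥ v)) →
      G.adjMatrix ℝ *ᵥ (G.adjMatrix ℝ *ᵥ v) = t • v) := by
  obtain ⟨e, lam, he, horth, hexp⟩ := exists_eigenbasis G
  have hne : ∀ j, e j ≠ 0 := by
    intro j hj
    have := horth j j
    simp [hj] at this
  have hmem : ∀ j, lam j ∈ eigenvalues G := fun j => mem_eigenvalues.mpr ⟨e j, hne j, he j⟩
  have hAA : G.adjMatrix ℝ *ᵥ (G.adjMatrix ℝ *ᵥ v)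
      = ∑ j, (lam j ^ 2 * (e j ⬝ᵥ v)) • e j := by
    conv_lhs => rw [hexp v]
    simp only [mulVec_sum, mulVec_smul, he, smul_smul]
    refine sum_congr rfl fun j _ => ?_
    congr 1
    ring
  have hvv : v ⬝ᵥ v = ∑ j, (e j ⬝ᵥ v) ^ 2 := by
    conv_lhs => rw [hexp v]
    rw [sum_dotProduct]
    refine sum_congr rfl fun j _ => ?_
    rw [smul_dotProduct, ← hexp v, smul_eq_mul, sq]
  have hvA : v ⬝ᵥ (G.adjMatrix ℝ *ᵥ (G.adjMatrix ℝ *ᵥ v)) = ∑ j, lam j ^ 2 * (e j ⬝ᵥ v) ^ 2 := by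
    rw [hAA, dotProduct_sum]
    refine sum_congr rfl fun j _ => ?_
    rw [dotProduct_smul, smul_eq_mul, dotProduct_comm v, sq (e j ⬝ᵥ v), mul_assoc]
  -- The sign of s chooses between t as an upper and as a lower bound for the Rayleigh quotient. In
  -- an eigenbasis the terms are nonnegative, so equality kills every coefficient whose squared
  -- eigenvalue differs from t.
  have hdiff : s * (t * (v ⬝ᵥ v) - v ⬝ᵥ (G.adjMatrix ℝ *ᵥ (G.adjMatrix ℝ *ᵥ v)))
      = ∑ j, s * (t - lam j ^ 2) * (e j ⬝ᵥ v) ^ 2 := by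
    rw [hvv, hvA, mul_sum, ← sum_sub_distrib, mul_sum]
    refine sum_congr rfl fun j _ => ?_
    ring
  have hnn : ∀ j ∈ (univ : Finset V), 0 ≤ s * (t - lam j ^ 2) * (e j ⬝ᵥ v) ^ 2 := by
    intro j _
    by_cases h0 : cosMatrix G ℝ (lam j) *ᵥ v = 0
    · rw [H.dotProduct_eigenvector_eq_zero (he j) h0]; simp
    · exact mul_nonneg (h _ (hmem j) h0) (sq_nonneg _)
  refine ⟨hdiff ▸ sum_nonneg hnn, fun hs heq => ?_⟩
  rw [heq, sub_self, mul_zero] at hdiff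
  have hz := (sum_eq_zero_iff_of_nonneg hnn).mp hdiff.symm
  conv_rhs => rw [hexp v]
  rw [hAA, smul_sum]
  refine sum_congr rfl fun j _ => ?_
  rw [smul_smul]
  congr 1
  rcases mul_eq_zero.mp (hz j (mem_univ j)) with h1 | h1
  · rcases mul_eq_zero.mp h1 with h2 | h2
    · exact absurd h2 hs
    · rw [sub_eq_zero.mp h2]
  · rw [pow_eq_zero_iff (by norm_num)] at h1
    rw [h1]; simp

/-- The cyclic space of δ_x is spanned by the D+1 sphere indicators, and every eigenvalue occurs in
δ_x because the x entry of Φ_θ δ_x is 1. -/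
theorem card_eigenvalues_le : #(eigenvalues G) ≤ G.diam + 1 := by
  obtain ⟨x⟩ := H.nonempty
  set W : Submodule ℝ (V → ℝ) := Submodule.span ℝ
    ((range (G.diam + 1)).image fun l => distMatrix G ℝ l *ᵥ Pi.single x 1 : Finset (V → ℝ))
    with hWdef
  have hmem : ∀ l, distMatrix G ℝ l *ᵥ Pi.single x 1 ∈ W := by
    intro l
    by_cases hl : l ≤ G.diam
    · exact Submodule.subset_span (by
        simp only [coe_image, Set.mem_image, mem_coe, mem_range]
        exact ⟨l, by omega, rfl⟩)
    · rw [H.distMatrix_eq_zero (by omega), zero_mulVec]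
      exact W.zero_mem
  have hW : ∀ w ∈ W, G.adjMatrix ℝ *ᵥ w ∈ W := by
    intro w hw
    induction hw using Submodule.span_induction with
    | mem w hw =>
      simp only [coe_image, Set.mem_image, mem_coe, mem_range] at hw
      obtain ⟨l, -, rfl⟩ := hw
      rw [mulVec_mulVec]
      cases l with
      | zero =>
        rw [H.distMatrix_zero, mul_one, ← distMatrix_one]
        exact hmem 1
      | succ l =>
        rw [H.adjMatrix_mul_distMatrix, add_mulVec, smul_mulVec, smul_mulVec]
        exact W.add_mem (W.smul_mem _ (hmem _)) (W.smul_mem _ (hmem _))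
    | zero => rw [mulVec_zero]; exact W.zero_mem
    | add u w _ _ hu hw => rw [mulVec_add]; exact W.add_mem hu hw
    | smul a w _ hw => rw [mulVec_smul]; exact W.smul_mem _ hw
  have h1 := H.card_support_le_finrank hW (v := Pi.single x 1) (by
    have := hmem 0
    rwa [H.distMatrix_zero, one_mulVec] at this)
  have h2 : Module.finrank ℝ W ≤ G.diam + 1 := by
    refine (finrank_span_finset_le_card _).trans ?_
    exact card_image_le.trans (by simp)
  refine le_trans (le_of_eq ?_) (h1.trans h2)
  rw [filter_true_of_mem]
  intro θ _ h0
  have := congrFun h0 x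
  simp [cosMatrix, cosine] at this

/-- With x an endpoint of a diametral pair, the D+1 sphere indicators around x are nonempty and
independent, and all lie in the span of the eigenspace components of δ_x, one for each eigenvalue.
-/
theorem le_card_eigenvalues : G.diam + 1 ≤ #(eigenvalues G) := by
  obtain ⟨x, y, hxy⟩ := H.exists_pair (i := G.diam) le_rfl
  obtain ⟨e, lam, he, horth, hexp⟩ := exists_eigenbasis G
  have hne : ∀ j, e j ≠ 0 := by
    intro j hj
    have := horth j j
    simp [hj] at this
  have hmem : ∀ j, lam j ∈ eigenvalues G := fun j => mem_eigenvalues.mpr ⟨e j, hne j, he j⟩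
  set Psi : ℝ → V → ℝ := fun θ => ∑ j with lam j = θ, (e j ⬝ᵥ Pi.single x 1) • e j with hPsi
  have h1 : ∀ l ≤ G.diam, distMatrix G ℝ l *ᵥ Pi.single x 1 ∈
      Submodule.span ℝ ((eigenvalues G).image Psi : Set (V → ℝ)) := by
    intro l hl
    have h2 : distMatrix G ℝ l *ᵥ Pi.single x 1
        = ∑ θ ∈ eigenvalues G, (sphereSize G l * cosine G θ l) • Psi θ := by
      rw [hexp (Pi.single x 1), mulVec_sum, ← sum_fiberwise_of_maps_to (fun j _ => hmem j)]
      refine sum_congr rfl fun θ _ => ?_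
      rw [hPsi, smul_sum]
      refine sum_congr rfl fun j hj => ?_
      rw [mem_filter] at hj
      rw [mulVec_smul, H.distMatrix_mulVec_eigenvector (K := ℝ) (θ := lam j) (he j) hl,
        smul_comm, hj.2]
      rfl
    rw [h2]
    refine Submodule.sum_mem _ fun θ hθ => Submodule.smul_mem _ _ (Submodule.subset_span ?_)
    rw [mem_coe]
    exact mem_image_of_mem _ hθ
  have hli : LinearIndependent ℝ fun l : Fin (G.diam + 1) =>
      distMatrix G ℝ l *ᵥ (Pi.single x 1 : V → ℝ) := by
    rw [Fintype.linearIndependent_iff]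
    intro g hg i
    obtain ⟨z, hz, -⟩ := H.exists_dist_sub x y (i := i) (by rw [hxy]; omega)
    have := congrFun hg z
    simp only [Finset.sum_apply, Pi.smul_apply, mulVec_single, distMatrix, smul_eq_mul,
      Pi.zero_apply, Matrix.col_apply, of_apply, MulOpposite.op_one, one_smul] at this
    rw [Finset.sum_eq_single i] at this
    · rw [SimpleGraph.dist_comm, hz] at this
      simpa using this
    · intro j _ hj
      rw [SimpleGraph.dist_comm, hz, if_neg, mul_zero]
      exact fun h => hj (Fin.ext h.symm)
    · simp
  have h3 : Module.finrank ℝ (Submodule.span ℝ (Set.range fun l : Fin (G.diam + 1) =>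
      distMatrix G ℝ l *ᵥ (Pi.single x 1 : V → ℝ))) = G.diam + 1 := by
    rw [finrank_span_eq_card hli, Fintype.card_fin]
  rw [← h3]
  refine (Submodule.finrank_mono (Submodule.span_le.mpr ?_)).trans
    ((finrank_span_finset_le_card ((eigenvalues G).image Psi)).trans card_image_le)
  rintro _ ⟨l, rfl⟩
  exact h1 l (by omega)

theorem card_eigenvalues : #(eigenvalues G) = G.diam + 1 :=
  le_antisymm H.card_eigenvalues_le H.le_card_eigenvalues

/-- Changing the sign of an eigenvector on one colour class negates its eigenvalue. -/
theorem neg_mem_eigenvalues {θ : ℝ} (hθ : θ ∈ eigenvalues G) : -θ ∈ eigenvalues G := by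
  obtain ⟨x⟩ := H.nonempty
  rw [mem_eigenvalues] at hθ ⊢
  obtain ⟨e, he0, he⟩ := hθ
  refine ⟨fun z => (-1) ^ G.dist z x * e z, fun h => he0 ?_, ?_⟩
  · ext z
    have := congrFun h z
    simpa using this
  · ext z
    have h1 := congrFun he z
    rw [SimpleGraph.adjMatrix_mulVec_apply] at h1 ⊢
    simp only [Pi.smul_apply, smul_eq_mul] at h1 ⊢
    rw [sum_congr rfl (g := fun w => -(-1) ^ G.dist z x * e w), ← mul_sum, h1]
    · ring
    · intro w hw
      rw [SimpleGraph.mem_neighborFinset] at hw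
      congr 1
      rcases H.dist_adj hw x with h | h <;> rw [h, pow_succ] <;> ring

theorem abs_le_valency {θ : ℝ} (hθ : θ ∈ eigenvalues G) : |θ| ≤ valency G := by
  have := H.nonempty
  obtain ⟨e, he0, he⟩ := mem_eigenvalues.mp hθ
  obtain ⟨z, -, hz⟩ := exists_max_image univ (fun z => |e z|) univ_nonempty
  have hpos : 0 < |e z| := by
    rw [abs_pos]
    intro h0
    apply he0
    ext w
    have := hz w (mem_univ w)
    rw [h0, abs_zero] at this
    simpa using this
  have h1 := congrFun he z
  rw [SimpleGraph.adjMatrix_mulVec_apply, Pi.smul_apply, smul_eq_mul] at h1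
  have h2 : |θ| * |e z| ≤ valency G * |e z| := by
    rw [← abs_mul, ← h1, ← H.degree_eq z, ← nsmul_eq_mul, ← sum_const]
    exact (abs_sum_le_sum_abs _ _).trans (sum_le_sum fun w _ => hz w (mem_univ w))
  exact le_of_mul_le_mul_right h2 hpos

theorem valency_mem_eigenvalues : (valency G : ℝ) ∈ eigenvalues G := by
  obtain ⟨x⟩ := H.nonempty
  rw [mem_eigenvalues]
  refine ⟨fun _ => 1, fun h => by simpa using congrFun h x, ?_⟩
  ext z
  rw [SimpleGraph.adjMatrix_mulVec_apply]
  simp [H.degree_eq z]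

theorem card_neg_eq_card_pos :
    #{θ ∈ eigenvalues G | θ < 0} = #{θ ∈ eigenvalues G | 0 < θ} := by
  refine card_bij' (fun θ _ => -θ) (fun θ _ => -θ) ?_ ?_ (by simp) (by simp)
  · intro θ hθ
    rw [mem_filter] at hθ ⊢
    exact ⟨H.neg_mem_eigenvalues hθ.1, by linarith [hθ.2]⟩
  · intro θ hθ
    rw [mem_filter] at hθ ⊢
    exact ⟨H.neg_mem_eigenvalues hθ.1, by linarith [hθ.2]⟩

theorem card_nonneg_add_card_pos :
    #{θ ∈ eigenvalues G | ¬ θ < 0} + #{θ ∈ eigenvalues G | 0 < θ} = G.diam + 1 := by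
  rw [← H.card_neg_eq_card_pos, ← H.card_eigenvalues, add_comm]
  exact card_filter_add_card_filter_not _

/-- This is the spectral use of odd D: the eigenvalues are symmetric about zero and their number D+1
is even, so zero is not among them. -/
theorem zero_notMem_eigenvalues : (0 : ℝ) ∉ eigenvalues G := by
  intro h0
  have h1 := H.card_nonneg_add_card_pos
  have h2 : {θ ∈ eigenvalues G | ¬ θ < 0} = insert 0 {θ ∈ eigenvalues G | 0 < θ} := by
    ext θ
    simp only [mem_filter, mem_insert, not_lt]
    constructor
    · rintro ⟨h, h'⟩
      rcases h'.eq_or_lt with h'' | h''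
      · exact Or.inl h''.symm
      · exact Or.inr ⟨h, h''⟩
    · rintro (rfl | ⟨h, h'⟩)
      · exact ⟨h0, le_rfl⟩
      · exact ⟨h, h'.le⟩
  rw [h2, card_insert_of_notMem (by simp)] at h1
  obtain ⟨m, hm⟩ := H.odd
  omega

theorem card_pos_eigenvalues : #{θ ∈ eigenvalues G | 0 < θ} = G.diam / 2 + 1 := by
  have h1 := H.card_nonneg_add_card_pos
  have h2 : {θ ∈ eigenvalues G | ¬ θ < 0} = {θ ∈ eigenvalues G | 0 < θ} := by
    refine filter_congr fun θ hθ => ?_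
    rw [not_lt, le_iff_lt_or_eq, or_iff_left]
    rintro rfl
    exact H.zero_notMem_eigenvalues hθ
  rw [h2] at h1
  omega

theorem eigenvalue_mem_of_le {i : ℕ} (hi : i ≤ G.diam) : eigenvalue G i ∈ eigenvalues G :=
  eigenvalue_mem (by rw [H.card_eigenvalues]; omega)

theorem eigenvalue_zero : eigenvalue G 0 = valency G := by
  obtain ⟨i, hi, h⟩ := exists_index_of_mem_eigenvalues H.valency_mem_eigenvalues
  rcases Nat.eq_zero_or_pos i with rfl | h0
  · exact h
  · have h1 := eigenvalue_lt h0 hi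
    have h2 := (abs_le.mp (H.abs_le_valency (H.eigenvalue_mem_of_le (Nat.zero_le _)))).2
    linarith

theorem eigenvalue_one_lt : eigenvalue G 1 < valency G := by
  have h5 := H.five_le
  rw [← H.eigenvalue_zero]
  exact eigenvalue_lt (by norm_num) (by rw [H.card_eigenvalues]; omega)

theorem le_eigenvalue_one {θ : ℝ} (hθ : θ ∈ eigenvalues G) (hne : θ ≠ valency G) :
    θ ≤ eigenvalue G 1 := by
  obtain ⟨i, hi, rfl⟩ := exists_index_of_mem_eigenvalues hθ
  rcases Nat.lt_trichotomy i 1 with h | rfl | h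
  · rw [Nat.lt_one_iff.mp h, H.eigenvalue_zero] at hne
    exact absurd rfl hne
  · exact le_rfl
  · exact (eigenvalue_lt h hi).le

/-- Exactly D/2+1 eigenvalues are positive, so in decreasing order they occupy the positions 0 to
D/2, and the last of these is the least positive one. -/
theorem eigenvalue_half_pos : 0 < eigenvalue G (G.diam / 2) := by
  by_contra hle
  have h1 : {θ ∈ eigenvalues G | 0 < θ} ⊆ (range (G.diam / 2)).image (eigenvalue G) := by
    intro θ hθ
    rw [mem_filter] at hθ
    obtain ⟨i, hi, rfl⟩ := exists_index_of_mem_eigenvalues hθ.1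
    refine mem_image_of_mem _ (mem_range.mpr ?_)
    by_contra h
    rcases (not_lt.mp h).eq_or_lt with h' | h'
    · rw [h'] at hle
      exact hle hθ.2
    · have := eigenvalue_lt h' hi
      linarith [hθ.2]
  have h2 := (card_le_card h1).trans card_image_le
  rw [H.card_pos_eigenvalues, card_range] at h2
  omega

theorem eigenvalue_half_le {θ : ℝ} (hθ : θ ∈ eigenvalues G) (hpos : 0 < θ) :
    eigenvalue G (G.diam / 2) ≤ θ := by
  by_contra hlt
  obtain ⟨i, hi, rfl⟩ := exists_index_of_mem_eigenvalues hθ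
  have hlt' : G.diam / 2 < i := by
    by_contra h
    rcases (not_lt.mp h).eq_or_lt with rfl | h'
    · exact hlt le_rfl
    · have := eigenvalue_lt h' (by rw [H.card_eigenvalues]; omega)
      exact hlt this.le
  have h1 : (range (i + 1)).image (eigenvalue G) ⊆ {θ ∈ eigenvalues G | 0 < θ} := by
    intro θ hθ
    obtain ⟨j, hj, rfl⟩ := mem_image.mp hθ
    rw [mem_range] at hj
    rw [mem_filter]
    refine ⟨eigenvalue_mem (by omega), ?_⟩
    rcases (Nat.lt_succ_iff.mp hj).eq_or_lt with rfl | h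
    · exact hpos
    · exact hpos.trans (eigenvalue_lt h hi)
  have h2 := card_le_card h1
  rw [H.card_pos_eigenvalues, card_image_of_injOn, card_range] at h2
  · omega
  · intro a ha b' hb hab
    simp only [coe_range, Set.mem_Iio] at ha hb
    rcases Nat.lt_trichotomy a b' with h | h | h
    · have := eigenvalue_lt (G := G) h (by omega)
      exact absurd hab this.ne'
    · exact h
    · have := eigenvalue_lt (G := G) h (by omega)
      exact absurd hab this.ne

theorem eigenvalue_half_lt_one : eigenvalue G (G.diam / 2) < eigenvalue G 1 := by
  have h5 := H.five_le
  exact eigenvalue_lt (by omega) (by rw [H.card_eigenvalues]; omega)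

/-- The squares of the nontrivial eigenvalues lie between those of the two extremal ones. -/
theorem sq_bounds {θ : ℝ} (hθ : θ ∈ eigenvalues G) (h1 : θ ≠ valency G) (h2 : θ ≠ -valency G) :
    eigenvalue G (G.diam / 2) ^ 2 ≤ θ ^ 2 ∧ θ ^ 2 ≤ eigenvalue G 1 ^ 2 := by
  have h0 : θ ≠ 0 := fun h => H.zero_notMem_eigenvalues (h ▸ hθ)
  have key : ∀ t ∈ eigenvalues G, t ≠ valency G → 0 < t →
      eigenvalue G (G.diam / 2) ^ 2 ≤ t ^ 2 ∧ t ^ 2 ≤ eigenvalue G 1 ^ 2 := by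
    intro t ht hne hpos
    have h3 := H.eigenvalue_half_le ht hpos
    have h4 := H.le_eigenvalue_one ht hne
    have h5 := H.eigenvalue_half_pos
    constructor <;> gcongr
  rcases lt_or_gt_of_ne h0 with h | h
  · have := key (-θ) (H.neg_mem_eigenvalues hθ) (fun h' => h2 (by linarith)) (by linarith)
    simpa using this
  · exact key θ hθ h1 h

theorem adjMatrix_mulVec_injective {v : V → ℝ} (hv : G.adjMatrix ℝ *ᵥ v = 0) : v = 0 := by
  by_contra h
  exact H.zero_notMem_eigenvalues (mem_eigenvalues.mpr ⟨v, h, by simpa using hv⟩)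

end OddBipartite
end DRG

/-! ### Nonvanishing of cosine differences at the extremal eigenvalues. -/

namespace DRG
open Finset Matrix

variable {V : Type*} [Fintype V] [DecidableEq V] {G : SimpleGraph V} [DecidableRel G.Adj]

/-- The polynomials expressing the sums `A_i + A_{i-2} + ⋯` in terms of the adjacency matrix. -/
noncomputable def partialPoly (G : SimpleGraph V) : ℕ → Polynomial ℝ
  | 0 => 1
  | 1 => Polynomial.X
  | i + 2 => Polynomial.C (c G (i + 2) : ℝ)⁻¹ *
      (Polynomial.X * partialPoly G (i + 1) - Polynomial.C (b G (i + 2) : ℝ) * partialPoly G i)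

/-- The sum of the distance matrices `A_i + A_{i-2} + ⋯`. -/
noncomputable def partialMatrix (G : SimpleGraph V) (i : ℕ) : Matrix V V ℝ :=
  of fun z y => if G.dist z y ≤ i ∧ Even (G.dist z y + i) then 1 else 0

theorem partialPoly_eval_neg (θ : ℝ) (i : ℕ) :
    (partialPoly G i).eval (-θ) = (-1) ^ i * (partialPoly G i).eval θ := by
  induction i using Nat.twoStepInduction with
  | zero => simp [partialPoly]
  | one => simp [partialPoly]
  | more i ih1 ih2 =>
    simp only [partialPoly, Polynomial.eval_mul, Polynomial.eval_C, Polynomial.eval_sub,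
      Polynomial.eval_X, ih1, ih2]
    ring

theorem partialPoly_natDegree_le (i : ℕ) : (partialPoly G i).natDegree ≤ i := by
  induction i using Nat.twoStepInduction with
  | zero => simp [partialPoly]
  | one => simp [partialPoly]
  | more i ih1 ih2 =>
    rw [partialPoly]
    refine (Polynomial.natDegree_C_mul_le _ _).trans ((Polynomial.natDegree_sub_le _ _).trans ?_)
    refine max_le ((Polynomial.natDegree_mul_le).trans ?_)
      ((Polynomial.natDegree_C_mul_le _ _).trans (by omega))
    rw [Polynomial.natDegree_X]
    omega

theorem partialMatrix_add_two (i : ℕ) :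
    partialMatrix G (i + 2) = distMatrix G ℝ (i + 2) + partialMatrix G i := by
  ext z y
  simp only [partialMatrix, distMatrix, of_apply, Matrix.add_apply]
  by_cases h1 : G.dist z y = i + 2
  · have : ¬ (G.dist z y ≤ i) := by omega
    have h2 : G.dist z y ≤ i + 2 := by omega
    have h3 : Even (G.dist z y + (i + 2)) := ⟨i + 2, by omega⟩
    simp [this, h2, h3, h1]
  · rw [if_neg h1, zero_add]
    congr 1
    rw [eq_iff_iff]
    constructor
    · rintro ⟨h2, m, h3⟩
      exact ⟨by omega, m - 1, by omega⟩
    · rintro ⟨h2, m, h3⟩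
      exact ⟨by omega, m + 1, by omega⟩

namespace OddBipartite

variable (H : OddBipartite G)
include H

/-- For a pair at distance at most i (of the right parity) the left side counts all k = c_{i+2} +
b_{i+2} neighbours; at distance i+2 it counts only the c_{i+2} closer ones. -/
theorem adjMatrix_mul_partialMatrix {i : ℕ} (hi : i + 2 ≤ G.diam) :
    G.adjMatrix ℝ * partialMatrix G (i + 1)
      = (c G (i + 2) : ℝ) • partialMatrix G (i + 2) + (b G (i + 2) : ℝ) • partialMatrix G i := by
  ext z y
  rw [SimpleGraph.adjMatrix_mul_apply]
  simp only [partialMatrix, of_apply, Matrix.add_apply, Matrix.smul_apply, smul_eq_mul, mul_ite,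
    mul_one, mul_zero]
  rw [H.sum_neighbor (fun d => if d ≤ i + 1 ∧ Even (d + (i + 1)) then (1 : ℝ) else 0)]
  have hd := H.dist_le z y
  have h1 := H.cast_c_add_b hd
  have h2 := H.cast_c_add_b hi
  set d := G.dist z y
  by_cases hp : Even (d + i)
  · have p1 : Even (d + (i + 2)) := by rw [← add_assoc]; exact hp.add even_two
    have p2 : Even (d + 1 + (i + 1)) := by
      rw [show d + 1 + (i + 1) = d + (i + 2) by ring]; exact p1
    rcases Nat.eq_zero_or_pos d with h0 | h0
    · have hc0 : (c G d : ℝ) = 0 := by rw [h0, H.c_zero]; simp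
      rw [hc0] at h1 ⊢
      simp only [hp, p1, p2, and_true, zero_mul]
      rw [if_pos (by omega), if_pos (by omega), if_pos (by omega)]
      linarith
    · have p3 : Even (d - 1 + (i + 1)) := by
        rw [show d - 1 + (i + 1) = d + i by omega]; exact hp
      simp only [hp, p1, p2, p3, and_true]
      by_cases h3 : d ≤ i
      · rw [if_pos (by omega), if_pos (by omega), if_pos (by omega), if_pos h3]
        linarith
      · by_cases h4 : d = i + 2
        · rw [if_pos (by omega), if_neg (by omega), if_pos (by omega), if_neg h3, h4]
          ring
        · have : d ≠ i + 1 := by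
            rintro h
            rw [h] at hp
            obtain ⟨m, hm⟩ := hp
            omega
          rw [if_neg (by omega), if_neg (by omega), if_neg (by omega), if_neg h3]
          ring
  · have p1 : ¬ Even (d + (i + 2)) := by
      rintro ⟨m, hm⟩; exact hp ⟨m - 1, by omega⟩
    have p2 : ¬ Even (d + 1 + (i + 1)) := by
      rintro ⟨m, hm⟩; exact hp ⟨m - 1, by omega⟩
    have p3 : (c G d : ℝ) * (if d - 1 ≤ i + 1 ∧ Even (d - 1 + (i + 1)) then (1 : ℝ) else 0) = 0 := by
      rcases Nat.eq_zero_or_pos d with h0 | h0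
      · rw [h0, H.c_zero]; simp
      · rw [show d - 1 + (i + 1) = d + i by omega]
        simp [hp]
    rw [p3]
    simp only [p1, p2, hp, and_false, if_false]
    ring

theorem aeval_partialPoly {i : ℕ} (hi : i ≤ G.diam) :
    Polynomial.aeval (G.adjMatrix ℝ) (partialPoly G i) = partialMatrix G i := by
  induction i using Nat.twoStepInduction with
  | zero =>
    ext z y
    rw [partialPoly, map_one, partialMatrix, of_apply, Matrix.one_apply]
    by_cases h : z = y
    · subst h; simp
    · simp [h, H.dist_eq_zero]
  | one =>
    ext z y
    simp only [partialPoly, partialMatrix, Polynomial.aeval_X, SimpleGraph.adjMatrix_apply,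
      of_apply, ← SimpleGraph.dist_eq_one_iff_adj]
    congr 1
    rw [eq_iff_iff]
    constructor
    · intro h; rw [h]; simp
    · rintro ⟨h, m, hm⟩; omega
  | more i ih1 ih2 =>
    rw [partialPoly, map_mul, map_sub, map_mul, map_mul, Polynomial.aeval_X, ih1 (by omega),
      ih2 (by omega), Polynomial.aeval_C, Polynomial.aeval_C, H.adjMatrix_mul_partialMatrix hi,
      ← Algebra.smul_def, ← Algebra.smul_def, add_sub_cancel_right, smul_smul, inv_mul_cancel₀,
      one_smul]
    exact H.cast_c_ne (by omega) hi

theorem partialMatrix_mulVec_eigenvector {θ : ℝ} {e : V → ℝ}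
    (he : G.adjMatrix ℝ *ᵥ e = θ • e) {i : ℕ} (hi : i ≤ G.diam) :
    partialMatrix G i *ᵥ e = (partialPoly G i).eval θ • e := by
  rw [← H.aeval_partialPoly hi]
  have h1 : ∀ q : Polynomial ℝ,
      Polynomial.aeval (G.adjMatrix ℝ) q *ᵥ e = q.eval θ • e := by
    intro q
    induction q using Polynomial.induction_on' with
    | add p q hp hq => rw [map_add, add_mulVec, hp, hq, Polynomial.eval_add, add_smul]
    | monomial n a =>
      induction n with
      | zero => simp [Algebra.algebraMap_eq_smul_one, smul_mulVec]
      | succ n ih =>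
        rw [← Polynomial.monomial_mul_X, map_mul, ← mulVec_mulVec, Polynomial.aeval_X, he,
          mulVec_smul, ih, smul_smul, Polynomial.eval_mul, Polynomial.eval_X, mul_comm]
  exact h1 _

theorem partialPoly_eval_add_two {θ : ℝ} (hθ : IsEigenvalue G θ) {i : ℕ} (hi : i + 2 ≤ G.diam) :
    (partialPoly G (i + 2)).eval θ
      = (partialPoly G i).eval θ + sphereSize G (i + 2) * cosine G θ (i + 2) := by
  obtain ⟨e, he0, he⟩ := hθ
  have h1 := congrArg (· *ᵥ e) (partialMatrix_add_two (G := G) i)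
  simp only [add_mulVec] at h1
  rw [H.partialMatrix_mulVec_eigenvector he hi, H.partialMatrix_mulVec_eigenvector he (by omega),
    H.distMatrix_mulVec_eigenvector (K := ℝ) he hi, ← add_smul] at h1
  have := smul_left_injective ℝ he0 h1
  simp only [RCLike.ofReal_real_eq_id, id] at this
  linarith

/-- Reduces the nonvanishing of cosine differences to that of `partialPoly`. The two-step induction
combines the recurrences at three consecutive levels. -/
theorem cosine_sub_cosine {θ : ℝ} (hθ : IsEigenvalue G θ) {i : ℕ} (hi : i + 2 ≤ G.diam) :
    sphereSize G i * b G i * b G (i + 1) * (cosine G θ i - cosine G θ (i + 2))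
      = ((valency G : ℝ) ^ 2 - θ ^ 2) * (partialPoly G i).eval θ := by
  have h5 := H.five_le
  have hk := H.cast_valency_ge
  have hb0 : (b G 0 : ℝ) = valency G := rfl
  have r0 : (valency G : ℝ) * cosine G θ 1 = θ := by
    simp only [cosine]; field_simp
  have r1 := H.cosine_rec hθ (i := 1) (by omega)
  have r2 := H.cosine_rec hθ (i := 2) (by omega)
  have a1 := H.cast_c_add_b (i := 1) (by omega)
  have a2 := H.cast_c_add_b (i := 2) (by omega)
  have c1 : (c G 1 : ℝ) = 1 := by rw [H.c_one]; simp
  simp only [Nat.sub_self, Nat.reduceSub, Nat.reduceAdd, c1] at r1 r2 a1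
  have z0 : cosine G θ 0 = 1 := rfl
  induction i using Nat.twoStepInduction with
  | zero =>
    simp only [partialPoly, Polynomial.eval_one, sphereSize, zero_add, hb0, z0] at *
    linear_combination (-(valency G : ℝ)) * r1 - θ * r0 + (valency G : ℝ) * a1
  | one =>
    have s1 := H.sphereSize_succ (l := 0) (by omega)
    simp only [zero_add, c1, hb0, sphereSize] at s1
    simp only [partialPoly, Polynomial.eval_X, Nat.reduceAdd, z0, sphereSize, zero_add, c1,
      hb0] at *
    linear_combination (-(valency G : ℝ) * b G 1) * r2 + (valency G : ℝ) * b G 1 * a2 * cosine G θ 1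
      - θ * valency G * r1 - θ ^ 2 * r0 + (valency G : ℝ) * θ * a1
        + (valency G : ℝ) * (b G 1) * r0
  | more i ih1 ih2 =>
    have e1 := H.sphereSize_succ (l := i) (by omega)
    have e2 := H.sphereSize_succ (l := i + 1) (by omega)
    have q1 := H.cosine_rec hθ (i := i + 1) (by omega)
    have q2 := H.cosine_rec hθ (i := i + 2) (by omega)
    have q3 := H.cosine_rec hθ (i := i + 3) (by omega)
    have t1 := H.cast_c_add_b (i := i + 1) (by omega)
    have t2 := H.cast_c_add_b (i := i + 2) (by omega)
    have t3 := H.cast_c_add_b (i := i + 3) (by omega)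
    have ih := ih1 (by omega)
    have hs := H.partialPoly_eval_add_two hθ (i := i) (by omega)
    simp only [Nat.add_sub_cancel, Nat.reduceAdd, add_assoc,
      show i + 2 - 1 = i + 1 by omega, show i + 3 - 1 = i + 2 by omega] at *
    rw [hs, mul_add, ← ih]
    have key : (b G (i + 2) : ℝ) * b G (i + 3) * (cosine G θ (i + 2) - cosine G θ (i + 4))
        = c G (i + 2) * c G (i + 1) * (cosine G θ i - cosine G θ (i + 2))
          + ((valency G : ℝ) ^ 2 - θ ^ 2) * cosine G θ (i + 2) := by
      linear_combination (-(b G (i + 2) : ℝ)) * q3 - θ * q2 - (c G (i + 2) : ℝ) * q1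
        + (b G (i + 2) : ℝ) * cosine G θ (i + 2) * t3 + (c G (i + 2) : ℝ) * cosine G θ (i + 2) * t1
        + (valency G : ℝ) * cosine G θ (i + 2) * t2
    linear_combination sphereSize G (i + 2) * key
      + (c G (i + 1) : ℝ) * (cosine G θ i - cosine G θ (i + 2)) * e2
      + (b G (i + 1) : ℝ) * (cosine G θ i - cosine G θ (i + 2)) * e1

theorem cosine_valency {l : ℕ} (hl : l ≤ G.diam) : cosine G (valency G) l = 1 := by
  have hk := H.cast_valency_ge
  induction l using Nat.twoStepInduction with
  | zero => rfl
  | one => simp only [cosine]; field_simp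
  | more l ih1 ih2 =>
    have h1 := H.cosine_succ_succ (θ := valency G) (l := l) (by omega)
    have h2 := H.cast_c_add_b (i := l + 1) (by omega)
    have h3 := H.cast_b_pos (i := l + 1) (by omega)
    rw [ih1 (by omega), ih2 (by omega)] at h1
    apply mul_left_cancel₀ h3.ne'
    linarith

theorem cosine_neg_valency {l : ℕ} (hl : l ≤ G.diam) : cosine G (-valency G) l = (-1) ^ l := by
  have hk := H.cast_valency_ge
  induction l using Nat.twoStepInduction with
  | zero => simp [cosine]
  | one => simp only [cosine]; field_simp
  | more l ih1 ih2 =>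
    have h1 := H.cosine_succ_succ (θ := -valency G) (l := l) (by omega)
    have h2 := H.cast_c_add_b (i := l + 1) (by omega)
    have h3 := H.cast_b_pos (i := l + 1) (by omega)
    rw [ih1 (by omega), ih2 (by omega)] at h1
    apply mul_left_cancel₀ h3.ne'
    rw [pow_succ] at h1
    rw [pow_succ, pow_succ]
    linear_combination h1 - (-1) ^ l * h2

theorem cosMatrix_mul_adjMatrix {θ : ℝ} (hθ : IsEigenvalue G θ) :
    cosMatrix G ℝ θ * G.adjMatrix ℝ = θ • cosMatrix G ℝ θ := by
  have := congrArg transpose (H.adjMatrix_mul_cosMatrix (K := ℝ) hθ)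
  rw [transpose_mul, cosMatrix_transpose, SimpleGraph.transpose_adjMatrix, transpose_smul,
    cosMatrix_transpose] at this
  exact this

theorem cosMatrix_mulVec_aeval_eq_zero {θ : ℝ} (hθ : IsEigenvalue G θ) {w : V → ℝ}
    (hw : cosMatrix G ℝ θ *ᵥ w = 0) (q : Polynomial ℝ) :
    cosMatrix G ℝ θ *ᵥ (Polynomial.aeval (G.adjMatrix ℝ) q *ᵥ w) = 0 := by
  induction q using Polynomial.induction_on' with
  | add p q hp hq => rw [map_add, add_mulVec, mulVec_add, hp, hq, add_zero]
  | monomial n a =>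
    induction n with
    | zero => simp [Algebra.algebraMap_eq_smul_one, smul_mulVec, mulVec_smul, hw]
    | succ n ih =>
      rw [← Polynomial.X_mul_monomial, map_mul, ← mulVec_mulVec, Polynomial.aeval_X, mulVec_mulVec,
        H.cosMatrix_mul_adjMatrix hθ, smul_mulVec, ih, smul_zero]

/-- A vector orthogonal to the trivial eigenspaces attains the extremal values of the Rayleigh
quotient of `A²` only if it is an eigenvector. -/
theorem adjMatrix_sq_eq_of_extremal {θ : ℝ}
    (hθ : θ = eigenvalue G 1 ∨ θ = eigenvalue G (G.diam / 2)) {v : V → ℝ}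
    (h1 : cosMatrix G ℝ (valency G) *ᵥ v = 0) (h2 : cosMatrix G ℝ (-valency G) *ᵥ v = 0)
    (h : θ ^ 2 * (v ⬝ᵥ v) = v ⬝ᵥ (G.adjMatrix ℝ *ᵥ (G.adjMatrix ℝ *ᵥ v))) :
    G.adjMatrix ℝ *ᵥ (G.adjMatrix ℝ *ᵥ v) = θ ^ 2 • v := by
  have hb : ∀ t ∈ eigenvalues G, cosMatrix G ℝ t *ᵥ v ≠ 0 →
      eigenvalue G (G.diam / 2) ^ 2 ≤ t ^ 2 ∧ t ^ 2 ≤ eigenvalue G 1 ^ 2 := by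
    intro t ht hne
    exact H.sq_bounds ht (by rintro rfl; exact hne h1) (by rintro rfl; exact hne h2)
  rcases hθ with rfl | rfl
  · exact (H.adjMatrix_sq_estimate (s := 1) (t := eigenvalue G 1 ^ 2) (v := v)
      (fun t ht hne => by linarith [(hb t ht hne).2])).2 one_ne_zero h
  · exact (H.adjMatrix_sq_estimate (s := -1) (t := eigenvalue G (G.diam / 2) ^ 2) (v := v)
      (fun t ht hne => by linarith [(hb t ht hne).1])).2 (by norm_num) h

theorem aeval_mulVec_single_eq_zero {q : Polynomial ℝ} {u z : V}
    (h : q.natDegree < G.dist z u) :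
    (Polynomial.aeval (G.adjMatrix ℝ) q *ᵥ Pi.single u 1) z = 0 := by
  have key : ∀ (n : ℕ) (z : V), n < G.dist z u →
      ((G.adjMatrix ℝ) ^ n *ᵥ Pi.single u 1) z = 0 := by
    intro n
    induction n with
    | zero =>
      intro z hz
      rw [pow_zero, one_mulVec, Pi.single_eq_of_ne]
      rintro rfl
      simp at hz
    | succ n ih =>
      intro z hz
      rw [pow_succ', ← mulVec_mulVec, SimpleGraph.adjMatrix_mulVec_apply]
      refine sum_eq_zero fun w hw => ih w ?_
      rw [SimpleGraph.mem_neighborFinset] at hw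
      have := H.dist_adj hw u
      omega
  rw [Polynomial.aeval_eq_sum_range, sum_mulVec, Finset.sum_apply]
  refine sum_eq_zero fun n hn => ?_
  rw [mem_range] at hn
  rw [smul_mulVec, Pi.smul_apply, key n z (by omega), smul_zero]

omit H in
theorem partialMatrix_mulVec_sub_single (u u' z : V) (i : ℕ) :
    (partialMatrix G i *ᵥ (Pi.single u 1 - Pi.single u' 1)) z
      = (if G.dist z u ≤ i ∧ Even (G.dist z u + i) then 1 else 0)
        - (if G.dist z u' ≤ i ∧ Even (G.dist z u' + i) then 1 else 0) := by
  simp [partialMatrix, mulVec_sub]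

/-- The entries of Φ_k and Φ_{-k} are 1 and ±1 according to colour, and two neighbours of x have the
same colour, so their columns agree. -/
theorem cosMatrix_mulVec_sub_single {x u u' : V} (hu : G.Adj x u) (hu' : G.Adj x u') :
    cosMatrix G ℝ (valency G) *ᵥ (Pi.single u 1 - Pi.single u' 1) = 0 ∧
    cosMatrix G ℝ (-valency G) *ᵥ (Pi.single u 1 - Pi.single u' 1) = 0 := by
  constructor
  · ext z
    simp [mulVec_sub, cosMatrix, H.cosine_valency (H.dist_le _ _)]
  · ext z
    simp only [mulVec_sub, cosMatrix, Matrix.mulVec_single, Pi.sub_apply, Pi.zero_apply,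
      MulOpposite.op_one, one_smul, Matrix.col_apply, of_apply, H.cosine_neg_valency (H.dist_le _ _)]
    have h1 := H.dist_adj hu z
    have h2 := H.dist_adj hu' z
    rw [SimpleGraph.dist_comm (u := z), SimpleGraph.dist_comm (u := z)]
    rcases h1 with h | h <;> rcases h2 with h' | h'
    · rw [show G.dist u z = G.dist u' z by omega]; simp
    · rw [show G.dist u' z = G.dist u z + 2 by omega, pow_add]; simp
    · rw [show G.dist u z = G.dist u' z + 2 by omega, pow_add]; simp
    · rw [show G.dist u z = G.dist u' z by omega]; simp

/-- The partial sums of the polynomials of the graph do not vanish at the extremal eigenvalues. -/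
theorem partialPoly_eval_ne_zero {θ : ℝ}
    (hθ : θ = eigenvalue G 1 ∨ θ = eigenvalue G (G.diam / 2)) {i : ℕ} (hi : i + 2 ≤ G.diam) :
    (partialPoly G i).eval θ ≠ 0 := by
  have h5 := H.five_le
  have hθ0 : θ ≠ 0 := by
    have h1 := H.eigenvalue_half_pos
    have h2 := H.eigenvalue_half_lt_one
    rcases hθ with rfl | rfl
    · linarith
    · linarith
  intro h0
  have hneg : (partialPoly G i).eval (-θ) = 0 := by rw [partialPoly_eval_neg, h0, mul_zero]
  have hcop : IsCoprime (Polynomial.X - Polynomial.C θ) (Polynomial.X - Polynomial.C (-θ)) := by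
    apply Polynomial.isCoprime_X_sub_C_of_isUnit_sub
    rw [isUnit_iff_ne_zero]
    intro h
    exact hθ0 (by linarith)
  -- By parity of the polynomial, -θ is a root together with θ, and X² - θ² divides it.
  obtain ⟨q, hq⟩ := hcop.mul_dvd (Polynomial.dvd_iff_isRoot.mpr h0)
    (Polynomial.dvd_iff_isRoot.mpr hneg)
  obtain ⟨x, z, hxz⟩ := H.exists_pair (i := i + 1) (by omega)
  -- The neighbours u and u' of x lie at distances i and i+2 from z, so `partialMatrix G i`
  -- separates them at z and does not kill w.
  obtain ⟨u, hu, huz⟩ := H.exists_adj_closer (z := x) (y := z) (by rintro rfl; simp at hxz)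
  obtain ⟨u', hu', huz'⟩ := H.exists_adj_farther (z := x) (y := z) (by omega)
  set w : V → ℝ := Pi.single u 1 - Pi.single u' 1 with hw
  set y := Polynomial.aeval (G.adjMatrix ℝ) q *ᵥ w with hy
  have hPw : partialMatrix G i *ᵥ w
      = G.adjMatrix ℝ *ᵥ (G.adjMatrix ℝ *ᵥ y) - θ ^ 2 • y := by
    rw [← H.aeval_partialPoly (by omega), hq, hy]
    have : (Polynomial.X - Polynomial.C θ) * (Polynomial.X - Polynomial.C (-θ)) * q
        = Polynomial.X * (Polynomial.X * q) - Polynomial.C (θ ^ 2) * q := by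
      rw [Polynomial.C_neg, Polynomial.C_pow]; ring
    rw [this, map_sub, map_mul, map_mul, map_mul, Polynomial.aeval_X, Polynomial.aeval_C,
      ← Algebra.smul_def, sub_mulVec, smul_mulVec, mulVec_mulVec, mulVec_mulVec,
      mul_assoc]
  have hne : partialMatrix G i *ᵥ w ≠ 0 := by
    intro h
    have := congrFun h z
    rw [hw, partialMatrix_mulVec_sub_single] at this
    rw [SimpleGraph.dist_comm (u := z), SimpleGraph.dist_comm (u := z),
      if_pos ⟨by omega, i, by omega⟩, if_neg (by omega)] at this
    norm_num at this
  have hqdeg : q.natDegree + 2 ≤ i := by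
    have hq0 : q ≠ 0 := by
      rintro rfl
      rw [mul_zero] at hq
      apply hne
      rw [← H.aeval_partialPoly (by omega), hq, map_zero, zero_mulVec]
    have h1 := partialPoly_natDegree_le (G := G) i
    rw [hq, Polynomial.natDegree_mul (mul_ne_zero (Polynomial.X_sub_C_ne_zero _)
      (Polynomial.X_sub_C_ne_zero _)) hq0, Polynomial.natDegree_mul (Polynomial.X_sub_C_ne_zero _)
      (Polynomial.X_sub_C_ne_zero _), Polynomial.natDegree_X_sub_C,
      Polynomial.natDegree_X_sub_C] at h1
    omega
  -- The two factors have disjoint supports. Where both distances to u and u' are at least i-1, y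
  -- vanishes because q has degree at most i-2. Elsewhere the distances are equal, or both at most i
  -- with the same parity, and the two indicators in the first factor cancel.
  have horth : (partialMatrix G i *ᵥ w) ⬝ᵥ y = 0 := by
    refine sum_eq_zero fun a _ => ?_
    have h1 := H.dist_adj hu a
    have h2 := H.dist_adj hu' a
    rw [SimpleGraph.dist_comm (u := u), SimpleGraph.dist_comm (u := x)] at h1
    rw [SimpleGraph.dist_comm (u := u'), SimpleGraph.dist_comm (u := x)] at h2
    by_cases h3 : G.dist a u = G.dist a u'
    · rw [hw, partialMatrix_mulVec_sub_single, h3, sub_self, zero_mul]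
    · by_cases h4 : i ≤ G.dist a u + 1 ∧ i ≤ G.dist a u' + 1
      · have hya : y a = 0 := by
          rw [hy, hw, mulVec_sub, Pi.sub_apply, H.aeval_mulVec_single_eq_zero (by omega),
            H.aeval_mulVec_single_eq_zero (by omega), sub_zero]
        rw [hya, mul_zero]
      · rw [hw, partialMatrix_mulVec_sub_single]
        have h6 : (G.dist a u ≤ i ∧ Even (G.dist a u + i)) ↔
            (G.dist a u' ≤ i ∧ Even (G.dist a u' + i)) := by
          rw [Nat.even_iff, Nat.even_iff]
          omega
        simp only [h6, sub_self, zero_mul]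
  have hS : ∀ {t : ℝ}, t ∈ eigenvalues G → IsEigenvalue G t := fun h => mem_eigenvalues.mp h
  have htriv := H.cosMatrix_mulVec_sub_single hu hu'
  -- Orthogonality says that y has Rayleigh quotient θ² for A². As y avoids the trivial eigenspaces
  -- and θ² is extremal there, A² y = θ² y, so w would be killed after all.
  apply hne
  rw [hPw, sub_eq_zero]
  refine H.adjMatrix_sq_eq_of_extremal hθ
    (H.cosMatrix_mulVec_aeval_eq_zero (hS H.valency_mem_eigenvalues) htriv.1 q)
    (H.cosMatrix_mulVec_aeval_eq_zero (hS (H.neg_mem_eigenvalues H.valency_mem_eigenvalues))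
      htriv.2 q) ?_
  rw [hPw, sub_dotProduct, smul_dotProduct, smul_eq_mul, dotProduct_comm] at horth
  linarith

theorem isEigenvalue_extremal {θ : ℝ}
    (hθ : θ = eigenvalue G 1 ∨ θ = eigenvalue G (G.diam / 2)) : IsEigenvalue G θ := by
  have h5 := H.five_le
  rcases hθ with rfl | rfl
  · exact mem_eigenvalues.mp (H.eigenvalue_mem_of_le (by omega))
  · exact mem_eigenvalues.mp (H.eigenvalue_mem_of_le (by omega))

theorem extremal_pos_lt {θ : ℝ}
    (hθ : θ = eigenvalue G 1 ∨ θ = eigenvalue G (G.diam / 2)) : 0 < θ ∧ θ < valency G := by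
  have h1 := H.eigenvalue_half_pos
  have h2 := H.eigenvalue_half_lt_one
  have h3 := H.eigenvalue_one_lt
  rcases hθ with rfl | rfl
  · exact ⟨h1.trans h2, h3⟩
  · exact ⟨h1, h2.trans h3⟩

/-- These differences are the coefficients in `smul_lowerVec_eq`, which later have to be inverted.
-/
theorem cosine_ne_cosine {θ : ℝ}
    (hθ : θ = eigenvalue G 1 ∨ θ = eigenvalue G (G.diam / 2)) {i : ℕ} (hi : i + 2 ≤ G.diam) :
    cosine G θ i ≠ cosine G θ (i + 2) := by
  intro h
  have h1 := H.cosine_sub_cosine (H.isEigenvalue_extremal hθ) hi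
  rw [h, sub_self, mul_zero] at h1
  rcases mul_eq_zero.mp h1.symm with h2 | h2
  · have := H.extremal_pos_lt hθ
    nlinarith
  · exact H.partialPoly_eval_ne_zero hθ hi h2

theorem adjMatrix_sq_mulVec {K : Type*} [CommRing K] (v : V → K) :
    G.adjMatrix K *ᵥ (G.adjMatrix K *ᵥ v)
      = (c G 2 : K) • (distMatrix G K 2 *ᵥ v) + (valency G : K) • v := by
  have h1 := congrArg (· *ᵥ v) (H.adjMatrix_mul_distMatrix (K := K) 0)
  simp only [add_mulVec, smul_mulVec, ← mulVec_mulVec] at h1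
  rw [zero_add, zero_add, distMatrix_one, H.distMatrix_zero, one_mulVec] at h1
  exact h1

/-- `partialPoly G 2` is (X² - b_2)/c_2. -/
theorem b_two_ne_sq {θ : ℝ}
    (hθ : θ = eigenvalue G 1 ∨ θ = eigenvalue G (G.diam / 2)) : θ ^ 2 ≠ b G 2 := by
  have h5 := H.five_le
  intro h
  apply H.partialPoly_eval_ne_zero hθ (i := 2) (by omega)
  simp only [partialPoly, Polynomial.eval_mul, Polynomial.eval_C, Polynomial.eval_sub,
    Polynomial.eval_X, Polynomial.eval_one, zero_add]
  rw [← h]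
  ring

/-- For two vertices at distance two, the difference of their indicators avoids the trivial
eigenspaces and has Rayleigh quotient k - c_2 = b_2 for A². Strictness comes from `b_two_ne_sq`. -/
theorem eigenvalue_half_sq_lt_and_lt_eigenvalue_one_sq :
    eigenvalue G (G.diam / 2) ^ 2 < b G 2 ∧ (b G 2 : ℝ) < eigenvalue G 1 ^ 2 := by
  have h5 := H.five_le
  obtain ⟨u, u', huu⟩ := H.exists_pair (i := 2) (by omega)
  obtain ⟨x, hx, hxu⟩ := H.exists_adj_closer (z := u) (y := u') (by rintro rfl; simp at huu)
  have hx' : G.Adj x u' := by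
    rw [← SimpleGraph.dist_eq_one_iff_adj]; omega
  set w : V → ℝ := Pi.single u 1 - Pi.single u' 1 with hw
  have htriv := H.cosMatrix_mulVec_sub_single hx.symm hx'
  have hne : u ≠ u' := by rintro rfl; simp at huu
  have hww : w ⬝ᵥ w = 2 := by
    simp [hw, hne, hne.symm]
    norm_num
  have hwA : w ⬝ᵥ (G.adjMatrix ℝ *ᵥ (G.adjMatrix ℝ *ᵥ w)) = 2 * b G 2 := by
    have ha := H.cast_c_add_b (i := 2) (by omega)
    rw [H.adjMatrix_sq_mulVec, dotProduct_add, dotProduct_smul, dotProduct_smul, hww]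
    have : w ⬝ᵥ (distMatrix G ℝ 2 *ᵥ w) = -2 := by
      simp [hw, mulVec_sub, distMatrix, huu, SimpleGraph.dist_comm (u := u') (v := u)]
      norm_num
    rw [this, smul_eq_mul, smul_eq_mul]
    linarith
  have hb : ∀ t ∈ eigenvalues G, cosMatrix G ℝ t *ᵥ w ≠ 0 →
      eigenvalue G (G.diam / 2) ^ 2 ≤ t ^ 2 ∧ t ^ 2 ≤ eigenvalue G 1 ^ 2 := by
    intro t ht hne
    exact H.sq_bounds ht (by rintro rfl; exact hne htriv.1) (by rintro rfl; exact hne htriv.2)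
  have e1 := (H.adjMatrix_sq_estimate (s := 1) (t := eigenvalue G 1 ^ 2) (v := w)
      (fun t ht hne => by linarith [(hb t ht hne).2])).1
  have e2 := (H.adjMatrix_sq_estimate (s := -1) (t := eigenvalue G (G.diam / 2) ^ 2) (v := w)
      (fun t ht hne => by linarith [(hb t ht hne).1])).1
  rw [hww, hwA] at e1 e2
  constructor
  · exact lt_of_le_of_ne (by linarith) (H.b_two_ne_sq (Or.inr rfl))
  · exact lt_of_le_of_ne (by linarith) (H.b_two_ne_sq (Or.inl rfl)).symm

end OddBipartite
end DRG

/-! ### The local space and the quadratic forms Q_θ on it. -/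

namespace DRG
open Finset Matrix

variable {V : Type*} [Fintype V] [DecidableEq V] {G : SimpleGraph V} [DecidableRel G.Adj]

/-- The restriction of a vector to the vertices at distance `i` from `x`. -/
noncomputable def levelPart (G : SimpleGraph V) {K : Type*} [Semiring K] (x : V) (i : ℕ) :
    (V → K) →ₗ[K] (V → K) where
  toFun v z := if G.dist x z = i then v z else 0
  map_add' v w := by ext z; simp only [Pi.add_apply]; split_ifs <;> simp
  map_smul' a v := by ext z; simp

theorem levelPart_apply {K : Type*} [Semiring K] (x : V) (i : ℕ) (v : V → K) (z : V) :
    levelPart G x i v z = if G.dist x z = i then v z else 0 := rfl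

/-- The vectors supported on the second subconstituent with respect to `x` and killed by the
lowering map to the first one. -/
noncomputable def localSpace (G : SimpleGraph V) [DecidableRel G.Adj] (K : Type*) [CommRing K]
    (x : V) : Submodule K (V → K) where
  carrier := {v | levelPart G x 2 v = v ∧ ∀ u, G.Adj x u → (G.adjMatrix K *ᵥ v) u = 0}
  add_mem' := by
    rintro v w ⟨h1, h2⟩ ⟨h3, h4⟩
    refine ⟨by rw [map_add, h1, h3], fun u hu => ?_⟩
    rw [mulVec_add, Pi.add_apply, h2 u hu, h4 u hu, add_zero]
  zero_mem' := ⟨map_zero _, fun u _ => by simp⟩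
  smul_mem' := by
    rintro a v ⟨h1, h2⟩
    refine ⟨by rw [map_smul, h1], fun u hu => ?_⟩
    rw [mulVec_smul, Pi.smul_apply, h2 u hu, smul_zero]

theorem apply_eq_zero_of_mem_localSpace {K : Type*} [CommRing K] {x : V} {v : V → K}
    (hv : v ∈ localSpace G K x) {z : V} (hz : G.dist x z ≠ 2) : v z = 0 := by
  rw [← hv.1, levelPart_apply, if_neg hz]

/-- The adjacency map of the local graph: distance two inside the second subconstituent. -/
noncomputable def localMap (G : SimpleGraph V) (K : Type*) [CommRing K] (x : V) :
    (V → K) →ₗ[K] (V → K) :=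
  levelPart G x 2 ∘ₗ (distMatrix G K 2).mulVecLin

/-- A linear polynomial in the local adjacency map attached to a real number `θ`. -/
noncomputable def localQuad (G : SimpleGraph V) (K : Type*) [RCLike K] (x : V) (θ : ℝ) :
    (V → K) →ₗ[K] (V → K) :=
  (((b G 2 : ℝ) * b G 3 + (θ ^ 2 - b G 2) : ℝ) : K) • LinearMap.id
    + ((θ ^ 2 - b G 2 : ℝ) : K) • localMap G K x

theorem localQuad_apply {K : Type*} [RCLike K] (x : V) (θ : ℝ) (v : V → K) :
    localQuad G K x θ v = (((b G 2 : ℝ) * b G 3 + (θ ^ 2 - b G 2) : ℝ) : K) • v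
      + ((θ ^ 2 - b G 2 : ℝ) : K) • localMap G K x v := rfl

theorem localQuad_comm {K : Type*} [RCLike K] (x : V) (θ φ : ℝ) (v : V → K) :
    localQuad G K x θ (localQuad G K x φ v) = localQuad G K x φ (localQuad G K x θ v) := by
  simp only [localQuad_apply, map_add, map_smul, smul_add, smul_smul]
  ext z
  simp only [Pi.add_apply, Pi.smul_apply, smul_eq_mul]
  ring

theorem levelPart_dotProduct {K : Type*} [CommRing K] (x : V) (i : ℕ) (v w : V → K) :
    levelPart G x i v ⬝ᵥ w = v ⬝ᵥ levelPart G x i w := by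
  simp [dotProduct, levelPart_apply]

theorem distMatrix_dotProduct {K : Type*} [CommRing K] (l : ℕ) (v w : V → K) :
    (distMatrix G K l *ᵥ v) ⬝ᵥ w = v ⬝ᵥ (distMatrix G K l *ᵥ w) := by
  rw [dotProduct_mulVec, ← mulVec_transpose, distMatrix_transpose]

theorem localMap_dotProduct {K : Type*} [CommRing K] {x : V} {v w : V → K}
    (hv : levelPart G x 2 v = v) (hw : levelPart G x 2 w = w) :
    localMap G K x v ⬝ᵥ w = v ⬝ᵥ localMap G K x w := by
  simp only [localMap, LinearMap.comp_apply, mulVecLin_apply]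
  rw [levelPart_dotProduct, hw, distMatrix_dotProduct, ← levelPart_dotProduct, hv]

namespace OddBipartite

variable (H : OddBipartite G)
include H

/-- The entries of a vector of the local space sum to zero. -/
theorem sum_eq_zero_of_mem_localSpace {K : Type*} [RCLike K] {x : V} {v : V → K}
    (hv : v ∈ localSpace G K x) : ∑ y, v y = 0 := by
  have h5 := H.five_le
  have h1 := congrFun (H.adjMatrix_sq_mulVec v) x
  rw [SimpleGraph.adjMatrix_mulVec_apply, sum_eq_zero (fun u hu => hv.2 u (by simpa using hu)),
    Pi.add_apply, Pi.smul_apply, Pi.smul_apply, apply_eq_zero_of_mem_localSpace hv (by simp),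
    smul_zero, add_zero, distMatrix_mulVec_apply] at h1
  have h2 : ∑ y, v y = ∑ y, if G.dist x y = 2 then v y else 0 := by
    refine sum_congr rfl fun y _ => ?_
    exact (congrFun hv.1 y).symm
  rw [h2]
  exact (smul_eq_zero.mp h1.symm).resolve_left (H.cast_c_ne (by norm_num) (by omega))

/-- On a vertex of the `i`-th subconstituent with `i ≥ 2`, three distance matrices applied to a
vector of the local space add up to zero. -/
theorem distMatrix_add_add {K : Type*} [RCLike K] {x : V} {v : V → K}
    (hv : v ∈ localSpace G K x) {z : V} {i : ℕ} (hi : 2 ≤ i) (hz : G.dist x z = i) :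
    (distMatrix G K (i - 2) *ᵥ v) z + (distMatrix G K i *ᵥ v) z
      + (distMatrix G K (i + 2) *ᵥ v) z = 0 := by
  simp only [distMatrix_mulVec_apply]
  rw [← sum_add_distrib, ← sum_add_distrib]
  refine Eq.trans (sum_congr rfl fun y _ => ?_) (H.sum_eq_zero_of_mem_localSpace hv)
  by_cases hy : G.dist x y = 2
  · have h1 := H.dist_triangle x y z
    have h2 := H.dist_triangle y x z
    have h3 := H.dist_triangle x z y
    obtain ⟨m, h4⟩ := H.even_dist_add x y z
    rw [SimpleGraph.dist_comm (u := z)] at *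
    rw [SimpleGraph.dist_comm (u := y) (v := x)] at h2
    have : G.dist y z = i - 2 ∨ G.dist y z = i ∨ G.dist y z = i + 2 := by omega
    rcases this with h | h | h <;> rw [h]
    · rw [if_pos rfl, if_neg (by omega), if_neg (by omega)]; simp
    · rw [if_neg (by omega), if_pos rfl, if_neg (by omega)]; simp
    · rw [if_neg (by omega), if_neg (by omega), if_pos rfl]; simp
  · rw [apply_eq_zero_of_mem_localSpace hv hy]; simp

/-- A neighbour u of x sees the second subconstituent at distances 1 and 3 only. The distance-1 sum
is zero by locality and the total is zero. -/
theorem distMatrix_three_mulVec_eq_zero {K : Type*} [RCLike K] {x : V} {v : V → K}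
    (hv : v ∈ localSpace G K x) {u : V} (hu : G.Adj x u) : (distMatrix G K 3 *ᵥ v) u = 0 := by
  have h1 : (distMatrix G K 1 *ᵥ v) u + (distMatrix G K 3 *ᵥ v) u = ∑ y, v y := by
    simp only [distMatrix_mulVec_apply]
    rw [← sum_add_distrib]
    refine sum_congr rfl fun y _ => ?_
    by_cases hy : G.dist x y = 2
    · have := H.dist_adj hu y
      have : G.dist u y = 1 ∨ G.dist u y = 3 := by omega
      rcases this with h | h <;> rw [h] <;> simp
    · rw [apply_eq_zero_of_mem_localSpace hv hy]; simp
  rw [distMatrix_one, hv.2 u hu, zero_add, H.sum_eq_zero_of_mem_localSpace hv] at h1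
  exact h1

/-- A A_2 = c_3 A_3 + b_1 A, and both terms vanish on v at the neighbours of x. Truncating to level
two removes nothing else relevant, since A_2 v also vanishes at x. -/
theorem localMap_mem {K : Type*} [RCLike K] {x : V} {v : V → K}
    (hv : v ∈ localSpace G K x) : localMap G K x v ∈ localSpace G K x := by
  refine ⟨?_, fun u hu => ?_⟩
  · ext z
    simp only [localMap, LinearMap.comp_apply, levelPart_apply]
    split_ifs <;> rfl
  · have h1 : (G.adjMatrix K *ᵥ localMap G K x v) u
        = (G.adjMatrix K *ᵥ (distMatrix G K 2 *ᵥ v)) u := by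
      rw [SimpleGraph.adjMatrix_mulVec_apply, SimpleGraph.adjMatrix_mulVec_apply]
      refine sum_congr rfl fun y hy => ?_
      rw [SimpleGraph.mem_neighborFinset] at hy
      simp only [localMap, LinearMap.comp_apply, levelPart_apply, mulVecLin_apply]
      by_cases h2 : G.dist x y = 2
      · rw [if_pos h2]
      · rw [if_neg h2]
        have h3 := H.dist_adj hu y
        rw [SimpleGraph.dist_eq_one_iff_adj.mpr hy] at h3
        obtain rfl : x = y := H.dist_eq_zero.mp (by omega)
        rw [distMatrix_mulVec_apply]
        refine (Eq.trans (sum_congr rfl fun y _ => ?_) (H.sum_eq_zero_of_mem_localSpace hv)).symm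
        exact congrFun hv.1 y
    rw [h1]
    have h2 := congrArg (fun M => (M *ᵥ v) u) (H.adjMatrix_mul_distMatrix (K := K) 1)
    simp only [add_mulVec, smul_mulVec, ← mulVec_mulVec, Pi.add_apply, Pi.smul_apply,
      Nat.reduceAdd] at h2
    rw [h2, H.distMatrix_three_mulVec_eq_zero hv hu, distMatrix_one, hv.2 u hu]
    simp

theorem localQuad_mem {K : Type*} [RCLike K] {x : V} {v : V → K}
    (hv : v ∈ localSpace G K x) (θ : ℝ) : localQuad G K x θ v ∈ localSpace G K x := by
  rw [localQuad_apply]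
  exact Submodule.add_mem _ (Submodule.smul_mem _ _ hv) (Submodule.smul_mem _ _ (H.localMap_mem hv))

theorem localQuad_dotProduct {x : V} {v w : V → ℝ} (hv : v ∈ localSpace G ℝ x)
    (hw : w ∈ localSpace G ℝ x) (θ : ℝ) :
    localQuad G ℝ x θ v ⬝ᵥ w = v ⬝ᵥ localQuad G ℝ x θ w := by
  simp only [localQuad_apply, add_dotProduct, dotProduct_add, smul_dotProduct, dotProduct_smul,
    localMap_dotProduct hv.1 hw.1]

/-- The cosines at distances two and four in terms of the intersection numbers. -/
theorem cosine_local {θ : ℝ} (hθ : IsEigenvalue G θ) :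
    (valency G : ℝ) * b G 1 * b G 2 * b G 3 * (1 - cosine G θ 4)
      = ((valency G : ℝ) ^ 2 - θ ^ 2) * (b G 2 * b G 3 + (θ ^ 2 - b G 2)) ∧
    (valency G : ℝ) * b G 1 * b G 2 * b G 3 * (cosine G θ 2 - cosine G θ 4)
      = ((valency G : ℝ) ^ 2 - θ ^ 2) * (θ ^ 2 - b G 2) := by
  have h5 := H.five_le
  have h1 := H.cosine_sub_cosine hθ (i := 0) (by omega)
  have h2 := H.cosine_sub_cosine hθ (i := 2) (by omega)
  have e1 := H.sphereSize_succ (l := 0) (by omega)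
  have e2 := H.sphereSize_succ (l := 1) (by omega)
  have c1 : (c G 1 : ℝ) = 1 := by rw [H.c_one]; simp
  have c2 := H.cast_c_pos (i := 2) (by norm_num) (by omega)
  have hb0 : (b G 0 : ℝ) = valency G := rfl
  simp only [Nat.reduceAdd, zero_add] at *
  have hp0 : (partialPoly G 0).eval θ = 1 := by simp [partialPoly]
  have hp2 : c G 2 * (partialPoly G 2).eval θ = θ ^ 2 - b G 2 := by
    simp only [partialPoly, Polynomial.eval_mul, Polynomial.eval_C, Polynomial.eval_sub,
      Polynomial.eval_X, Polynomial.eval_one, zero_add]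
    field_simp
  have hs0 : sphereSize G 0 = 1 := rfl
  have hc0 : cosine G θ 0 = 1 := rfl
  rw [hs0, hb0, c1] at e1
  rw [hs0, hb0, hp0, hc0] at h1
  have hs2 : sphereSize G 2 * c G 2 = valency G * b G 1 := by
    linear_combination e2 + (b G 1 : ℝ) * e1
  have key : (valency G : ℝ) * b G 1 * b G 2 * b G 3 * (cosine G θ 2 - cosine G θ 4)
      = ((valency G : ℝ) ^ 2 - θ ^ 2) * (θ ^ 2 - b G 2) := by
    linear_combination (c G 2 : ℝ) * h2 + ((valency G : ℝ) ^ 2 - θ ^ 2) * hp2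
      - (b G 2 : ℝ) * b G 3 * (cosine G θ 2 - cosine G θ 4) * hs2
  refine ⟨?_, key⟩
  linear_combination key + (b G 2 : ℝ) * b G 3 * h1

/-- On the local space, the level-two part of `Φ_θ` is a positive multiple of `localQuad`. -/
theorem levelPart_cosMatrix_mulVec {K : Type*} [RCLike K] {θ : ℝ} (hθ : IsEigenvalue G θ) {x : V}
    {v : V → K} (hv : v ∈ localSpace G K x) :
    (((valency G : ℝ) * b G 1 * b G 2 * b G 3 : ℝ) : K) • levelPart G x 2 (cosMatrix G K θ *ᵥ v)
      = (((valency G : ℝ) ^ 2 - θ ^ 2 : ℝ) : K) • localQuad G K x θ v := by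
  have h5 := H.five_le
  obtain ⟨e1, e2⟩ := H.cosine_local hθ
  have e1' := congrArg (fun t : ℝ => (t : K)) e1
  have e2' := congrArg (fun t : ℝ => (t : K)) e2
  ext z
  simp only [Pi.smul_apply, levelPart_apply, localQuad_apply, Pi.add_apply, localMap,
    LinearMap.comp_apply, mulVecLin_apply, smul_eq_mul]
  by_cases hz : G.dist x z = 2
  · rw [if_pos hz, if_pos hz]
    have h1 := H.distMatrix_add_add hv le_rfl hz
    have h2 : (cosMatrix G K θ *ᵥ v) z = (cosine G θ 0 : K) * (distMatrix G K 0 *ᵥ v) z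
        + (cosine G θ 2 : K) * (distMatrix G K 2 *ᵥ v) z
        + (cosine G θ 4 : K) * (distMatrix G K 4 *ᵥ v) z := by
      rw [mulVec, dotProduct]
      simp only [distMatrix_mulVec_apply, mul_sum, cosMatrix, of_apply]
      rw [← sum_add_distrib, ← sum_add_distrib]
      refine sum_congr rfl fun y _ => ?_
      by_cases hy : G.dist x y = 2
      · have t1 := H.dist_triangle z x y
        obtain ⟨m, h4⟩ := H.even_dist_add x z y
        rw [SimpleGraph.dist_comm (u := z) (v := x)] at t1
        have : G.dist z y = 0 ∨ G.dist z y = 2 ∨ G.dist z y = 4 := by omega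
        rcases this with h | h | h <;> rw [h] <;> simp
      · rw [apply_eq_zero_of_mem_localSpace hv hy]; simp
    have h3 : (distMatrix G K 0 *ᵥ v) z = v z := by rw [H.distMatrix_zero, one_mulVec]
    simp only [Nat.sub_self, Nat.reduceAdd] at h1
    rw [h2]
    rw [h3] at h1 ⊢
    rw [show cosine G θ 0 = 1 from rfl]
    push_cast at e1' e2' ⊢
    linear_combination v z * e1' + (distMatrix G K 2 *ᵥ v) z * e2'
      + (valency G : K) * b G 1 * b G 2 * b G 3 * (cosine G θ 4 : K) * h1
  · rw [if_neg hz, if_neg hz, apply_eq_zero_of_mem_localSpace hv hz]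
    simp

theorem dotProduct_cosMatrix_local {θ : ℝ} (hθ : IsEigenvalue G θ) {x : V}
    {v : V → ℝ} (hv : v ∈ localSpace G ℝ x) :
    ((valency G : ℝ) * b G 1 * b G 2 * b G 3) * (v ⬝ᵥ (cosMatrix G ℝ θ *ᵥ v))
      = ((valency G : ℝ) ^ 2 - θ ^ 2) * (v ⬝ᵥ localQuad G ℝ x θ v) := by
  have h := congrArg (v ⬝ᵥ ·) (H.levelPart_cosMatrix_mulVec (K := ℝ) hθ hv)
  simp only [dotProduct_smul, ← levelPart_dotProduct, hv.1, smul_eq_mul] at h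
  exact h

theorem const_pos : 0 < (valency G : ℝ) * b G 1 * b G 2 * b G 3 := by
  have h5 := H.five_le
  have h1 := H.cast_valency_ge
  have h2 := H.cast_b_pos (i := 1) (by omega)
  have h3 := H.cast_b_pos (i := 2) (by omega)
  have h4 := H.cast_b_pos (i := 3) (by omega)
  have : (0 : ℝ) < valency G := by linarith
  positivity

/-- The local quadratic form attached to a nontrivial eigenvalue is nonnegative. -/
theorem dotProduct_localQuad_nonneg {θ : ℝ} (hθ : IsEigenvalue G θ) (hk : θ ^ 2 < valency G ^ 2)
    {x : V} {v : V → ℝ} (hv : v ∈ localSpace G ℝ x) : 0 ≤ v ⬝ᵥ localQuad G ℝ x θ v := by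
  have h1 := H.dotProduct_cosMatrix_local hθ hv
  have h2 := (H.cosMatrix_posSemidef hθ).dotProduct_mulVec_nonneg v
  rw [star_trivial] at h2
  have h3 := mul_nonneg H.const_pos.le h2
  rw [h1] at h3
  exact nonneg_of_mul_nonneg_right h3 (by linarith)

/-- The forms of Φ_θ and Q_θ agree on v up to scalars, and a null vector of the positive
semidefinite Φ_θ lies in its kernel. Thus local information becomes global. -/
theorem cosMatrix_mulVec_eq_zero {θ : ℝ} (hθ : IsEigenvalue G θ)
    {x : V} {v : V → ℝ} (hv : v ∈ localSpace G ℝ x) (h : v ⬝ᵥ localQuad G ℝ x θ v = 0) :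
    cosMatrix G ℝ θ *ᵥ v = 0 := by
  have h1 := H.dotProduct_cosMatrix_local hθ hv
  rw [h, mul_zero] at h1
  have h2 := (mul_eq_zero.mp h1).resolve_left H.const_pos.ne'
  have h3 : (cosMatrix G ℝ θ *ᵥ v) ⬝ᵥ (cosMatrix G ℝ θ *ᵥ v) = 0 := by
    rw [← dotProduct_cosMatrix_mulVec, mulVec_mulVec, H.cosMatrix_mul_self hθ, smul_mulVec,
      dotProduct_smul, h2, smul_zero]
  exact dotProduct_self_eq_zero.mp h3

theorem localQuad_eq_zero {K : Type*} [RCLike K] {θ : ℝ} (hθ : IsEigenvalue G θ)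
    (hk : θ ^ 2 < valency G ^ 2) {x : V} {v : V → K} (hv : v ∈ localSpace G K x)
    (h : cosMatrix G K θ *ᵥ v = 0) : localQuad G K x θ v = 0 := by
  have h1 := H.levelPart_cosMatrix_mulVec hθ hv
  rw [h, map_zero, smul_zero] at h1
  refine (smul_eq_zero.mp h1.symm).resolve_left fun h0 => ?_
  rw [RCLike.ofReal_eq_zero] at h0
  linarith

theorem extremal_sq_lt {θ : ℝ}
    (hθ : θ = eigenvalue G 1 ∨ θ = eigenvalue G (G.diam / 2)) : θ ^ 2 < valency G ^ 2 := by
  have := H.extremal_pos_lt hθ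
  nlinarith

/-- The product of the two extremal local operators is positive semidefinite. -/
theorem localQuad_mul_estimate {x : V} {v : V → ℝ} (hv : v ∈ localSpace G ℝ x) :
    0 ≤ v ⬝ᵥ localQuad G ℝ x (eigenvalue G 1) (localQuad G ℝ x (eigenvalue G (G.diam / 2)) v) ∧
    (v ⬝ᵥ localQuad G ℝ x (eigenvalue G 1) (localQuad G ℝ x (eigenvalue G (G.diam / 2)) v) = 0 →
      localQuad G ℝ x (eigenvalue G 1) (localQuad G ℝ x (eigenvalue G (G.diam / 2)) v) = 0) := by
  have h5 := H.five_le
  obtain ⟨hs, ht⟩ := H.eigenvalue_half_sq_lt_and_lt_eigenvalue_one_sq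
  have hb2 := H.cast_b_pos (i := 2) (by omega)
  have hb3 := H.cast_b_pos (i := 3) (by omega)
  have e1 := H.isEigenvalue_extremal (Or.inl rfl)
  have e2 := H.isEigenvalue_extremal (Or.inr rfl)
  have k1 := H.extremal_sq_lt (Or.inl rfl)
  have k2 := H.extremal_sq_lt (Or.inr rfl)
  set θ := eigenvalue G 1
  set φ := eigenvalue G (G.diam / 2)
  have hu := H.localQuad_mem hv φ
  have hw := H.localQuad_mem hv θ
  have n1 := H.dotProduct_localQuad_nonneg e1 k1 hu
  have n2 := H.dotProduct_localQuad_nonneg e2 k2 hw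
  -- The positive weights b_2 - φ² and θ² - b_2 make N cancel, so a positive combination of Q_θ and
  -- Q_φ is a positive scalar. Multiplied by Q_θ Q_φ, it writes that product as a positive
  -- combination of Q_θ Q_φ Q_θ and Q_φ Q_θ Q_φ.
  have hlin : ∀ y : V → ℝ, ((b G 2 : ℝ) - φ ^ 2) • localQuad G ℝ x θ y
      + (θ ^ 2 - b G 2) • localQuad G ℝ x φ y
        = ((θ ^ 2 - φ ^ 2) * (b G 2 * b G 3)) • y := by
    intro y
    ext z
    simp only [localQuad_apply, Pi.add_apply, Pi.smul_apply, smul_eq_mul, RCLike.ofReal_real_eq_id,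
      id]
    ring
  have hid : ((θ ^ 2 - φ ^ 2) * (b G 2 * b G 3)) *
      (v ⬝ᵥ localQuad G ℝ x θ (localQuad G ℝ x φ v))
        = ((b G 2 : ℝ) - φ ^ 2) * (localQuad G ℝ x θ v ⬝ᵥ localQuad G ℝ x φ (localQuad G ℝ x θ v))
          + (θ ^ 2 - b G 2) *
            (localQuad G ℝ x φ v ⬝ᵥ localQuad G ℝ x θ (localQuad G ℝ x φ v)) := by
    have := congrArg (v ⬝ᵥ ·) (hlin (localQuad G ℝ x θ (localQuad G ℝ x φ v)))
    simp only [dotProduct_add, dotProduct_smul, smul_eq_mul] at this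
    rw [← this, ← H.localQuad_dotProduct hv (H.localQuad_mem hu θ) θ,
      ← H.localQuad_dotProduct hv (H.localQuad_mem hu θ) φ, localQuad_comm x θ φ v]
  have hpos : 0 < (θ ^ 2 - φ ^ 2) * (b G 2 * b G 3) :=
    mul_pos (by linarith) (mul_pos hb2 hb3)
  constructor
  · have h0 := add_nonneg (mul_nonneg (show 0 ≤ (b G 2 : ℝ) - φ ^ 2 by linarith) n2)
      (mul_nonneg (show 0 ≤ θ ^ 2 - (b G 2 : ℝ) by linarith) n1)
    rw [← hid] at h0
    exact nonneg_of_mul_nonneg_right h0 hpos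
  · intro h0
    rw [h0, mul_zero] at hid
    have m1 := mul_nonneg (show 0 ≤ (b G 2 : ℝ) - φ ^ 2 by linarith) n2
    have m2 := mul_nonneg (show 0 ≤ θ ^ 2 - (b G 2 : ℝ) by linarith) n1
    have h1 : (θ ^ 2 - (b G 2 : ℝ)) *
        (localQuad G ℝ x φ v ⬝ᵥ localQuad G ℝ x θ (localQuad G ℝ x φ v)) = 0 := by linarith
    have h2 := (mul_eq_zero.mp h1).resolve_left (by linarith)
    exact H.localQuad_eq_zero e1 k1 hu (H.cosMatrix_mulVec_eq_zero e1 hu h2)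

end OddBipartite
end DRG

/-! ### The projection of δ_z onto the local space and the fundamental expression. -/

namespace DRG
open Finset Matrix

variable {V : Type*} [Fintype V] [DecidableEq V] {G : SimpleGraph V} [DecidableRel G.Adj]

/-- The difference of the two sides of the fundamental equation, as a function of two
eigenvalues. -/
noncomputable def fundamental (G : SimpleGraph V) (θ φ : ℝ) : ℝ :=
  (b G 3 : ℝ) * ((b G 2 : ℝ) * ((valency G : ℝ) - 2) - ((c G 2 : ℝ) - 1) * θ ^ 2)
      * ((b G 2 : ℝ) * ((valency G : ℝ) - 2) - ((c G 2 : ℝ) - 1) * φ ^ 2)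
    - (b G 1 : ℝ) * Delta G * (θ ^ 2 - (b G 2 : ℝ)) * ((b G 2 : ℝ) - φ ^ 2)

/-- The coefficients of the component of `δ_z` outside the local space. -/
noncomputable def projCoeff (G : SimpleGraph V) [DecidableRel G.Adj] (x z u : V) : ℝ :=
  if G.Adj x u then ((if G.Adj z u then 1 else 0) - ((c G 2 : ℝ) - 1) / b G 1) / b G 2 else 0

/-- The orthogonal projection of `δ_z` onto the local space. -/
noncomputable def projVec (G : SimpleGraph V) [DecidableRel G.Adj] (x z : V) : V → ℝ :=
  Pi.single z 1 - levelPart G x 2 (G.adjMatrix ℝ *ᵥ projCoeff G x z)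

namespace OddBipartite

variable (H : OddBipartite G)
include H

theorem distMatrix_two_mul_adjMatrix :
    distMatrix G ℝ 2 * G.adjMatrix ℝ
      = (c G 3 : ℝ) • distMatrix G ℝ 3 + (b G 1 : ℝ) • G.adjMatrix ℝ := by
  have h := congrArg transpose (H.adjMatrix_mul_distMatrix (K := ℝ) 1)
  rw [transpose_mul, distMatrix_transpose, SimpleGraph.transpose_adjMatrix, transpose_add,
    transpose_smul, transpose_smul, distMatrix_transpose, distMatrix_transpose, distMatrix_one] at h
  exact h

/-- Substituting c_2 A_2 = A² - k in one factor turns c_2 A_2² into a combination of distance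
matrices; the entries at distance two are compared. -/
theorem intersectionNumber_two :
    (c G 2 : ℝ) * intersectionNumber G 2 2 2
      = c G 2 * (b G 1 - 1) + b G 2 * (c G 3 - 1) := by
  have h5 := H.five_le
  obtain ⟨x, z, hxz⟩ := H.exists_pair (i := 2) (by omega)
  have h1 := H.adjMatrix_mul_distMatrix (K := ℝ) 0
  have h2 := H.adjMatrix_mul_distMatrix (K := ℝ) 1
  have h3 := H.adjMatrix_mul_distMatrix (K := ℝ) 2
  have hA : (b G 0 : ℝ) = valency G := rfl
  have ha := H.cast_c_add_b (i := 2) (by omega)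
  simp only [zero_add, Nat.reduceAdd, distMatrix_one, H.distMatrix_zero, hA] at h1 h2 h3
  have h4 : (c G 2 : ℝ) • (distMatrix G ℝ 2 * distMatrix G ℝ 2)
      = (c G 3 : ℝ) • ((c G 4 : ℝ) • distMatrix G ℝ 4 + (b G 2 : ℝ) • distMatrix G ℝ 2)
        + (b G 1 : ℝ) • ((c G 2 : ℝ) • distMatrix G ℝ 2 + (valency G : ℝ) • (1 : Matrix V V ℝ))
        - (valency G : ℝ) • distMatrix G ℝ 2 := by
    rw [← h3, ← h1, ← smul_mul_assoc, eq_sub_of_add_eq h1.symm, sub_mul, mul_assoc, h2, mul_add,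
      mul_smul_comm, mul_smul_comm, smul_mul_assoc, one_mul]
  have h6 := congrFun (congrFun h4 x) z
  have hne : x ≠ z := by rintro rfl; simp at hxz
  have h7 : (distMatrix G ℝ 2 * distMatrix G ℝ 2) x z = intersectionNumber G 2 2 2 := by
    rw [← H.card_sphere (by omega) (by omega) (by omega) hxz, Matrix.mul_apply, card_filter]
    push_cast
    refine sum_congr rfl fun y _ => ?_
    by_cases h8 : G.dist x y = 2 <;> by_cases h9 : G.dist y z = 2 <;>
      simp [distMatrix, h8, h9]
  simp only [Matrix.smul_apply, Matrix.add_apply, Matrix.sub_apply, h7, smul_eq_mul,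
    Matrix.one_apply_ne hne] at h6
  simp only [distMatrix, of_apply, hxz] at h6
  norm_num at h6
  linear_combination h6 + ha

theorem sum_projCoeff {x z : V} (hz : G.dist x z = 2) :
    ∑ u, projCoeff G x z u
      = (c G 2 - (valency G : ℝ) * ((c G 2 - 1) / b G 1)) / b G 2 := by
  have h1 : ∑ u ∈ G.neighborFinset x, (if G.Adj z u then (1 : ℝ) else 0) = c G 2 := by
    rw [← hz, ← H.card_c, card_eq_sum_ones, sum_filter, SimpleGraph.neighborFinset_eq_filter,
      sum_filter]
    push_cast
    refine sum_congr rfl fun u _ => ?_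
    by_cases hu : G.Adj x u
    · have : G.dist u z + 1 = G.dist x z ↔ G.Adj z u := by
        rw [hz, SimpleGraph.adj_comm, ← SimpleGraph.dist_eq_one_iff_adj]; omega
      simp [hu, this]
    · simp [hu]
  simp only [projCoeff]
  rw [← sum_filter, ← SimpleGraph.neighborFinset_eq_filter, ← sum_div, sum_sub_distrib, h1,
    sum_const, H.degree_eq, nsmul_eq_mul]

theorem adjMatrix_mulVec_projCoeff {x z : V} (hz : G.dist x z = 2) :
    (G.adjMatrix ℝ *ᵥ projCoeff G x z) z
      = c G 2 * ((1 - (c G 2 - 1) / b G 1) / b G 2) := by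
  have hc := H.card_c x z
  rw [hz] at hc
  generalize ht : (1 - ((c G 2 : ℝ) - 1) / b G 1) / b G 2 = t
  rw [SimpleGraph.adjMatrix_mulVec_apply, ← hc, ← nsmul_eq_mul, ← sum_const,
    SimpleGraph.neighborFinset_eq_filter, sum_filter, sum_filter]
  refine sum_congr rfl fun u _ => ?_
  simp only [projCoeff]
  by_cases hu : G.Adj x u
  · have : G.dist u z + 1 = 2 ↔ G.Adj z u := by
      rw [SimpleGraph.adj_comm, ← SimpleGraph.dist_eq_one_iff_adj]; omega
    by_cases h : G.Adj z u
    · simp [hu, this, h, ← ht]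
    · simp [hu, this, h]
  · simp [hu]

theorem adjMatrix_mulVec_eq_levelPart {x : V} {g : V → ℝ} (hg : ∀ u, ¬ G.Adj x u → g u = 0) :
    levelPart G x 2 (G.adjMatrix ℝ *ᵥ g) = G.adjMatrix ℝ *ᵥ g - Pi.single x (∑ u, g u) := by
  ext y
  rw [levelPart_apply, Pi.sub_apply]
  by_cases hy : y = x
  · subst hy
    rw [if_neg (by simp), Pi.single_eq_same, SimpleGraph.adjMatrix_mulVec_apply,
      SimpleGraph.neighborFinset_eq_filter, sum_filter, eq_comm, sub_eq_zero]
    refine sum_congr rfl fun u _ => ?_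
    by_cases h : G.Adj y u
    · rw [if_pos h]
    · rw [if_neg h, hg u h]
  · rw [Pi.single_eq_of_ne hy, sub_zero]
    by_cases h2 : G.dist x y = 2
    · rw [if_pos h2]
    · rw [if_neg h2, SimpleGraph.adjMatrix_mulVec_apply, eq_comm]
      refine sum_eq_zero fun u hu => hg u fun hxu => ?_
      rw [SimpleGraph.mem_neighborFinset] at hu
      have h3 := H.dist_adj hxu y
      rw [SimpleGraph.dist_eq_one_iff_adj.mpr hu.symm] at h3
      have : G.dist x y ≠ 0 := fun h => hy (H.dist_eq_zero.mp h).symm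
      omega

/-- The vector removed from δ_z is a combination of the level-two neighbourhoods of the neighbours u
of x. Their Gram matrix is b_2 I + (c_2 - 1) J, and `projCoeff` is its inverse applied to the
indicator of u ~ z; the denominator b_2 + k(c_2 - 1) = c_2 b_1 cancels c_2. -/
theorem projVec_mem {x z : V} (hz : G.dist x z = 2) : projVec G x z ∈ localSpace G ℝ x := by
  have h5 := H.five_le
  have hg : ∀ u, ¬ G.Adj x u → projCoeff G x z u = 0 := fun u hu => by simp [projCoeff, hu]
  refine ⟨?_, fun u hu => ?_⟩
  · rw [projVec, map_sub]
    congr 1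
    · ext y
      rw [levelPart_apply]
      by_cases hy : y = z
      · subst hy; simp [hz]
      · simp [hy]
    · ext y
      simp only [levelPart_apply]
      split_ifs <;> rfl
  · rw [projVec, H.adjMatrix_mulVec_eq_levelPart hg, mulVec_sub, mulVec_sub,
      H.adjMatrix_sq_mulVec]
    have h1 : (distMatrix G ℝ 2 *ᵥ projCoeff G x z) u
        = ∑ u, projCoeff G x z u - projCoeff G x z u := by
      rw [distMatrix_mulVec_apply, eq_sub_iff_add_eq,
        ← Finset.sum_erase_add _ _ (mem_univ u), if_neg (by simp), add_zero,
        ← Finset.sum_erase_add univ (projCoeff G x z) (mem_univ u)]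
      congr 1
      refine sum_congr rfl fun y hy => ?_
      rw [mem_erase] at hy
      by_cases hxy : G.Adj x y
      · have h3 := H.dist_adj hu y
        rw [SimpleGraph.dist_eq_one_iff_adj.mpr hxy] at h3
        have h4 : G.dist u y ≠ 0 := fun h => hy.1 (H.dist_eq_zero.mp h).symm
        rw [if_pos (by omega)]
      · rw [hg y hxy]; simp
    have h2 : (G.adjMatrix ℝ *ᵥ (Pi.single z 1 : V → ℝ)) u = if G.Adj z u then 1 else 0 := by
      simp [SimpleGraph.adjMatrix_apply, SimpleGraph.adj_comm]
    have h3 : (G.adjMatrix ℝ *ᵥ (Pi.single x (∑ u, projCoeff G x z u) : V → ℝ)) u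
        = ∑ u, projCoeff G x z u := by
      simp [SimpleGraph.adjMatrix_apply, hu.symm]
    simp only [Pi.sub_apply, Pi.add_apply, Pi.smul_apply, smul_eq_mul, h1, h2, h3]
    rw [H.sum_projCoeff hz]
    have a1 := H.cast_c_add_b (i := 2) (by omega)
    have a2 := H.cast_c_add_b (i := 1) (by omega)
    have b1 := (H.cast_b_pos (i := 1) (by omega)).ne'
    have b2 := (H.cast_b_pos (i := 2) (by omega)).ne'
    rw [H.c_one] at a2
    push_cast at a2
    have hk : (valency G : ℝ) = 1 + b G 1 := a2.symm
    have hb : (b G 2 : ℝ) = 1 + b G 1 - c G 2 := by linarith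
    simp only [projCoeff, if_pos hu]
    generalize (if G.Adj z u then (1 : ℝ) else 0) = t
    rw [hb] at b2
    rw [hk, hb]
    field_simp
    ring

/-- A reproducing property: the component removed from δ_z is orthogonal to the local space. -/
theorem projVec_dotProduct {x z : V} {w : V → ℝ} (hw : w ∈ localSpace G ℝ x) :
    projVec G x z ⬝ᵥ w = w z := by
  rw [projVec, sub_dotProduct, levelPart_dotProduct, hw.1, dotProduct_comm (G.adjMatrix ℝ *ᵥ _),
    dotProduct_adjMatrix_mulVec]
  have : (G.adjMatrix ℝ *ᵥ w) ⬝ᵥ projCoeff G x z = 0 := by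
    refine sum_eq_zero fun u _ => ?_
    by_cases hu : G.Adj x u
    · rw [hw.2 u hu, zero_mul]
    · simp [projCoeff, hu]
  rw [this]
  simp

theorem localMap_levelPart_adjMatrix {x : V} {g : V → ℝ} (hg : ∀ u, ¬ G.Adj x u → g u = 0) {y : V}
    (hy : G.dist x y = 2) :
    localMap G ℝ x (levelPart G x 2 (G.adjMatrix ℝ *ᵥ g)) y
      = ((b G 1 : ℝ) - c G 3) * (G.adjMatrix ℝ *ᵥ g) y + (c G 3 - 1) * ∑ u, g u := by
  rw [H.adjMatrix_mulVec_eq_levelPart hg]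
  simp only [localMap, LinearMap.comp_apply, levelPart_apply, mulVecLin_apply, if_pos hy]
  rw [mulVec_sub, mulVec_mulVec, H.distMatrix_two_mul_adjMatrix, add_mulVec, smul_mulVec,
    smul_mulVec]
  have h1 : (distMatrix G ℝ 3 *ᵥ g) y = ∑ u, g u - (G.adjMatrix ℝ *ᵥ g) y := by
    rw [eq_sub_iff_add_eq, ← distMatrix_one, distMatrix_mulVec_apply, distMatrix_mulVec_apply,
      ← sum_add_distrib]
    refine sum_congr rfl fun u _ => ?_
    by_cases hu : G.Adj x u
    · have := H.dist_adj hu y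
      rw [SimpleGraph.dist_comm (u := y)]
      have : G.dist u y = 1 ∨ G.dist u y = 3 := by omega
      rcases this with h | h <;> rw [h] <;> simp
    · rw [hg u hu]; simp
  have h2 : (distMatrix G ℝ 2 *ᵥ (Pi.single x (∑ u, g u) : V → ℝ)) y = ∑ u, g u := by
    simp [distMatrix, SimpleGraph.dist_comm (u := y), hy]
  simp only [Pi.sub_apply, Pi.add_apply, Pi.smul_apply, smul_eq_mul, h1, h2]
  ring

/-- The moments of the local map at `projVec`, combined into the fundamental expression. -/
theorem projVec_localQuad {x z : V} (hz : G.dist x z = 2) (θ φ : ℝ) :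
    localQuad G ℝ x θ (localQuad G ℝ x φ (projVec G x z)) z * (b G 1 * (b G 2 - 1))
      = b G 3 * fundamental G θ φ := by
  have h5 := H.five_le
  set g := projCoeff G x z with hgdef
  have hg : ∀ u, ¬ G.Adj x u → g u = 0 := fun u hu => by simp [hgdef, projCoeff, hu]
  set p : ℝ := (intersectionNumber G 2 2 2 : ℝ) with hp
  set σ := ∑ u, g u with hσ
  set τ := (G.adjMatrix ℝ *ᵥ g) z with hτ
  have hσ' : σ = (c G 2 - (valency G : ℝ) * ((c G 2 - 1) / b G 1)) / b G 2 := H.sum_projCoeff hz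
  have hτ' : τ = c G 2 * ((1 - (c G 2 - 1) / b G 1) / b G 2) := H.adjMatrix_mulVec_projCoeff hz
  -- The entry of Q_θ Q_φ `projVec` at z needs only the entries at z of N^j `projVec` for j = 0, 1,
  -- 2; these are `m0`, `m1`, `m2`.
  have hN : ∀ y, G.dist x y = 2 → localMap G ℝ x (projVec G x z) y
      = (if G.dist z y = 2 then 1 else 0) - ((b G 1 - c G 3) * (G.adjMatrix ℝ *ᵥ g) y
        + (c G 3 - 1) * σ) := by
    intro y hy
    rw [projVec, map_sub, Pi.sub_apply, H.localMap_levelPart_adjMatrix hg hy]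
    congr 1
    simp [localMap, levelPart_apply, hy, distMatrix, SimpleGraph.dist_comm (u := y)]
  have m0 : projVec G x z z = 1 - τ := by
    simp [projVec, levelPart_apply, hz, hτ, hgdef]
  have m1 : localMap G ℝ x (projVec G x z) z = - ((b G 1 - c G 3) * τ + (c G 3 - 1) * σ) := by
    rw [hN z hz]
    simp [hτ]
  have hcount : ∑ y, (if G.dist z y = 2 then (if G.dist x y = 2 then (1 : ℝ) else 0) else 0) = p := by
    rw [hp, ← H.card_sphere (by omega) (by omega) (by omega) hz, card_filter]
    push_cast
    refine sum_congr rfl fun y _ => ?_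
    rw [SimpleGraph.dist_comm (u := y)]
    by_cases h8 : G.dist x y = 2 <;> by_cases h9 : G.dist z y = 2 <;> simp [h8, h9]
  have m2 : localMap G ℝ x (localMap G ℝ x (projVec G x z)) z
      = p - ((b G 1 - c G 3) * ((b G 1 - c G 3) * τ + (c G 3 - 1) * σ) + (c G 3 - 1) * σ * p) := by
    have h1 : ∀ f : V → ℝ, localMap G ℝ x f z = ∑ y, if G.dist z y = 2 then f y else 0 := by
      intro f
      simp only [localMap, LinearMap.comp_apply, levelPart_apply, mulVecLin_apply, if_pos hz,
        distMatrix_mulVec_apply]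
    have h2 := H.localMap_levelPart_adjMatrix hg hz
    rw [h1] at h2 ⊢
    rw [← hτ, ← hσ] at h2
    rw [← h2, ← hcount, mul_sum, mul_sum, ← sum_add_distrib, ← sum_sub_distrib]
    refine sum_congr rfl fun y _ => ?_
    by_cases hy : G.dist z y = 2
    · by_cases hxy : G.dist x y = 2
      · rw [if_pos hy, hN y hxy]
        simp only [levelPart_apply, hy, hxy, if_true]
        ring
      · simp only [localMap, LinearMap.comp_apply, levelPart_apply, hxy, hy, if_true, if_false]
        ring
    · simp [hy]
  have a1 := H.cast_c_add_b (i := 2) (by omega)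
  have a2 := H.cast_c_add_b (i := 1) (by omega)
  have a3 := H.cast_c_add_b (i := 3) (by omega)
  have b1 := (H.cast_b_pos (i := 1) (by omega)).ne'
  have b2 := (H.cast_b_pos (i := 2) (by omega)).ne'
  have c2 := (H.cast_c_pos (i := 2) (by omega) (by omega)).ne'
  have hp' := H.intersectionNumber_two
  rw [← hp] at hp'
  rw [H.c_one] at a2
  push_cast at a2
  have hexp : localQuad G ℝ x θ (localQuad G ℝ x φ (projVec G x z)) z
      = (b G 2 * b G 3 + (θ ^ 2 - b G 2)) * ((b G 2 * b G 3 + (φ ^ 2 - b G 2)) *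
          projVec G x z z + (φ ^ 2 - b G 2) * localMap G ℝ x (projVec G x z) z)
        + (θ ^ 2 - b G 2) * ((b G 2 * b G 3 + (φ ^ 2 - b G 2)) *
          localMap G ℝ x (projVec G x z) z
            + (φ ^ 2 - b G 2) * localMap G ℝ x (localMap G ℝ x (projVec G x z)) z) := by
    simp only [localQuad_apply, map_add, map_smul, Pi.add_apply, Pi.smul_apply, smul_eq_mul,
      RCLike.ofReal_real_eq_id, id]
    ring
  rw [hexp, m0, m1, m2, fundamental, Delta, ← hp, hσ', hτ']
  have hk : (valency G : ℝ) = 1 + b G 1 := a2.symm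
  have hc2 : (c G 2 : ℝ) = 1 + b G 1 - b G 2 := by linarith
  have hc3 : (c G 3 : ℝ) = 1 + b G 1 - b G 3 := by linarith
  have hpe : p = ((1 + b G 1 - b G 2) * (b G 1 - 1) + b G 2 * (1 + b G 1 - b G 3 - 1))
      / (1 + b G 1 - b G 2) := by
    rw [eq_div_iff (by rw [← hc2]; exact c2)]
    rw [hc2, hc3] at hp'
    linarith
  rw [hc2] at c2
  rw [hpe, hk, hc2, hc3]
  generalize (b G 1 : ℝ) = B1 at *
  generalize (b G 2 : ℝ) = B2 at *
  generalize (b G 3 : ℝ) = B3 at *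
  generalize θ ^ 2 = S
  generalize φ ^ 2 = T
  field_simp
  ring

/-- The fundamental equation makes the product of the two extremal local operators vanish on the
local space. -/
theorem localQuad_mul_eq_zero (h : fundamental G (eigenvalue G 1) (eigenvalue G (G.diam / 2)) = 0)
    {x : V} {v : V → ℝ} (hv : v ∈ localSpace G ℝ x) :
    localQuad G ℝ x (eigenvalue G 1) (localQuad G ℝ x (eigenvalue G (G.diam / 2)) v) = 0 := by
  have h5 := H.five_le
  have hv2 := H.localQuad_mem (H.localQuad_mem hv (eigenvalue G (G.diam / 2))) (eigenvalue G 1)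
  ext z
  by_cases hz : G.dist x z = 2
  · have hr := H.projVec_mem hz
    have hr2 := H.localQuad_mem hr (eigenvalue G (G.diam / 2))
    have h1 := H.projVec_localQuad hz (eigenvalue G 1) (eigenvalue G (G.diam / 2))
    have hb1 := H.cast_b_pos (i := 1) (by omega)
    have hb2 : (2 : ℝ) ≤ b G 2 := by exact_mod_cast H.two_le_b_two
    rw [h, mul_zero] at h1
    have h2 := (mul_eq_zero.mp h1).resolve_right (mul_pos hb1 (by linarith)).ne'
    rw [← H.projVec_dotProduct (z := z) (H.localQuad_mem hr2 _)] at h2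
    -- The entry at z is the value of a positive semidefinite form at the projection of δ_z, so its
    -- vanishing kills that projection. Self-adjointness then gives a zero entry at z for every
    -- local v.
    have h3 := (H.localQuad_mul_estimate hr).2 h2
    have hv1 := H.localQuad_mem hv (eigenvalue G (G.diam / 2))
    rw [← H.projVec_dotProduct (z := z) hv2, ← H.localQuad_dotProduct hr hv1,
      ← H.localQuad_dotProduct (H.localQuad_mem hr _) hv, localQuad_comm, h3]
    simp
  · exact apply_eq_zero_of_mem_localSpace hv2 hz

/-- With equal arguments the fundamental expression is, up to a positive factor, the squared norm of
Q_θ applied to the projection of δ_z. -/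
theorem localQuad_eq_zero_of_fundamental {θ : ℝ} (h : fundamental G θ θ = 0)
    {x : V} {v : V → ℝ} (hv : v ∈ localSpace G ℝ x) : localQuad G ℝ x θ v = 0 := by
  have h5 := H.five_le
  have hv2 := H.localQuad_mem hv θ
  ext z
  by_cases hz : G.dist x z = 2
  · have hr := H.projVec_mem hz
    have hr2 := H.localQuad_mem hr θ
    have h1 := H.projVec_localQuad hz θ θ
    have hb1 := H.cast_b_pos (i := 1) (by omega)
    have hb2 : (2 : ℝ) ≤ b G 2 := by exact_mod_cast H.two_le_b_two
    rw [h, mul_zero] at h1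
    have h2 := (mul_eq_zero.mp h1).resolve_right (mul_pos hb1 (by linarith)).ne'
    rw [← H.projVec_dotProduct (z := z) (H.localQuad_mem hr2 _), ← H.localQuad_dotProduct hr hr2,
      dotProduct_self_eq_zero] at h2
    rw [← H.projVec_dotProduct (z := z) hv2, ← H.localQuad_dotProduct hr hv, h2]
    simp
  · exact apply_eq_zero_of_mem_localSpace hv2 hz

/-- The converse needs only one vertex z at distance two from one base vertex x. -/
theorem fundamental_eq_zero {x : V}
    (h : ∀ v ∈ localSpace G ℝ x,
      localQuad G ℝ x (eigenvalue G 1) (localQuad G ℝ x (eigenvalue G (G.diam / 2)) v) = 0) :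
    fundamental G (eigenvalue G 1) (eigenvalue G (G.diam / 2)) = 0 := by
  have h5 := H.five_le
  obtain ⟨u, hu, hux⟩ := H.exists_adj_farther (z := x) (y := x) (by simp; omega)
  obtain ⟨z, hz, hzx⟩ := H.exists_adj_farther (z := u) (y := x) (by simp [hux]; omega)
  have hxz : G.dist x z = 2 := by
    rw [SimpleGraph.dist_comm, hzx, hux]; simp
  have h1 := H.projVec_localQuad hxz (eigenvalue G 1) (eigenvalue G (G.diam / 2))
  rw [h _ (H.projVec_mem hxz), Pi.zero_apply, zero_mul] at h1
  exact (mul_eq_zero.mp h1.symm).resolve_left (H.cast_b_pos (by omega)).ne'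

end OddBipartite
end DRG

/-! ### The fundamental equation implies 2-thinness. -/

namespace DRG
open Finset Matrix

variable {V : Type*} [Fintype V] [DecidableEq V] {G : SimpleGraph V} [DecidableRel G.Adj]

theorem dualIdempotent_mulVec (x : V) (i : ℕ) (v : V → ℂ) :
    dualIdempotent G x i *ᵥ v = levelPart G x i v := by
  ext z
  simp [dualIdempotent, mulVec_diagonal, levelPart_apply]

theorem component_eq_map (x : V) (W : Submodule ℂ (V → ℂ)) (i : ℕ) :
    component G x W i = W.map (levelPart G x i) := by
  rw [component]
  congr 1
  exact LinearMap.ext fun v => dualIdempotent_mulVec x i v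

theorem levelPart_levelPart {K : Type*} [Semiring K] (x : V) (i j : ℕ) (v : V → K) :
    levelPart G x i (levelPart G x j v) = if i = j then levelPart G x j v else 0 := by
  ext z
  by_cases h : i = j
  · subst h
    simp only [levelPart_apply, if_true]
    split_ifs <;> rfl
  · rw [if_neg h]
    simp only [levelPart_apply, Pi.zero_apply]
    split_ifs <;> first | rfl | omega

/-- The lower part at distance `i` of the image of `v` under the distance matrices. -/
noncomputable def lowerVec (G : SimpleGraph V) {K : Type*} [CommRing K] (x : V) (v : V → K)
    (i : ℕ) : V → K := levelPart G x i (distMatrix G K (i - 2) *ᵥ v)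

/-- The upper part at distance `i` of the image of `v` under the distance matrices. -/
noncomputable def upperVec (G : SimpleGraph V) {K : Type*} [CommRing K] (x : V) (v : V → K)
    (i : ℕ) : V → K := levelPart G x i (distMatrix G K (i + 2) *ᵥ v)

/-- The span of the lower parts of `v`. -/
noncomputable def ladder (G : SimpleGraph V) {K : Type*} [CommRing K] (x : V) (v : V → K) :
    Submodule K (V → K) := Submodule.span K (Set.range (lowerVec G x v))

theorem levelPart_mem_ladder {K : Type*} [CommRing K] {x : V} {v w : V → K}
    (hw : w ∈ ladder G x v) (i : ℕ) : levelPart G x i w ∈ Submodule.span K {lowerVec G x v i} := by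
  have h : (ladder G x v).map (levelPart G x i) ≤ Submodule.span K {lowerVec G x v i} := by
    rw [ladder, Submodule.map_span, Submodule.span_le]
    rintro _ ⟨_, ⟨j, rfl⟩, rfl⟩
    change levelPart G x i (levelPart G x j _) ∈ Submodule.span K _
    rw [levelPart_levelPart]
    split_ifs with hij
    · subst hij
      exact Submodule.subset_span rfl
    · exact Submodule.zero_mem _
  exact h ⟨w, hw, rfl⟩

theorem map_distMatrix_mulVec (f : ℂ →ₗ[ℝ] ℝ) (l : ℕ) (v : V → ℂ) :
    f ∘ (distMatrix G ℂ l *ᵥ v) = distMatrix G ℝ l *ᵥ (f ∘ v) := by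
  ext z
  simp only [Function.comp_apply, distMatrix_mulVec_apply, map_sum, apply_ite f, map_zero]

theorem map_levelPart (f : ℂ →ₗ[ℝ] ℝ) (x : V) (i : ℕ) (v : V → ℂ) :
    f ∘ (levelPart G x i v) = levelPart G x i (f ∘ v) := by
  ext z
  simp only [Function.comp_apply, levelPart_apply, apply_ite f, map_zero]

theorem map_ofReal_mul (f : ℂ →ₗ[ℝ] ℝ) (r : ℝ) (z : ℂ) : f ((r : ℂ) * z) = r * f z := by
  rw [← Complex.real_smul, map_smul, smul_eq_mul]

theorem map_cosMatrix_mulVec (f : ℂ →ₗ[ℝ] ℝ) (θ : ℝ) (v : V → ℂ) :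
    f ∘ (cosMatrix G ℂ θ *ᵥ v) = cosMatrix G ℝ θ *ᵥ (f ∘ v) := by
  ext z
  simp only [Function.comp_apply, mulVec, dotProduct, map_sum, cosMatrix, of_apply]
  exact sum_congr rfl fun y _ => map_ofReal_mul f _ _

theorem map_localQuad (f : ℂ →ₗ[ℝ] ℝ) (x : V) (θ : ℝ) (v : V → ℂ) :
    f ∘ (localQuad G ℂ x θ v) = localQuad G ℝ x θ (f ∘ v) := by
  have h1 : f ∘ (localMap G ℂ x v) = localMap G ℝ x (f ∘ v) := by
    simp only [localMap, LinearMap.comp_apply, mulVecLin_apply]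
    rw [map_levelPart, map_distMatrix_mulVec]
  ext z
  have h2 := congrFun h1 z
  simp only [Function.comp_apply] at h2
  rw [Function.comp_apply, localQuad_apply, localQuad_apply, Pi.add_apply, Pi.add_apply, map_add]
  simp only [Pi.smul_apply, smul_eq_mul, ← h2]
  exact congrArg₂ _ (map_ofReal_mul f _ _) (map_ofReal_mul f _ _)

theorem map_mem_localSpace (f : ℂ →ₗ[ℝ] ℝ) {x : V} {v : V → ℂ} (hv : v ∈ localSpace G ℂ x) :
    f ∘ v ∈ localSpace G ℝ x := by
  refine ⟨by rw [← map_levelPart, hv.1], fun u hu => ?_⟩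
  rw [← distMatrix_one, ← map_distMatrix_mulVec, Function.comp_apply, distMatrix_one, hv.2 u hu,
    map_zero]

/-- Real and imaginary parts suffice, so the positivity arguments over ℝ transfer to complex
modules. -/
theorem eq_zero_of_map {v : V → ℂ} (h : ∀ f : ℂ →ₗ[ℝ] ℝ, f ∘ v = 0) : v = 0 := by
  ext z
  exact Complex.ext (congrFun (h Complex.reLm) z) (congrFun (h Complex.imLm) z)

namespace OddBipartite

variable (H : OddBipartite G)
include H

theorem levelPart_eq_zero {K : Type*} [Semiring K] (x : V) {i : ℕ} (hi : G.diam < i) (v : V → K) :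
    levelPart G x i v = 0 := by
  ext z
  have := H.dist_le x z
  rw [levelPart_apply, if_neg (by omega)]
  rfl

theorem isTModule_iff {x : V} {W : Submodule ℂ (V → ℂ)} :
    IsTModule G x W ↔ (∀ w ∈ W, G.adjMatrix ℂ *ᵥ w ∈ W) ∧ ∀ i, ∀ w ∈ W, levelPart G x i w ∈ W := by
  constructor
  · intro h
    refine ⟨fun w hw => h _ (Algebra.subset_adjoin (Or.inl rfl)) w hw, fun i w hw => ?_⟩
    by_cases hi : i ≤ G.diam
    · rw [← dualIdempotent_mulVec]
      exact h _ (Algebra.subset_adjoin (Or.inr ⟨i, hi, rfl⟩)) w hw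
    · rw [H.levelPart_eq_zero x (by omega)]
      exact W.zero_mem
  · rintro ⟨h1, h2⟩ B hB
    induction hB using Algebra.adjoin_induction with
    | mem B hB =>
      rcases hB with rfl | ⟨i, -, rfl⟩
      · exact h1
      · intro w hw
        rw [dualIdempotent_mulVec]
        exact h2 i w hw
    | algebraMap r =>
      intro w hw
      rw [Algebra.algebraMap_eq_smul_one, smul_mulVec, one_mulVec]
      exact W.smul_mem r hw
    | add B C _ _ hB hC =>
      intro w hw
      rw [add_mulVec]
      exact W.add_mem (hB w hw) (hC w hw)
    | mul B C _ _ hB hC =>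
      intro w hw
      rw [← mulVec_mulVec]
      exact hB _ (hC w hw)

theorem sum_levelPart {K : Type*} [Semiring K] (x : V) (v : V → K) :
    ∑ i ∈ range (G.diam + 1), levelPart G x i v = v := by
  ext z
  have := H.dist_le x z
  simp only [Finset.sum_apply, levelPart_apply]
  rw [sum_ite_eq, if_pos (by rw [mem_range]; omega)]

theorem distMatrix_mulVec_apply_eq_zero {K : Type*} [CommRing K] {x : V} {v : V → K}
    (hv : levelPart G x 2 v = v) {z : V} {l : ℕ}
    (hl : G.dist x z + 2 < l ∨ l + 2 < G.dist x z) : (distMatrix G K l *ᵥ v) z = 0 := by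
  rw [distMatrix_mulVec_apply]
  refine sum_eq_zero fun y _ => ?_
  by_cases hy : G.dist x y = 2
  · have h1 := H.dist_triangle z x y
    have h2 := H.dist_triangle x y z
    rw [SimpleGraph.dist_comm (u := z) (v := x)] at h1
    rw [SimpleGraph.dist_comm (u := y)] at h2
    rw [if_neg (by omega)]
  · rw [← hv, levelPart_apply, if_neg hy, ite_self]

theorem levelPart_adjMatrix_levelPart {K : Type*} [CommRing K] (x : V) (i : ℕ) (v : V → K) :
    G.adjMatrix K *ᵥ levelPart G x (i + 1) v
      = levelPart G x (i + 2) (G.adjMatrix K *ᵥ levelPart G x (i + 1) v)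
        + levelPart G x i (G.adjMatrix K *ᵥ levelPart G x (i + 1) v) := by
  ext z
  simp only [Pi.add_apply, levelPart_apply]
  by_cases h1 : G.dist x z = i + 2
  · simp [h1]
  · by_cases h2 : G.dist x z = i
    · simp [h2]
    · rw [if_neg h1, if_neg h2, add_zero, SimpleGraph.adjMatrix_mulVec_apply]
      refine sum_eq_zero fun w hw => ?_
      rw [SimpleGraph.mem_neighborFinset] at hw
      have := H.dist_adj hw x
      rw [SimpleGraph.dist_comm (u := z), SimpleGraph.dist_comm (u := w)] at this
      rw [levelPart_apply, if_neg (by omega)]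

/-- Raising the lower parts. -/
theorem levelPart_adjMatrix_lowerVec {K : Type*} [CommRing K] {x : V} {v : V → K}
    (hv : levelPart G x 2 v = v) (i : ℕ) :
    levelPart G x (i + 3) (G.adjMatrix K *ᵥ lowerVec G x v (i + 2))
      = (c G (i + 1) : K) • lowerVec G x v (i + 3) := by
  ext z
  simp only [lowerVec, levelPart_apply, Pi.smul_apply, Nat.add_sub_cancel,
    show i + 3 - 2 = i + 1 by omega]
  by_cases hz : G.dist x z = i + 3
  · rw [if_pos hz, if_pos hz]
    have h1 : (G.adjMatrix K *ᵥ levelPart G x (i + 2) (distMatrix G K i *ᵥ v)) z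
        = (G.adjMatrix K *ᵥ (distMatrix G K i *ᵥ v)) z := by
      rw [SimpleGraph.adjMatrix_mulVec_apply, SimpleGraph.adjMatrix_mulVec_apply]
      refine sum_congr rfl fun w hw => ?_
      rw [SimpleGraph.mem_neighborFinset] at hw
      have := H.dist_adj hw x
      rw [SimpleGraph.dist_comm (u := z), SimpleGraph.dist_comm (u := w)] at this
      rw [levelPart_apply]
      split_ifs with h
      · rfl
      · rw [H.distMatrix_mulVec_apply_eq_zero hv (by omega)]
    rw [h1, mulVec_mulVec]
    rcases i with _ | i
    · rw [H.distMatrix_zero, mul_one, distMatrix_one, H.c_one]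
      simp
    · rw [H.adjMatrix_mul_distMatrix, add_mulVec, smul_mulVec, smul_mulVec, Pi.add_apply,
        Pi.smul_apply, Pi.smul_apply, H.distMatrix_mulVec_apply_eq_zero hv (l := i) (by omega),
        smul_zero, add_zero]
  · rw [if_neg hz, if_neg hz, smul_zero]

/-- Lowering the upper parts. -/
theorem levelPart_adjMatrix_upperVec {K : Type*} [CommRing K] {x : V} {v : V → K}
    (hv : levelPart G x 2 v = v) (i : ℕ) :
    levelPart G x i (G.adjMatrix K *ᵥ upperVec G x v (i + 1))
      = (b G (i + 2) : K) • upperVec G x v i := by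
  ext z
  simp only [upperVec, levelPart_apply, Pi.smul_apply]
  by_cases hz : G.dist x z = i
  · rw [if_pos hz, if_pos hz]
    have h1 : (G.adjMatrix K *ᵥ levelPart G x (i + 1) (distMatrix G K (i + 1 + 2) *ᵥ v)) z
        = (G.adjMatrix K *ᵥ (distMatrix G K (i + 2 + 1) *ᵥ v)) z := by
      rw [SimpleGraph.adjMatrix_mulVec_apply, SimpleGraph.adjMatrix_mulVec_apply]
      refine sum_congr rfl fun w hw => ?_
      rw [SimpleGraph.mem_neighborFinset] at hw
      have := H.dist_adj hw x
      rw [SimpleGraph.dist_comm (u := z), SimpleGraph.dist_comm (u := w)] at this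
      rw [levelPart_apply]
      split_ifs with h
      · rfl
      · rw [H.distMatrix_mulVec_apply_eq_zero hv (by omega)]
    rw [h1, mulVec_mulVec, H.adjMatrix_mul_distMatrix, add_mulVec, smul_mulVec, smul_mulVec,
      Pi.add_apply, Pi.smul_apply, Pi.smul_apply,
      H.distMatrix_mulVec_apply_eq_zero hv (l := i + 2 + 2) (by omega), smul_zero, zero_add]
  · rw [if_neg hz, if_neg hz, smul_zero]

theorem lowerVec_two {K : Type*} [CommRing K] {x : V} {v : V → K}
    (hv : levelPart G x 2 v = v) : lowerVec G x v 2 = v := by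
  rw [lowerVec, Nat.sub_self, H.distMatrix_zero, one_mulVec, hv]

theorem lowerVec_eq_zero {K : Type*} [CommRing K] {x : V} {v : V → K}
    (hv : levelPart G x 2 v = v) {i : ℕ} (hi : i < 2) : lowerVec G x v i = 0 := by
  rw [lowerVec, show i - 2 = 0 by omega, H.distMatrix_zero, one_mulVec, ← hv, levelPart_levelPart,
    if_neg (by omega)]

theorem upperVec_eq_zero {K : Type*} [CommRing K] {x : V} {v : V → K}
    {i : ℕ} (hi : G.diam < i + 2) : upperVec G x v i = 0 := by
  rw [upperVec, H.distMatrix_eq_zero hi, zero_mulVec, map_zero]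

/-- If lowering respects the lower parts then their span is invariant under the adjacency matrix. -/
theorem adjMatrix_mulVec_mem_ladder {K : Type*} [CommRing K] {x : V} {v : V → K}
    (hv : v ∈ localSpace G K x)
    (h : ∀ i, levelPart G x (i + 2) (G.adjMatrix K *ᵥ lowerVec G x v (i + 3)) ∈ ladder G x v)
    {w : V → K} (hw : w ∈ ladder G x v) : G.adjMatrix K *ᵥ w ∈ ladder G x v := by
  have hle : (ladder G x v).map (G.adjMatrix K).mulVecLin ≤ ladder G x v := by
    rw [ladder, Submodule.map_span, Submodule.span_le]
    rintro _ ⟨_, ⟨j, rfl⟩, rfl⟩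
    rw [mulVecLin_apply]
    rcases lt_or_ge j 2 with hj | hj
    · rw [H.lowerVec_eq_zero hv.1 hj, mulVec_zero]
      exact Submodule.zero_mem _
    · obtain ⟨i, rfl⟩ := Nat.exists_eq_add_of_le' hj
      have h1 := H.levelPart_adjMatrix_levelPart x (i + 1) (distMatrix G K (i + 2 - 2) *ᵥ v)
      have h2 := H.levelPart_adjMatrix_lowerVec hv.1 i
      change G.adjMatrix K *ᵥ lowerVec G x v (i + 2)
        = levelPart G x (i + 3) (G.adjMatrix K *ᵥ lowerVec G x v (i + 2))
        + levelPart G x (i + 1) (G.adjMatrix K *ᵥ lowerVec G x v (i + 2)) at h1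
      rw [h1, h2]
      refine Submodule.add_mem _ (Submodule.smul_mem _ _ (Submodule.subset_span ⟨_, rfl⟩)) ?_
      rcases i with _ | i
      · have : levelPart G x 1 (G.adjMatrix K *ᵥ lowerVec G x v 2) = 0 := by
          rw [H.lowerVec_two hv.1]
          ext u
          rw [levelPart_apply]
          split_ifs with hu
          · exact hv.2 u (SimpleGraph.dist_eq_one_iff_adj.mp hu)
          · rfl
        rw [zero_add, zero_add, this]
        exact Submodule.zero_mem _
      · exact h i
  exact hle ⟨w, hw, rfl⟩

/-- A local vector killed by the cosine matrix has proportional lower and upper parts. -/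
theorem smul_lowerVec_eq {K : Type*} [RCLike K] {θ : ℝ} {x : V} {v : V → K}
    (hv : v ∈ localSpace G K x) (h : cosMatrix G K θ *ᵥ v = 0) (i : ℕ) :
    ((cosine G θ i - cosine G θ (i + 2) : ℝ) : K) • lowerVec G x v (i + 2)
      = ((cosine G θ (i + 2) - cosine G θ (i + 4) : ℝ) : K) • upperVec G x v (i + 2) := by
  ext z
  simp only [lowerVec, upperVec, Pi.smul_apply, levelPart_apply, smul_eq_mul, Nat.add_sub_cancel]
  by_cases hz : G.dist x z = i + 2
  · rw [if_pos hz, if_pos hz]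
    -- Φ_θ v = 0 relates three distance sums at z; their total is also zero, which eliminates the
    -- middle one.
    have h1 := H.distMatrix_add_add hv (by omega) hz
    have h2 : (cosMatrix G K θ *ᵥ v) z = (cosine G θ i : K) * (distMatrix G K i *ᵥ v) z
        + (cosine G θ (i + 2) : K) * (distMatrix G K (i + 2) *ᵥ v) z
        + (cosine G θ (i + 4) : K) * (distMatrix G K (i + 4) *ᵥ v) z := by
      rw [mulVec, dotProduct]
      simp only [distMatrix_mulVec_apply, mul_sum, cosMatrix, of_apply]
      rw [← sum_add_distrib, ← sum_add_distrib]
      refine sum_congr rfl fun y _ => ?_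
      by_cases hy : G.dist x y = 2
      · have t1 := H.dist_triangle z x y
        have t2 := H.dist_triangle x y z
        obtain ⟨m, h4⟩ := H.even_dist_add x z y
        rw [SimpleGraph.dist_comm (u := z) (v := x)] at t1
        rw [SimpleGraph.dist_comm (u := y)] at t2
        have : G.dist z y = i ∨ G.dist z y = i + 2 ∨ G.dist z y = i + 4 := by omega
        rcases this with h | h | h <;> rw [h] <;> simp
      · rw [apply_eq_zero_of_mem_localSpace hv hy]; simp
    rw [h, Pi.zero_apply] at h2
    simp only [Nat.add_sub_cancel] at h1
    push_cast
    linear_combination - h2 - (cosine G θ (i + 2) : K) * h1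
  · rw [if_neg hz, if_neg hz, mul_zero, mul_zero]

/-- The differences of cosines can be inverted by `cosine_ne_cosine`. Beyond level D - 2 the upper
part is zero, so the cosine at i+4, meaningless there, is not used. -/
theorem lowerVec_mem_span_upperVec {K : Type*} [RCLike K] {θ : ℝ}
    (hθ : θ = eigenvalue G 1 ∨ θ = eigenvalue G (G.diam / 2)) {x : V} {v : V → K}
    (hv : v ∈ localSpace G K x) (h : cosMatrix G K θ *ᵥ v = 0) (i : ℕ) :
    (∃ a : K, lowerVec G x v (i + 2) = a • upperVec G x v (i + 2)) ∧
      ∃ a : K, upperVec G x v (i + 2) = a • lowerVec G x v (i + 2) := by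
  have h5 := H.five_le
  have h1 := H.smul_lowerVec_eq hv h i
  rcases le_or_gt (i + 2) G.diam with hi | hi
  · have hne : ((cosine G θ i - cosine G θ (i + 2) : ℝ) : K) ≠ 0 := by
      rw [Ne, RCLike.ofReal_eq_zero, sub_eq_zero]
      exact H.cosine_ne_cosine hθ hi
    refine ⟨⟨_, by rw [mul_smul, ← h1, inv_smul_smul₀ hne]⟩, ?_⟩
    rcases le_or_gt (i + 4) G.diam with hi' | hi'
    · have hne' : ((cosine G θ (i + 2) - cosine G θ (i + 4) : ℝ) : K) ≠ 0 := by
        rw [Ne, RCLike.ofReal_eq_zero, sub_eq_zero]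
        exact H.cosine_ne_cosine hθ hi'
      exact ⟨_, by rw [mul_smul, h1, inv_smul_smul₀ hne']⟩
    · exact ⟨0, by rw [H.upperVec_eq_zero (by omega), zero_smul]⟩
  · have e1 : lowerVec G x v (i + 2) = 0 := H.levelPart_eq_zero x hi _
    have e2 : upperVec G x v (i + 2) = 0 := H.levelPart_eq_zero x hi _
    rw [e1, e2]
    exact ⟨⟨0, by simp⟩, ⟨0, by simp⟩⟩

/-- Raising is always known on lower parts and lowering on upper parts. Since the two are
proportional, lowering is known on lower parts too. -/
theorem ladder_invariant {K : Type*} [RCLike K] {θ : ℝ}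
    (hθ : θ = eigenvalue G 1 ∨ θ = eigenvalue G (G.diam / 2)) {x : V} {v : V → K}
    (hv : v ∈ localSpace G K x) (h : cosMatrix G K θ *ᵥ v = 0) {w : V → K}
    (hw : w ∈ ladder G x v) : G.adjMatrix K *ᵥ w ∈ ladder G x v := by
  refine H.adjMatrix_mulVec_mem_ladder hv (fun i => ?_) hw
  obtain ⟨a, ha⟩ := (H.lowerVec_mem_span_upperVec hθ hv h (i + 1)).1
  obtain ⟨a', ha'⟩ := (H.lowerVec_mem_span_upperVec hθ hv h i).2
  rw [show i + 3 = i + 1 + 2 by ring, ha, mulVec_smul, map_smul, show i + 1 + 2 = i + 2 + 1 by ring,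
    H.levelPart_adjMatrix_upperVec hv.1, ha']
  exact Submodule.smul_mem _ _ (Submodule.smul_mem _ _ (Submodule.smul_mem _ _
    (Submodule.subset_span ⟨_, rfl⟩)))

theorem isTModule_ladder {θ : ℝ}
    (hθ : θ = eigenvalue G 1 ∨ θ = eigenvalue G (G.diam / 2)) {x : V} {v : V → ℂ}
    (hv : v ∈ localSpace G ℂ x) (h : cosMatrix G ℂ θ *ᵥ v = 0) :
    IsTModule G x (ladder G x v) := by
  rw [H.isTModule_iff]
  refine ⟨fun w hw => H.ladder_invariant hθ hv h hw, fun i w hw => ?_⟩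
  refine Submodule.span_mono ?_ (levelPart_mem_ladder hw i)
  rintro _ rfl
  exact ⟨i, rfl⟩

/-- A_2 is a polynomial in A because c_2 A_2 = A² - k. -/
theorem localMap_mem_of_isTModule {x : V} {W : Submodule ℂ (V → ℂ)} (hW : IsTModule G x W)
    {v : V → ℂ} (hv : v ∈ W) : localMap G ℂ x v ∈ W := by
  have h5 := H.five_le
  rw [H.isTModule_iff] at hW
  refine hW.2 2 _ ?_
  have h1 := H.adjMatrix_sq_mulVec v
  have h2 : distMatrix G ℂ 2 *ᵥ v = (c G 2 : ℂ)⁻¹ • (G.adjMatrix ℂ *ᵥ (G.adjMatrix ℂ *ᵥ v)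
      - (valency G : ℂ) • v) := by
    rw [h1, add_sub_cancel_right, inv_smul_smul₀ (H.cast_c_ne (by norm_num) (by omega))]
  rw [mulVecLin_apply, h2]
  exact W.smul_mem _ (W.sub_mem (hW.1 _ (hW.1 _ hv)) (W.smul_mem _ hv))

theorem localQuad_mem_of_isTModule {x : V} {W : Submodule ℂ (V → ℂ)} (hW : IsTModule G x W)
    {v : V → ℂ} (hv : v ∈ W) (θ : ℝ) : localQuad G ℂ x θ v ∈ W := by
  rw [localQuad_apply]
  exact W.add_mem (W.smul_mem _ hv) (W.smul_mem _ (H.localMap_mem_of_isTModule hW hv))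

/-- A module of endpoint two contains a nonzero local vector. -/
theorem exists_mem_localSpace {x : V} {W : Submodule ℂ (V → ℂ)} (hW : IsTModule G x W)
    (he : endpoint G x W = 2) : ∃ v ∈ W, v ≠ 0 ∧ v ∈ localSpace G ℂ x := by
  have h5 := H.five_le
  rw [H.isTModule_iff] at hW
  have hne : {i | i ≤ G.diam ∧ component G x W i ≠ ⊥}.Nonempty := by
    by_contra h
    rw [Set.not_nonempty_iff_eq_empty] at h
    rw [endpoint, h] at he
    simp at he
  have h2 := Nat.sInf_mem hne
  change (endpoint G x W) ≤ _ ∧ component G x W (endpoint G x W) ≠ ⊥ at h2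
  rw [he, component_eq_map] at h2
  obtain ⟨_, ⟨w, hw, rfl⟩, hne'⟩ := Submodule.exists_mem_ne_zero_of_ne_bot h2.2
  have hmem := hW.2 2 w hw
  refine ⟨_, hmem, hne', by rw [levelPart_levelPart, if_pos rfl], fun u hu => ?_⟩
  have h1 : component G x W 1 = ⊥ := by
    by_contra h
    have : endpoint G x W ≤ 1 := Nat.sInf_le ⟨by omega, h⟩
    omega
  rw [component_eq_map, Submodule.eq_bot_iff] at h1
  have h3 := congrFun (h1 _ ⟨_, hW.1 _ hmem, rfl⟩) u
  rw [levelPart_apply, if_pos (SimpleGraph.dist_eq_one_iff_adj.mpr hu)] at h3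
  exact h3

theorem cosMatrix_mulVec_eq_zero_complex {θ : ℝ} (hθ : IsEigenvalue G θ)
    {x : V} {v : V → ℂ} (hv : v ∈ localSpace G ℂ x) (h : localQuad G ℂ x θ v = 0) :
    cosMatrix G ℂ θ *ᵥ v = 0 := by
  refine eq_zero_of_map fun f => ?_
  rw [map_cosMatrix_mulVec]
  refine H.cosMatrix_mulVec_eq_zero hθ (map_mem_localSpace f hv) ?_
  have : f ∘ (0 : V → ℂ) = 0 := by ext; simp
  rw [← map_localQuad, h, this, dotProduct_zero]

theorem localQuad_mul_eq_zero_complex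
    (h : fundamental G (eigenvalue G 1) (eigenvalue G (G.diam / 2)) = 0)
    {x : V} {v : V → ℂ} (hv : v ∈ localSpace G ℂ x) :
    localQuad G ℂ x (eigenvalue G 1) (localQuad G ℂ x (eigenvalue G (G.diam / 2)) v) = 0 := by
  refine eq_zero_of_map fun f => ?_
  rw [map_localQuad, map_localQuad]
  exact H.localQuad_mul_eq_zero h (map_mem_localSpace f hv)

/-- An irreducible W of endpoint 2 meets the ladder of one of its local vectors, so it lies in that
ladder, which has at most one dimension on each level. -/
theorem isTwoThin (h : fundamental G (eigenvalue G 1) (eigenvalue G (G.diam / 2)) = 0) (x : V) :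
    IsTwoThin G x := by
  rintro W ⟨hW, hbot, hirr⟩ he i -
  obtain ⟨w, hwW, hw0, hw⟩ := H.exists_mem_localSpace hW he
  obtain ⟨θ, hθ, v, hvW, hv0, hv, hQ⟩ : ∃ θ, (θ = eigenvalue G 1 ∨ θ = eigenvalue G (G.diam / 2)) ∧
      ∃ v ∈ W, v ≠ 0 ∧ v ∈ localSpace G ℂ x ∧ localQuad G ℂ x θ v = 0 := by
    -- Since the product of the two operators kills w, either w is killed by the first one applied,
    -- or its nonzero image is killed by the second.
    by_cases h0 : localQuad G ℂ x (eigenvalue G (G.diam / 2)) w = 0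
    · exact ⟨_, Or.inr rfl, w, hwW, hw0, hw, h0⟩
    · exact ⟨_, Or.inl rfl, _, H.localQuad_mem_of_isTModule hW hwW _, h0, H.localQuad_mem hw _,
        H.localQuad_mul_eq_zero_complex h hw⟩
  have hΦ := H.cosMatrix_mulVec_eq_zero_complex (H.isEigenvalue_extremal hθ) hv hQ
  have hT := H.isTModule_ladder hθ hv hΦ
  have hvl : v ∈ ladder G x v := by
    have : lowerVec G x v 2 ∈ ladder G x v := Submodule.subset_span ⟨2, rfl⟩
    rwa [H.lowerVec_two hv.1] at this
  have hle : W ≤ ladder G x v := by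
    have hT' : IsTModule G x (W ⊓ ladder G x v) :=
      fun B hB w hw => ⟨hW B hB w hw.1, hT B hB w hw.2⟩
    rcases hirr _ hT' inf_le_left with h0 | h0
    · exact absurd ((Submodule.eq_bot_iff _).mp h0 v ⟨hvW, hvl⟩) hv0
    · exact inf_eq_left.mp h0
  have hcomp : component G x W i ≤ Submodule.span ℂ {lowerVec G x v i} := by
    rw [component_eq_map]
    rintro _ ⟨w, hw, rfl⟩
    exact levelPart_mem_ladder (hle hw) i
  exact (Submodule.finrank_mono hcomp).trans (finrank_span_le_card _)|>.trans (by simp)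

end OddBipartite
end DRG

/-! ### The fundamental equation implies an antipodal 2-cover. -/

namespace DRG
open Finset Matrix

variable {V : Type*} [Fintype V] [DecidableEq V] {G : SimpleGraph V} [DecidableRel G.Adj]

/-- A Hankel determinant factors through the fundamental expression. -/
theorem hankel_identity {B1 B2 B3 S T p : ℝ} (hB1 : B1 ≠ 0) (hB2 : B2 ≠ 0) (hB3 : B3 ≠ 0)
    (hk : 1 + B1 ≠ 0) (hc : 1 + B1 - B2 ≠ 0) {g2 n3 g4 m2 m3 m4 : ℝ}
    (hp : (1 + B1 - B2) * p = (1 + B1 - B2) * (B1 - 1) + B2 * (B1 - B3))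
    (hg2 : ((1 + B1) * B1) ^ 2 * g2 = (S - (1 + B1)) * (T - (1 + B1)))
    (hn3 : ((1 + B1) * B1 * B2) ^ 2 * n3
      = (S - (1 + B1) - (1 + B1 - B2) * B1) * (T - (1 + B1) - (1 + B1 - B2) * B1))
    (hg4 : ((1 + B1) * B1 * B2 * B3) ^ 2 * g4
      = (S * (S - (1 + B1) - (1 + B1 - B2) * B1) - (1 + B1 - B3) * B2 * (S - (1 + B1)))
        * (T * (T - (1 + B1) - (1 + B1 - B2) * B1) - (1 + B1 - B3) * B2 * (T - (1 + B1))))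
    (hm2 : m2 = (1 + B1) * (1 + B1 * g2))
    (hm3 : m3 = 1 + (1 + B1) * B1 * ((1 + B1 - B2) / (1 + B1) ^ 2 + B2 * n3))
    (hm4 : m4 = (1 + B1) * (m2 + B1 * ((1 + B1 - B2) * (1 + B1 * g2)
      + B2 * ((1 + B1 - B3) * g2 + B3 * g4)))) :
    (m2 * m4 + 2 * (S * T / (1 + B1)) * m3 * m2 - m2 ^ 3 - S * T * m3 ^ 2
      - S * T / (1 + B1) ^ 2 * m4) * ((1 + B1) ^ 3 * B1 ^ 3 * B2 ^ 2 * B3 * (B2 - 1))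
    = (B3 * (B2 * (B1 - 1) - (B1 - B2) * S) * (B2 * (B1 - 1) - (B1 - B2) * T)
      - B1 * ((B1 - 1) * (B1 - B3) - (B1 - B2) * p) * (S - B2) * (B2 - T))
      * ((1 + B1 - B2) * ((1 + B1) ^ 2 - S) ^ 2 * ((1 + B1) ^ 2 - T) ^ 2) := by
  -- Dictionary: B_i = b_i, S = θ², T = φ²; `g2` and `g4` are the cosine products at 2 and 4, while
  -- `n3` and `m3` are the cosine product at 3 and the third moment, both divided by θφ, so that
  -- only squares of θ and φ occur.
  have e2 : g2 = (S - (1 + B1)) * (T - (1 + B1)) / ((1 + B1) * B1) ^ 2 := by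
    rw [← hg2]; field_simp
  have e3 : n3 = (S - (1 + B1) - (1 + B1 - B2) * B1) * (T - (1 + B1) - (1 + B1 - B2) * B1)
      / ((1 + B1) * B1 * B2) ^ 2 := by
    rw [← hn3]; field_simp
  have e4 : g4 = (S * (S - (1 + B1) - (1 + B1 - B2) * B1) - (1 + B1 - B3) * B2 * (S - (1 + B1)))
        * (T * (T - (1 + B1) - (1 + B1 - B2) * B1) - (1 + B1 - B3) * B2 * (T - (1 + B1)))
      / ((1 + B1) * B1 * B2 * B3) ^ 2 := by
    rw [← hg4]; field_simp
  have ep : p = ((1 + B1 - B2) * (B1 - 1) + B2 * (B1 - B3)) / (1 + B1 - B2) := by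
    rw [← hp]; field_simp
  subst hm4 hm3 hm2 e2 e3 e4 ep
  field_simp
  ring

/-- The action of the adjacency matrix on functions of the distance. -/
noncomputable def radialMap (G : SimpleGraph V) (h : ℕ → ℝ) (i : ℕ) : ℝ :=
  c G i * h (i - 1) + b G i * h (i + 1)

/-- The product of two cosine sequences. -/
noncomputable def cosineProd (G : SimpleGraph V) (θ φ : ℝ) (i : ℕ) : ℝ :=
  cosine G θ i * cosine G φ i

/-- The deviation of a product of cosine sequences from a linear relation between consecutive
differences. -/
noncomputable def deviation (G : SimpleGraph V) (θ φ α β : ℝ) (i : ℕ) : ℝ :=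
  cosineProd G θ φ (i + 1) - cosineProd G θ φ (i - 1)
    - α * cosine G θ i * (cosine G φ (i + 1) - cosine G φ (i - 1))
    - β * cosine G φ i * (cosine G θ (i + 1) - cosine G θ (i - 1))

theorem exists_ne_zero_of_hankel {m₀ m₁ m₂ m₃ m₄ : ℝ}
    (h : m₀ * (m₂ * m₄ - m₃ ^ 2) - m₁ * (m₁ * m₄ - m₂ * m₃) + m₂ * (m₁ * m₃ - m₂ ^ 2) = 0) :
    ∃ u₀ u₁ u₂ : ℝ, (u₀ ≠ 0 ∨ u₁ ≠ 0 ∨ u₂ ≠ 0) ∧ u₀ * m₀ + u₁ * m₁ + u₂ * m₂ = 0 ∧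
      u₀ * m₁ + u₁ * m₂ + u₂ * m₃ = 0 ∧ u₀ * m₂ + u₁ * m₃ + u₂ * m₄ = 0 := by
  have hdet : (!![m₀, m₁, m₂; m₁, m₂, m₃; m₂, m₃, m₄]).det = 0 := by
    rw [det_fin_three]
    simp
    linear_combination h
  obtain ⟨v, hv, hmv⟩ := Matrix.exists_mulVec_eq_zero_iff.mpr hdet
  refine ⟨v 0, v 1, v 2, ?_, ?_, ?_, ?_⟩
  · by_contra hcon
    push Not at hcon
    exact hv (funext fun i => by fin_cases i <;> simp [hcon])
  · have := congrFun hmv 0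
    simp [mulVec, dotProduct, Fin.sum_univ_three] at this
    linear_combination this
  · have := congrFun hmv 1
    simp [mulVec, dotProduct, Fin.sum_univ_three] at this
    linear_combination this
  · have := congrFun hmv 2
    simp [mulVec, dotProduct, Fin.sum_univ_three] at this
    linear_combination this

namespace OddBipartite

variable (H : OddBipartite G)
include H

theorem adjMatrix_mulVec_radial (x : V) (h : ℕ → ℝ) :
    G.adjMatrix ℝ *ᵥ (fun z => h (G.dist z x)) = fun z => radialMap G h (G.dist z x) := by
  ext z
  rw [SimpleGraph.adjMatrix_mulVec_apply, H.sum_neighbor h, radialMap]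

/-- If the Hankel determinant of the moments of a positive semidefinite radial matrix vanishes then
the radial function satisfies a quadratic recurrence. -/
theorem radial_relation {h : ℕ → ℝ}
    (hpsd : (of fun z y : V => h (G.dist z y)).PosSemidef) {u₀ u₁ u₂ : ℝ}
    (e₀ : u₀ * h 0 + u₁ * radialMap G h 0 + u₂ * radialMap G (radialMap G h) 0 = 0)
    (e₁ : u₀ * radialMap G h 0 + u₁ * radialMap G (radialMap G h) 0
      + u₂ * radialMap G (radialMap G (radialMap G h)) 0 = 0)
    (e₂ : u₀ * radialMap G (radialMap G h) 0 + u₁ * radialMap G (radialMap G (radialMap G h)) 0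
      + u₂ * radialMap G (radialMap G (radialMap G (radialMap G h))) 0 = 0) {i : ℕ}
    (hi : i ≤ G.diam) :
    u₀ * h i + u₁ * radialMap G h i + u₂ * radialMap G (radialMap G h) i = 0 := by
  obtain ⟨z, x, hzx⟩ := H.exists_pair hi
  set M : Matrix V V ℝ := of fun z y => h (G.dist z y) with hM
  set A := G.adjMatrix ℝ with hA
  have hcomm : M * A = A * M := by
    have h1 : A * M = of fun z y => radialMap G h (G.dist z y) := by
      ext z y
      have := congrFun (H.adjMatrix_mulVec_radial y h) z
      rw [SimpleGraph.adjMatrix_mulVec_apply] at this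
      rw [hA, SimpleGraph.adjMatrix_mul_apply]
      exact this
    have h2 : Mᵀ = M := by ext z y; simp [hM, SimpleGraph.dist_comm]
    have h3 := congrArg transpose h1
    rw [transpose_mul, h2, hA, SimpleGraph.transpose_adjMatrix, ← hA] at h3
    rw [h3, h1]
    ext z y
    simp [SimpleGraph.dist_comm]
  have hMA : ∀ w : V → ℝ, M *ᵥ (A *ᵥ w) = A *ᵥ (M *ᵥ w) := fun w => by
    rw [mulVec_mulVec, hcomm, mulVec_mulVec]
  set δ : V → ℝ := Pi.single x 1 with hδ
  have hMδ : M *ᵥ δ = fun z => h (G.dist z x) := by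
    ext z
    simp [hM, hδ]
  set u := u₀ • δ + u₁ • (A *ᵥ δ) + u₂ • (A *ᵥ (A *ᵥ δ)) with hu
  have hMu : M *ᵥ u = fun z => u₀ * h (G.dist z x) + u₁ * radialMap G h (G.dist z x)
      + u₂ * radialMap G (radialMap G h) (G.dist z x) := by
    rw [hu]
    simp only [mulVec_add, mulVec_smul, hMA, hMδ]
    rw [hA]
    simp only [H.adjMatrix_mulVec_radial]
    ext z
    simp
  -- As M commutes with A, this is the sum of u_i u_j m_{i+j} with m_j the moments, and the
  -- hypotheses say that the Hankel matrix kills (u₀, u₁, u₂). Semidefiniteness then gives M u = 0,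
  -- read off entrywise.
  have hquad : star u ⬝ᵥ (M *ᵥ u) = 0 := by
    set h' : ℕ → ℝ := fun i => u₀ * h i + u₁ * radialMap G h i + u₂ * radialMap G (radialMap G h) i
      with hh'
    have hlin1 : ∀ i, radialMap G h' i = u₀ * radialMap G h i + u₁ * radialMap G (radialMap G h) i
        + u₂ * radialMap G (radialMap G (radialMap G h)) i := by
      intro i
      rw [radialMap, hh']
      simp only [radialMap]
      ring
    have hlin2 : ∀ i, radialMap G (radialMap G h') i = u₀ * radialMap G (radialMap G h) i
        + u₁ * radialMap G (radialMap G (radialMap G h)) i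
        + u₂ * radialMap G (radialMap G (radialMap G (radialMap G h))) i := by
      intro i
      rw [radialMap, hlin1, hlin1]
      simp only [radialMap]
      ring
    have hMu' : M *ᵥ u = fun z => h' (G.dist z x) := hMu
    have hsingle : ∀ w : V → ℝ, δ ⬝ᵥ w = w x := fun w => by simp [hδ]
    rw [star_trivial, hu, add_dotProduct, add_dotProduct, smul_dotProduct, smul_dotProduct,
      smul_dotProduct, hA, ← dotProduct_adjMatrix_mulVec, ← dotProduct_adjMatrix_mulVec,
      ← dotProduct_adjMatrix_mulVec, ← hA, ← hu, hMu', hA, H.adjMatrix_mulVec_radial,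
      H.adjMatrix_mulVec_radial, hsingle, hsingle, hsingle]
    simp only [SimpleGraph.dist_self, smul_eq_mul]
    rw [hlin1, hlin2, show h' 0 = 0 from e₀, e₁, e₂]
    simp
  have h0 := (hpsd.dotProduct_mulVec_zero_iff u).mp hquad
  rw [hMu] at h0
  have := congrFun h0 z
  rw [← hzx]
  exact this

/-- Makes the quadratic relation monic. If u₂ = 0 then h is an eigenfunction of `radialMap`, to
which `radialMap` is applied once more; a relation with u₀ alone is excluded by h 0 = 1. -/
theorem exists_recurrence {h : ℕ → ℝ} {u₀ u₁ u₂ : ℝ} (h0 : h 0 = 1)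
    (hne : u₀ ≠ 0 ∨ u₁ ≠ 0 ∨ u₂ ≠ 0)
    (hrel : ∀ i ≤ G.diam,
      u₀ * h i + u₁ * radialMap G h i + u₂ * radialMap G (radialMap G h) i = 0) :
    ∃ s p : ℝ, ∀ i ≤ G.diam, radialMap G (radialMap G h) i = s * radialMap G h i - p * h i := by
  by_cases h2 : u₂ = 0
  · subst h2
    by_cases h1 : u₁ = 0
    · subst h1
      have := hrel 0 (Nat.zero_le _)
      rw [h0] at this
      simp at this
      simp [this] at hne
    · have hL : ∀ i ≤ G.diam, radialMap G h i = -(u₀ / u₁) * h i := by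
        intro i hi
        have := hrel i hi
        field_simp
        linear_combination this
      refine ⟨-(u₀ / u₁), 0, fun i hi => ?_⟩
      rw [zero_mul, sub_zero, radialMap, hL (i - 1) (by omega)]
      rcases hi.lt_or_eq with hlt | rfl
      · rw [hL (i + 1) (by omega), radialMap]
        ring
      · have := hL G.diam le_rfl
        rw [H.b_diam, this, Nat.cast_zero, zero_mul, add_zero]
        have h3 : radialMap G h G.diam = c G G.diam * h (G.diam - 1) := by
          rw [radialMap, H.b_diam]; simp
        rw [← this, h3]
        ring
  · refine ⟨-(u₁ / u₂), u₀ / u₂, fun i hi => ?_⟩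
    have := hrel i hi
    field_simp
    linear_combination this

theorem cosine_explicit {θ : ℝ} (hθ : IsEigenvalue G θ) :
    (valency G : ℝ) * cosine G θ 1 = θ ∧
    (valency G : ℝ) * b G 1 * cosine G θ 2 = θ ^ 2 - valency G ∧
    (valency G : ℝ) * b G 1 * b G 2 * cosine G θ 3 = θ * (θ ^ 2 - valency G - c G 2 * b G 1) ∧
    (valency G : ℝ) * b G 1 * b G 2 * b G 3 * cosine G θ 4
      = θ ^ 2 * (θ ^ 2 - valency G - c G 2 * b G 1) - c G 3 * b G 2 * (θ ^ 2 - valency G) := by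
  have h5 := H.five_le
  have r1 := H.cosine_rec hθ (i := 0) (by omega)
  have r2 := H.cosine_rec hθ (i := 1) (by omega)
  have r3 := H.cosine_rec hθ (i := 2) (by omega)
  have r4 := H.cosine_rec hθ (i := 3) (by omega)
  have hb0 : (b G 0 : ℝ) = valency G := rfl
  have q0 : cosine G θ 0 = 1 := rfl
  simp only [zero_add, Nat.reduceAdd, Nat.reduceSub, H.c_zero, H.c_one, Nat.cast_zero, Nat.cast_one,
    zero_mul, one_mul, hb0, q0, mul_one] at r1 r2 r3 r4
  have s2 : (valency G : ℝ) * b G 1 * cosine G θ 2 = θ ^ 2 - valency G := by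
    linear_combination (valency G : ℝ) * r2 + θ * r1
  have s3 : (valency G : ℝ) * b G 1 * b G 2 * cosine G θ 3
      = θ * (θ ^ 2 - valency G - c G 2 * b G 1) := by
    linear_combination (valency G * b G 1 : ℝ) * r3 + θ * s2 - (c G 2 : ℝ) * b G 1 * r1
  refine ⟨r1, s2, s3, ?_⟩
  linear_combination (valency G * b G 1 * b G 2 : ℝ) * r4 + θ * s3 - (c G 3 : ℝ) * b G 2 * s2

/-- The Schur product theorem makes the radial matrix of the cosine products positive semidefinite,
and its Hankel determinant is a multiple of `fundamental` by `hankel_identity`. -/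
theorem cosineProd_recurrence {θ φ : ℝ} (hθ : IsEigenvalue G θ) (hφ : IsEigenvalue G φ)
    (h : fundamental G θ φ = 0) :
    ∃ s p : ℝ, ∀ i ≤ G.diam, radialMap G (radialMap G (cosineProd G θ φ)) i
      = s * radialMap G (cosineProd G θ φ) i - p * cosineProd G θ φ i := by
  have h5 := H.five_le
  have a1 := H.cast_c_add_b (i := 1) (by omega)
  have a2 := H.cast_c_add_b (i := 2) (by omega)
  have a3 := H.cast_c_add_b (i := 3) (by omega)
  have b1 := (H.cast_b_pos (i := 1) (by omega))
  have b2 := (H.cast_b_pos (i := 2) (by omega)).ne'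
  have b3 := (H.cast_b_pos (i := 3) (by omega)).ne'
  have hb2 : (2 : ℝ) ≤ b G 2 := by exact_mod_cast H.two_le_b_two
  have c2 := (H.cast_c_pos (i := 2) (by omega) (by omega)).ne'
  have hp := H.intersectionNumber_two
  have hpsd : (of fun z y : V => cosineProd G θ φ (G.dist z y)).PosSemidef := by
    have e : (of fun z y : V => cosineProd G θ φ (G.dist z y))
        = cosMatrix G ℝ θ ⊙ cosMatrix G ℝ φ := by ext; rfl
    rw [e]
    exact (H.cosMatrix_posSemidef hθ).hadamard (H.cosMatrix_posSemidef hφ)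
  obtain ⟨r1, r2, r3, r4⟩ := H.cosine_explicit hθ
  obtain ⟨t1, t2, t3, t4⟩ := H.cosine_explicit hφ
  have hfund := h
  rw [fundamental, Delta] at hfund
  have m1 : radialMap G (cosineProd G θ φ) 0 = valency G * cosineProd G θ φ 1 := by
    simp [radialMap, H.c_zero, valency]
  have m2 : radialMap G (radialMap G (cosineProd G θ φ)) 0
      = valency G * (1 + b G 1 * cosineProd G θ φ 2) := by
    simp [radialMap, H.c_zero, H.c_one, valency, cosineProd, cosine]
  have m3 : radialMap G (radialMap G (radialMap G (cosineProd G θ φ))) 0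
      = valency G * (valency G * cosineProd G θ φ 1
        + b G 1 * (c G 2 * cosineProd G θ φ 1 + b G 2 * cosineProd G θ φ 3)) := by
    simp [radialMap, H.c_zero, H.c_one, valency]
  have m4 : radialMap G (radialMap G (radialMap G (radialMap G (cosineProd G θ φ)))) 0
      = valency G * (valency G * (1 + b G 1 * cosineProd G θ φ 2)
        + b G 1 * (c G 2 * (1 + b G 1 * cosineProd G θ φ 2)
          + b G 2 * (c G 3 * cosineProd G θ φ 2 + b G 3 * cosineProd G θ φ 4))) := by
    simp [radialMap, H.c_zero, H.c_one, valency, cosineProd, cosine]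
  have m0 : cosineProd G θ φ 0 = 1 := by simp [cosineProd, cosine]
  rw [H.c_one, Nat.cast_one] at a1
  have hk : (valency G : ℝ) = 1 + b G 1 := a1.symm
  have hc2 : (c G 2 : ℝ) = 1 + b G 1 - b G 2 := by linarith
  have hc3 : (c G 3 : ℝ) = 1 + b G 1 - b G 3 := by linarith
  have hk0 : (1 + b G 1 : ℝ) ≠ 0 := by positivity
  rw [hk, hc2, hc3] at hfund
  rw [hc2, hc3] at hp
  rw [hk] at m1 m2
  rw [hk, hc2] at m3
  rw [hk, hc2, hc3] at m4
  rw [hk] at r1 t1 r2 t2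
  rw [hk, hc2] at r3 t3
  rw [hk, hc2, hc3] at r4 t4
  rw [hc2] at c2
  have e1 : cosineProd G θ φ 1 = θ * φ / (1 + b G 1) ^ 2 := by
    rw [eq_div_iff (by positivity), cosineProd]
    linear_combination ((1 + b G 1) * cosine G φ 1) * r1 + θ * t1
  have e2 : ((1 + b G 1 : ℝ) * b G 1) ^ 2 * cosineProd G θ φ 2
      = (θ ^ 2 - (1 + b G 1)) * (φ ^ 2 - (1 + b G 1)) := by
    rw [cosineProd, ← r2, ← t2]
    ring
  obtain ⟨n, hn⟩ : ∃ n : ℝ, ((1 + b G 1 : ℝ) * b G 1 * b G 2) ^ 2 * n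
      = (θ ^ 2 - (1 + b G 1) - (1 + b G 1 - b G 2) * b G 1)
        * (φ ^ 2 - (1 + b G 1) - (1 + b G 1 - b G 2) * b G 1) :=
    ⟨_, mul_div_cancel₀ _ (pow_ne_zero 2 (mul_ne_zero (mul_ne_zero hk0 b1.ne') b2))⟩
  have e3 : cosineProd G θ φ 3 = θ * φ * n := by
    apply mul_left_cancel₀ (pow_ne_zero 2 (mul_ne_zero (mul_ne_zero hk0 b1.ne') b2))
    rw [mul_left_comm, hn, cosineProd]
    linear_combination ((1 + b G 1 : ℝ) * b G 1 * b G 2 * cosine G φ 3) * r3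
      + θ * (θ ^ 2 - (1 + b G 1) - (1 + b G 1 - b G 2) * b G 1) * t3
  have e4 : ((1 + b G 1 : ℝ) * b G 1 * b G 2 * b G 3) ^ 2 * cosineProd G θ φ 4
      = (θ ^ 2 * (θ ^ 2 - (1 + b G 1) - (1 + b G 1 - b G 2) * b G 1)
          - (1 + b G 1 - b G 3) * b G 2 * (θ ^ 2 - (1 + b G 1)))
        * (φ ^ 2 * (φ ^ 2 - (1 + b G 1) - (1 + b G 1 - b G 2) * b G 1)
          - (1 + b G 1 - b G 3) * b G 2 * (φ ^ 2 - (1 + b G 1))) := by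
    rw [cosineProd, ← r4, ← t4]
    ring
  rw [e1, e3] at m3
  rw [e1] at m1
  have key := hankel_identity (p := intersectionNumber G 2 2 2) b1.ne' b2 b3 hk0 c2
    (by linear_combination hp) e2 hn e4 rfl rfl rfl
  have hne : (1 + b G 1 : ℝ) ^ 3 * b G 1 ^ 3 * b G 2 ^ 2 * b G 3 * (b G 2 - 1) ≠ 0 :=
    mul_ne_zero (mul_ne_zero (mul_ne_zero (mul_ne_zero (pow_ne_zero _ hk0) (pow_ne_zero _ b1.ne'))
      (pow_ne_zero _ b2)) b3) (by linarith)
  have key' := (mul_eq_zero.mp (key.trans (mul_eq_zero_of_left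
    (by linear_combination hfund) _))).resolve_right hne
  obtain ⟨u₀, u₁, u₂, hu, f0, f1, f2⟩ := exists_ne_zero_of_hankel
    (m₀ := cosineProd G θ φ 0) (m₁ := radialMap G (cosineProd G θ φ) 0)
    (m₂ := radialMap G (radialMap G (cosineProd G θ φ)) 0)
    (m₃ := radialMap G (radialMap G (radialMap G (cosineProd G θ φ))) 0)
    (m₄ := radialMap G (radialMap G (radialMap G (radialMap G (cosineProd G θ φ)))) 0) (by
      rw [m0, m1, m2, m3, m4, ← key']
      field_simp
      ring)
  exact H.exists_recurrence m0 hu fun i hi => H.radial_relation hpsd f0 f1 f2 hi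


/-- With the conditions on α and β the second-order recurrence becomes b_j b_{j+1} dev(j+1) = c_j
c_{j-1} dev(j-1). As c_0 = 0, the right side vanishes for j = 0 and j = 1, which starts the
induction in both parities. -/
theorem deviation_eq_zero {θ φ s p α β : ℝ} (hθ : IsEigenvalue G θ) (hφ : IsEigenvalue G φ)
    (hrec : ∀ i ≤ G.diam, radialMap G (radialMap G (cosineProd G θ φ)) i
      = s * radialMap G (cosineProd G θ φ) i - p * cosineProd G θ φ i)
    (h1 : α * φ + β * θ = s) (h2 : valency G * (α * θ + β * φ) = valency G ^ 2 + p) {i : ℕ}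
    (hi : i + 1 < G.diam) : deviation G θ φ α β (i + 1) = 0 := by
  have h5 := H.five_le
  -- the image under `radialMap` at the two neighbouring levels, in terms of the deviation
  have hup : ∀ j, j + 1 ≤ G.diam → radialMap G (cosineProd G θ φ) j
      = valency G * cosineProd G θ φ (j + 1)
        + α * cosine G θ j * (φ * cosine G φ j - valency G * cosine G φ (j + 1))
        + β * cosine G φ j * (θ * cosine G θ j - valency G * cosine G θ (j + 1))
        - c G j * deviation G θ φ α β j := by
    intro j hj
    have r := H.cosine_rec hθ (i := j) (by omega)
    have t := H.cosine_rec hφ (i := j) (by omega)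
    have a := H.cast_c_add_b (i := j) (by omega)
    rw [radialMap, deviation, ← a, ← r, ← t]
    simp only [cosineProd]
    ring
  have hdown : ∀ j, j + 1 ≤ G.diam → radialMap G (cosineProd G θ φ) (j + 1)
      = valency G * cosineProd G θ φ j
        + α * cosine G θ (j + 1) * (φ * cosine G φ (j + 1) - valency G * cosine G φ j)
        + β * cosine G φ (j + 1) * (θ * cosine G θ (j + 1) - valency G * cosine G θ j)
        + b G (j + 1) * deviation G θ φ α β (j + 1) := by
    intro j hj
    have r := H.cosine_rec hθ (i := j + 1) (by omega)
    have t := H.cosine_rec hφ (i := j + 1) (by omega)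
    have a := H.cast_c_add_b (i := j + 1) (by omega)
    rw [radialMap, deviation, ← a, ← r, ← t]
    simp only [cosineProd, Nat.add_sub_cancel]
    ring
  have hstep : ∀ j, j + 1 ≤ G.diam → (b G j : ℝ) * b G (j + 1) * deviation G θ φ α β (j + 1)
      = c G j * c G (j - 1) * deviation G θ φ α β (j - 1) := by
    intro j hj
    have q := hrec j (by omega)
    have r := H.cosine_rec hθ (i := j) (by omega)
    have t := H.cosine_rec hφ (i := j) (by omega)
    have a := H.cast_c_add_b (i := j) (by omega)
    rw [radialMap, hdown j hj] at q
    have hL : radialMap G (cosineProd G θ φ) j = c G j * cosineProd G θ φ (j - 1)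
        + b G j * cosineProd G θ φ (j + 1) := rfl
    have hu : (c G j : ℝ) * radialMap G (cosineProd G θ φ) (j - 1)
        = c G j * (valency G * cosineProd G θ φ j
        + α * cosine G θ (j - 1) * (φ * cosine G φ (j - 1) - valency G * cosine G φ j)
        + β * cosine G φ (j - 1) * (θ * cosine G θ (j - 1) - valency G * cosine G θ j)
        - c G (j - 1) * deviation G θ φ α β (j - 1)) := by
      rcases Nat.eq_zero_or_pos j with rfl | hpos
      · rw [H.c_zero]; simp
      · have := hup (j - 1) (by omega)
        rw [Nat.sub_add_cancel hpos] at this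
        rw [this]
    rw [hu, hL] at q
    simp only [cosineProd] at q
    linear_combination q + (valency G * cosine G θ j * cosine G φ j : ℝ) * (-a)
      + (α * valency G * cosine G φ j) * r + (β * valency G * cosine G θ j) * t
      + (c G j * cosine G θ (j - 1) * cosine G φ (j - 1)
        + b G j * cosine G θ (j + 1) * cosine G φ (j + 1)) * (-h1)
      + cosine G θ j * cosine G φ j * h2
  induction i using Nat.strong_induction_on with
  | _ i ih =>
    have h3 := hstep i (by omega)
    have hb : (b G i : ℝ) * b G (i + 1) ≠ 0 :=
      (mul_pos (H.cast_b_pos (by omega)) (H.cast_b_pos hi)).ne'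
    refine (mul_eq_zero.mp (h3.trans ?_)).resolve_left hb
    rcases Nat.lt_or_ge i 2 with h | h
    · have : i = 0 ∨ i = 1 := by omega
      rcases this with rfl | rfl <;> simp [H.c_zero]
    · have := ih (i - 2) (by omega) (by omega)
      rw [show i - 2 + 1 = i - 1 by omega] at this
      rw [this, mul_zero]

/-- A zero at D would propagate down the recurrence, starting from b_D = 0, to the cosine at 0,
which is 1. -/
theorem cosine_diam_ne_zero {θ : ℝ} (hθ : IsEigenvalue G θ) : cosine G θ G.diam ≠ 0 := by
  intro h0
  have key : ∀ j ≤ G.diam, cosine G θ (G.diam - j) = 0 ∧ cosine G θ (G.diam - j + 1) * b G (G.diam - j) = 0 := by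
    intro j hj
    induction j with
    | zero => simp [h0, H.b_diam]
    | succ j ih =>
      obtain ⟨i1, i2⟩ := ih (by omega)
      have r := H.cosine_rec hθ (i := G.diam - j) (by omega)
      have hc := H.cast_c_pos (i := G.diam - j) (by omega) (by omega)
      rw [i1, mul_comm (b G _ : ℝ), i2, mul_zero, add_zero] at r
      have := (mul_eq_zero.mp r).resolve_left hc.ne'
      rw [show G.diam - (j + 1) = G.diam - j - 1 by omega, this,
        show G.diam - j - 1 + 1 = G.diam - j by omega, i1]
      simp
  have := (key G.diam le_rfl).1
  rw [Nat.sub_self] at this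
  exact one_ne_zero this

/-- The linear equation for the intersection numbers has a unique solution. -/
theorem linear_root_unique {K : Type*} [Field K] {θ φ k α β s₀ s₁ r₀ r₁ x y : K}
    (hne : (θ * s₁ - k * s₀) * (φ * r₁ - k * r₀) ≠ 0)
    (hx : x * (k - x) * (s₀ * r₀) + (θ * s₁ - x * s₀) * (φ * r₁ - x * r₀)
      = (k - x) * (k * (s₀ * r₀) + α * s₁ * (φ * r₁ - k * r₀) + β * r₁ * (θ * s₁ - k * s₀)))
    (hy : y * (k - y) * (s₀ * r₀) + (θ * s₁ - y * s₀) * (φ * r₁ - y * r₀)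
      = (k - y) * (k * (s₀ * r₀) + α * s₁ * (φ * r₁ - k * r₀) + β * r₁ * (θ * s₁ - k * s₀))) :
    x = y := by
  by_contra hxy
  -- The square of the unknown cancels inside each equation, and cross-multiplying by k - y and k -
  -- x removes the common right-hand factor.
  have : (x - y) * ((θ * s₁ - k * s₀) * (φ * r₁ - k * r₀)) = 0 := by
    linear_combination (k - y) * hx - (k - x) * hy
  exact hne ((mul_eq_zero.mp this).resolve_left (sub_ne_zero.mpr hxy))

/-- Eliminating the cosines at i+2, the vanishing deviation at i+1 is a linear equation for c_{i+1}
in terms of the cosines at i and i+1. The deviation at D-i-1, rewritten through the reversed cosines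
already known, is the same equation for b_{D-i-1}. Equality of the two numbers yields the next
reversed cosine. -/
theorem reversal {θ φ α β : ℝ} (hθ : θ = eigenvalue G 1 ∨ θ = eigenvalue G (G.diam / 2))
    (hφ : φ = eigenvalue G 1 ∨ φ = eigenvalue G (G.diam / 2))
    (hdev : ∀ i, i + 1 < G.diam → deviation G θ φ α β (i + 1) = 0) (i : ℕ) (hi : i < G.diam) :
    c G i = b G (G.diam - i) ∧
    cosine G θ (G.diam - i) = cosine G θ G.diam * cosine G θ i ∧
    cosine G φ (G.diam - i) = cosine G φ G.diam * cosine G φ i ∧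
    cosine G θ (G.diam - i - 1) = cosine G θ G.diam * cosine G θ (i + 1) ∧
    cosine G φ (G.diam - i - 1) = cosine G φ G.diam * cosine G φ (i + 1) := by
  have h5 := H.five_le
  have eθ := H.isEigenvalue_extremal hθ
  have eφ := H.isEigenvalue_extremal hφ
  -- the next cosine is determined by the reversed intersection number
  have hnext : ∀ {t : ℝ} (ht : IsEigenvalue G t) {i : ℕ}, i < G.diam → c G i = b G (G.diam - i) →
      cosine G t (G.diam - i) = cosine G t G.diam * cosine G t i →
      (c G i : ℝ) * cosine G t (G.diam - i + 1) = c G i * (cosine G t G.diam * cosine G t (i - 1)) →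
      cosine G t (G.diam - i - 1) = cosine G t G.diam * cosine G t (i + 1) := by
    intro t ht i hi hc h1 h2
    have r := H.cosine_rec ht (i := i) (by omega)
    have r' := H.cosine_rec ht (i := G.diam - i) (by omega)
    have a := H.cast_c_add_b (i := i) (by omega)
    have a' := H.cast_c_add_b (i := G.diam - i) (by omega)
    have hb := H.cast_b_pos hi
    rw [← hc] at r' a'
    have e : (c G (G.diam - i) : ℝ) = b G i := by linarith
    rw [e, h1, h2] at r'
    apply mul_left_cancel₀ hb.ne'
    linear_combination r' - cosine G t G.diam * r
  induction i with
  | zero =>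
    have q0 : ∀ t, cosine G t 0 = 1 := fun _ => rfl
    have hc : c G 0 = b G (G.diam - 0) := by rw [H.c_zero, Nat.sub_zero, H.b_diam]
    refine ⟨hc, by simp [q0], by simp [q0], ?_, ?_⟩
    · exact hnext eθ hi hc (by simp [q0]) (by simp [H.c_zero])
    · exact hnext eφ hi hc (by simp [q0]) (by simp [H.c_zero])
  | succ i ih =>
    obtain ⟨hc, s0, r0, s1, r1⟩ := ih (by omega)
    obtain ⟨j, hj⟩ : ∃ j, G.diam = i + 1 + (j + 1) := ⟨G.diam - i - 2, by omega⟩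
    have ej : G.diam - (i + 1) = j + 1 := by omega
    have ej' : G.diam - i = j + 2 := by omega
    have ej'' : G.diam - i - 1 = j + 1 := by omega
    rw [ej''] at s1 r1
    rw [ej'] at s0 r0
    have hR := hdev i hi
    have hR' := hdev j (by omega)
    have b1 := (H.cast_b_pos hi).ne'
    have cj := (H.cast_c_pos (i := j + 1) (by omega) (by omega)).ne'
    have ρ := H.cosine_rec eθ (i := i + 1) (by omega)
    have τ := H.cosine_rec eφ (i := i + 1) (by omega)
    have ρ' := H.cosine_rec eθ (i := j + 1) (by omega)
    have τ' := H.cosine_rec eφ (i := j + 1) (by omega)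
    have a := H.cast_c_add_b (i := i + 1) (by omega)
    have a' := H.cast_c_add_b (i := j + 1) (by omega)
    have σD := H.cosine_diam_ne_zero eθ
    have ρD := H.cosine_diam_ne_zero eφ
    simp only [Nat.add_sub_cancel, Nat.add_assoc, Nat.reduceAdd] at ρ τ ρ' τ'
    simp only [deviation, cosineProd, Nat.add_sub_cancel, Nat.add_assoc, Nat.reduceAdd] at hR hR'
    rw [s1, s0] at ρ'
    rw [r1, r0] at τ'
    rw [s0, r0, s1, r1] at hR'
    have hb' : (c G (i + 1) : ℝ) = b G (j + 1) := by
      refine H.linear_root_unique (θ := θ) (φ := φ) (k := (valency G : ℝ)) (α := α) (β := β)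
        (s₀ := cosine G θ i) (s₁ := cosine G θ (i + 1))
        (r₀ := cosine G φ i) (r₁ := cosine G φ (i + 1)) ?_ ?_ ?_
      · have e1 : θ * cosine G θ (i + 1) - valency G * cosine G θ i
            = b G (i + 1) * (cosine G θ (i + 2) - cosine G θ i) := by
          linear_combination cosine G θ i * a - ρ
        have e2 : φ * cosine G φ (i + 1) - valency G * cosine G φ i
            = b G (i + 1) * (cosine G φ (i + 2) - cosine G φ i) := by
          linear_combination cosine G φ i * a - τ
        rw [e1, e2]
        exact mul_ne_zero
          (mul_ne_zero b1 (sub_ne_zero.mpr (H.cosine_ne_cosine hθ (by omega)).symm))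
          (mul_ne_zero b1 (sub_ne_zero.mpr (H.cosine_ne_cosine hφ (by omega)).symm))
      · rw [← ρ, ← τ, ← a]
        linear_combination (b G (i + 1) : ℝ) ^ 2 * hR
      · have hD : cosine G θ G.diam * cosine G φ G.diam ≠ 0 := mul_ne_zero σD ρD
        apply mul_left_cancel₀ hD
        have e1 : (c G (j + 1) : ℝ) * cosine G θ j = cosine G θ G.diam *
            (θ * cosine G θ (i + 1) - b G (j + 1) * cosine G θ i) := by linear_combination ρ'
        have e2 : (c G (j + 1) : ℝ) * cosine G φ j = cosine G φ G.diam *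
            (φ * cosine G φ (i + 1) - b G (j + 1) * cosine G φ i) := by linear_combination τ'
        rw [← a']
        linear_combination (-(c G (j + 1) : ℝ) ^ 2) * hR'
          - cosine G φ G.diam * (φ * cosine G φ (i + 1) - b G (j + 1) * cosine G φ i) * e1
          - c G (j + 1) * cosine G θ j * e2
          + c G (j + 1) * α * cosine G θ G.diam * cosine G θ (i + 1) * e2
          + c G (j + 1) * β * cosine G φ G.diam * cosine G φ (i + 1) * e1
    have hc' : c G (i + 1) = b G (G.diam - (i + 1)) := by rw [ej]; exact_mod_cast hb'
    have n1 : cosine G θ (G.diam - (i + 1)) = cosine G θ G.diam * cosine G θ (i + 1) := by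
      rw [ej, s1]
    have n2 : cosine G φ (G.diam - (i + 1)) = cosine G φ G.diam * cosine G φ (i + 1) := by
      rw [ej, r1]
    refine ⟨hc', n1, n2, hnext eθ hi hc' n1 ?_, hnext eφ hi hc' n2 ?_⟩
    · rw [ej, s0, Nat.add_sub_cancel]
    · rw [ej, r0, Nat.add_sub_cancel]

theorem card_sphere_eq_sphereSize (x : V) {l : ℕ} (hl : l ≤ G.diam) :
    (#{z | G.dist x z = l} : ℝ) = sphereSize G l := by
  have he : G.adjMatrix ℝ *ᵥ (fun _ => 1) = ((valency G : ℝ) : ℝ) • fun _ : V => (1 : ℝ) := by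
    ext z
    rw [SimpleGraph.adjMatrix_mulVec_apply]
    simp [H.degree_eq z]
  have h1 := congrFun (H.distMatrix_mulVec_eigenvector (K := ℝ) (θ := valency G) he hl) x
  rw [distMatrix_mulVec_apply, H.cosine_valency hl] at h1
  rw [card_filter]
  push_cast
  simpa using h1

/-- The fundamental equation forces the graph to be an antipodal 2-cover. -/
theorem isAntipodalTwoCover
    (h : fundamental G (eigenvalue G 1) (eigenvalue G (G.diam / 2)) = 0) :
    IsAntipodalTwoCover G := by
  have h5 := H.five_le
  set θ := eigenvalue G 1
  set φ := eigenvalue G (G.diam / 2)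
  have eθ := H.isEigenvalue_extremal (θ := θ) (Or.inl rfl)
  have eφ := H.isEigenvalue_extremal (θ := φ) (Or.inr rfl)
  have hk := H.cast_valency_ge
  obtain ⟨s, p, hrec⟩ := H.cosineProd_recurrence eθ eφ h
  -- A linear system whose determinant is, up to sign, k(θ² - φ²), nonzero because b_2 separates the
  -- two squares.
  obtain ⟨α, β, h1, h2⟩ : ∃ α β : ℝ, α * φ + β * θ = s ∧
      valency G * (α * θ + β * φ) = valency G ^ 2 + p := by
    have hne : θ ^ 2 - φ ^ 2 ≠ 0 := by
      have := H.eigenvalue_half_sq_lt_and_lt_eigenvalue_one_sq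
      have : φ ^ 2 < θ ^ 2 := this.1.trans this.2
      linarith
    have hk0 : (valency G : ℝ) ≠ 0 := by linarith
    refine ⟨(θ * ((valency G ^ 2 + p) / valency G) - φ * s) / (θ ^ 2 - φ ^ 2),
      (θ * s - φ * ((valency G ^ 2 + p) / valency G)) / (θ ^ 2 - φ ^ 2), ?_, ?_⟩
    · field_simp
      ring
    · field_simp
      ring
  have hrev := H.reversal (Or.inl rfl) (Or.inr rfl)
    fun i hi => H.deviation_eq_zero eθ eφ hrec h1 h2 hi
  -- The reversed intersection numbers make the sphere sizes palindromic up to a factor; at i = D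
  -- this reads 1 = k_D².
  have hsize : ∀ i, i ≤ G.diam → sphereSize G (G.diam - i) = sphereSize G G.diam * sphereSize G i := by
    intro i hi
    induction i with
    | zero => simp [sphereSize]
    | succ i ih =>
      have e1 := H.sphereSize_succ (l := i) (by omega)
      have e2 := H.sphereSize_succ (l := G.diam - (i + 1)) (by omega)
      rw [show G.diam - (i + 1) + 1 = G.diam - i by omega, ih (by omega)] at e2
      have hc : (c G (i + 1) : ℝ) = b G (G.diam - (i + 1)) := by
        rcases hi.lt_or_eq with hlt | heq
        · exact_mod_cast (hrev (i + 1) hlt).1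
        · rw [heq, Nat.sub_self, H.c_diam]; rfl
      have hb : (c G (G.diam - i) : ℝ) = b G i := by
        have a := H.cast_c_add_b (i := i) (by omega)
        have a' := H.cast_c_add_b (i := G.diam - i) (by omega)
        have : (c G i : ℝ) = b G (G.diam - i) := by exact_mod_cast (hrev i (by omega)).1
        linarith
      have hpos := (H.cast_c_pos (i := i + 1) (by omega) hi).ne'
      rw [← hc, hb] at e2
      apply mul_right_cancel₀ hpos
      linear_combination (-1 : ℝ) * e2 - sphereSize G G.diam * e1
  have hone : sphereSize G G.diam = 1 := by
    have h3 := hsize G.diam le_rfl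
    have h4 := H.sphereSize_pos (l := G.diam) le_rfl
    rw [Nat.sub_self, show sphereSize G 0 = 1 from rfl] at h3
    nlinarith
  intro y
  have h3 := H.card_sphere_eq_sphereSize y (l := G.diam) le_rfl
  rw [hone, Nat.cast_eq_one, card_eq_one] at h3
  obtain ⟨z, hz⟩ := h3
  have hz' : ∀ w, G.dist y w = G.diam ↔ w = z := fun w => by
    have := Finset.ext_iff.mp hz w
    simpa using this
  exact ⟨z, (hz' z).mpr rfl, fun w hw => (hz' w).mp hw⟩

end OddBipartite
end DRG

/-! ### 2-homogeneity implies the fundamental equation. -/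

namespace DRG
open Finset Matrix

variable {V : Type*} [Fintype V] [DecidableEq V] {G : SimpleGraph V} [DecidableRel G.Adj]

namespace OddBipartite

variable (H : OddBipartite G)
include H

/-- A local vector in a small invariant subspace is killed by a nontrivial cosine matrix. -/
theorem exists_cosMatrix_mulVec_eq_zero {K : Type*} [RCLike K] {W : Submodule K (V → K)}
    (hW : ∀ w ∈ W, G.adjMatrix K *ᵥ w ∈ W) {v : V → K} (hv : v ∈ W)
    (hdim : Module.finrank K W + 2 ≤ G.diam) :
    ∃ θ ∈ eigenvalues G, θ ≠ valency G ∧ θ ≠ -valency G ∧ cosMatrix G K θ *ᵥ v = 0 := by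
  have h1 := H.card_support_le_finrank hW hv
  have h2 := card_filter_add_card_filter_not (s := eigenvalues G)
    (fun θ => cosMatrix G K θ *ᵥ v ≠ 0)
  rw [H.card_eigenvalues] at h2
  -- At most D-2 of the D+1 eigenvalues occur in v, so at least three are missing, and one of these
  -- is not ±k.
  have h3 : #({(valency G : ℝ), -(valency G : ℝ)} : Finset ℝ)
      < #{θ ∈ eigenvalues G | ¬ cosMatrix G K θ *ᵥ v ≠ 0} := by
    have := card_le_two (a := (valency G : ℝ)) (b := -(valency G : ℝ))
    omega
  obtain ⟨θ, hθ, hθ'⟩ := exists_mem_notMem_of_card_lt_card h3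
  rw [mem_filter, not_not] at hθ
  rw [mem_insert, mem_singleton, not_or] at hθ'
  exact ⟨θ, hθ.1, hθ'.1, hθ'.2, hθ.2⟩

theorem sq_lt_of_ne {θ : ℝ} (hθ : θ ∈ eigenvalues G) (h1 : θ ≠ valency G)
    (h2 : θ ≠ -valency G) : θ ^ 2 < valency G ^ 2 := by
  have h3 := abs_le.mp (H.abs_le_valency hθ)
  exact sq_lt_sq' (lt_of_le_of_ne h3.1 h2.symm) (lt_of_le_of_ne h3.2 h1)

/-- The form of Q_t at v is affine in t², vanishes at θ² and is nonnegative at θ_1² and θ_d²,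
between which θ² lies. So θ² is one of these ends, unless the slope is zero, and then v = 0. -/
theorem localQuad_mul_eq_zero_of_root {θ : ℝ} (hθ : θ ∈ eigenvalues G) (h1 : θ ≠ valency G)
    (h2 : θ ≠ -valency G) {x : V} {v : V → ℝ} (hv : v ∈ localSpace G ℝ x)
    (h : localQuad G ℝ x θ v = 0) :
    localQuad G ℝ x (eigenvalue G 1) (localQuad G ℝ x (eigenvalue G (G.diam / 2)) v) = 0 := by
  have h5 := H.five_le
  obtain ⟨l1, l2⟩ := H.sq_bounds hθ h1 h2
  have n1 := H.dotProduct_localQuad_nonneg (H.isEigenvalue_extremal (Or.inl rfl))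
    (H.extremal_sq_lt (Or.inl rfl)) hv
  have n2 := H.dotProduct_localQuad_nonneg (H.isEigenvalue_extremal (Or.inr rfl))
    (H.extremal_sq_lt (Or.inr rfl)) hv
  have hexp : ∀ t : ℝ, v ⬝ᵥ localQuad G ℝ x t v = b G 2 * b G 3 * (v ⬝ᵥ v)
      + (t ^ 2 - b G 2) * (v ⬝ᵥ v + v ⬝ᵥ localMap G ℝ x v) := by
    intro t
    simp only [localQuad_apply, dotProduct_add, dotProduct_smul, smul_eq_mul,
      RCLike.ofReal_real_eq_id, id]
    ring
  have h0 := hexp θ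
  rw [h, dotProduct_zero] at h0
  rw [hexp] at n1 n2
  have hcongr : ∀ t : ℝ, t ^ 2 = θ ^ 2 → localQuad G ℝ x t v = 0 := by
    intro t ht
    rw [localQuad_apply, ht, ← localQuad_apply, h]
  rcases lt_trichotomy (v ⬝ᵥ v + v ⬝ᵥ localMap G ℝ x v) 0 with hm | hm | hm
  · rw [localQuad_comm, hcongr (eigenvalue G 1) (by nlinarith), map_zero]
  · rw [hm, mul_zero, add_zero] at h0
    have hb := mul_pos (H.cast_b_pos (i := 2) (by omega)) (H.cast_b_pos (i := 3) (by omega))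
    rw [dotProduct_self_eq_zero.mp ((mul_eq_zero.mp h0.symm).resolve_left hb.ne'), map_zero,
      map_zero]
  · rw [hcongr (eigenvalue G (G.diam / 2)) (by nlinarith), map_zero]

theorem dist_eq_two {u x y : V} (hx : G.Adj u x) (hy : G.Adj u y) (h : x ≠ y) :
    G.dist x y = 2 := by
  have h1 := H.dist_adj hx y
  rw [SimpleGraph.dist_eq_one_iff_adj.mpr hy] at h1
  have h2 : G.dist x y ≠ 0 := fun h0 => h (H.dist_eq_zero.mp h0)
  omega

/-- Two vertices at distance two and two adjacent vertices, equidistant from both. -/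
theorem exists_equidistant_adj {i : ℕ} (h2 : 2 ≤ i) (hi : i < G.diam) :
    ∃ x y z w : V, G.dist x y = 2 ∧ G.dist x z = i ∧ G.dist y z = i ∧ G.Adj z w ∧
      G.dist x w = i - 1 ∧ G.dist y w = i - 1 := by
  by_cases hb : 2 ≤ b G (i - 1)
  · obtain ⟨u, z, huz⟩ := H.exists_pair (i := i - 1) (by omega)
    obtain ⟨w, hzw, hwu⟩ := H.exists_adj_closer (z := z) (y := u)
      (by rintro rfl; rw [SimpleGraph.dist_self] at huz; omega)
    rw [SimpleGraph.dist_comm (u := z), huz] at hwu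
    rw [← huz, ← H.card_b] at hb
    obtain ⟨x, hx, y, hy, hxy⟩ := one_lt_card.mp hb
    rw [mem_filter] at hx hy
    have key : ∀ t, G.Adj u t → G.dist t z = G.dist u z + 1 → G.dist t w = i - 1 := by
      intro t ht htz
      have t1 := H.dist_triangle t u w
      have t2 := H.dist_triangle t w z
      rw [SimpleGraph.dist_eq_one_iff_adj.mpr ht.symm, SimpleGraph.dist_comm (u := u)] at t1
      rw [SimpleGraph.dist_eq_one_iff_adj.mpr hzw.symm] at t2
      omega
    exact ⟨x, y, z, w, H.dist_eq_two hx.2.1 hy.2.1 hxy, by omega, by omega, hzw,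
      key x hx.2.1 hx.2.2, key y hy.2.1 hy.2.2⟩
  -- Here b_{i-1} ≤ 1, so c_i ≥ c_{i-1} ≥ k-1. The two sets of c_i closer neighbours of z must meet,
  -- as 2(k-1) > k.
  · obtain ⟨x, y, z, hxy, hxz, hyz⟩ := H.exists_triple (i := i) (by omega) hi
    have hk := H.three_le
    have hc1 := H.c_add_b (i := i - 1) (by omega)
    have hc2 := H.c_le_of_le (i := i - 1) (j := i) (by omega) (by omega)
    have cx := H.card_c z x
    have cy := H.card_c z y
    have hd := H.degree_eq z
    rw [SimpleGraph.dist_comm (u := z), hxz] at cx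
    rw [SimpleGraph.dist_comm (u := z), hyz] at cy
    have hsub : ∀ t : V, ({w | G.Adj z w ∧ G.dist w t + 1 = i} : Finset V) ⊆ G.neighborFinset z := by
      intro t w hw
      rw [mem_filter] at hw
      rw [SimpleGraph.mem_neighborFinset]
      exact hw.2.1
    obtain ⟨w, hw⟩ := inter_nonempty_of_card_lt_card_add_card (hsub x) (hsub y) (by omega)
    simp only [mem_inter, mem_filter, mem_univ, true_and] at hw
    refine ⟨x, y, z, w, hxy, hxz, hyz, hw.1.1, ?_, ?_⟩ <;> rw [SimpleGraph.dist_comm] <;> omega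

/-- In a 2-homogeneous graph, neighbourhood sums of functions of the two distances depend only on
the two distances. -/
theorem sum_neighbor_two (h2 : IsTwoHomogeneous G) (g : ℕ → ℕ → ℝ) {x y z z' : V}
    (hxy : G.dist x y = 2) (hx : G.dist x z = G.dist x z') (hy : G.dist y z = G.dist y z') :
    ∑ w ∈ G.neighborFinset z, g (G.dist x w) (G.dist y w)
      = ∑ w ∈ G.neighborFinset z', g (G.dist x w) (G.dist y w) := by
  have key : ∀ t : V, ∑ w ∈ G.neighborFinset t, g (G.dist x w) (G.dist y w)
      = ∑ p ∈ range (G.diam + 1) ×ˢ range (G.diam + 1),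
        (#{w | G.Adj t w ∧ G.dist x w = p.1 ∧ G.dist y w = p.2} : ℝ) * g p.1 p.2 := by
    intro t
    rw [← sum_fiberwise_of_maps_to (t := range (G.diam + 1) ×ˢ range (G.diam + 1))
      (g := fun w => (G.dist x w, G.dist y w))]
    · refine sum_congr rfl fun p _ => ?_
      rw [← nsmul_eq_mul, ← sum_const]
      refine sum_congr ?_ fun w hw => ?_
      · ext w
        simp [Prod.ext_iff]
      · rw [mem_filter] at hw
        rw [hw.2.2.1, hw.2.2.2]
    · intro w _
      have := H.dist_le x w
      have := H.dist_le y w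
      simp only [mem_product, mem_range]
      omega
  rw [key, key]
  refine sum_congr rfl fun p _ => ?_
  obtain ⟨n, hn⟩ := h2 (G.dist x z) (G.dist y z) p.1 p.2
  rw [hn x y z hxy rfl rfl, hn x y z' hxy hx.symm hy.symm]

/-- In a 2-homogeneous graph no vertex is at maximal distance from both members of a pair at
distance two. -/
theorem not_both_dist_diam (h2 : IsTwoHomogeneous G) {x y z : V} (hxy : G.dist x y = 2)
    (hx : G.dist x z = G.diam) (hy : G.dist y z = G.diam) : False := by
  have h5 := H.five_le
  obtain ⟨m, hm⟩ := H.odd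
  -- By 2-homogeneity the distance pairs give an equitable partition. Both coordinates have the same
  -- parity, which sorts the types into even and odd ones.
  set types : Finset (ℕ × ℕ) := univ.image fun w => (G.dist x w, G.dist y w) with htypes
  set ev := types.filter fun p => Even p.1 with hev
  set od := types.filter fun p => ¬ Even p.1 with hod
  have hmem : ∀ w, (G.dist x w, G.dist y w) ∈ types := fun w => mem_image_of_mem _ (mem_univ w)
  have hrel : ∀ w, Even (G.dist x w + G.dist y w) := by
    intro w
    have := H.even_dist_add x w y
    rw [hxy, SimpleGraph.dist_comm (u := w)] at this
    simpa [Nat.even_add] using this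
  -- the odd types do not outnumber the even ones
  have hle : #od ≤ #ev := by
    have hrep : ∀ p : ev, ∃ w, (G.dist x w, G.dist y w) = p.1 := by
      intro p
      have h1 := (mem_filter.mp p.2).1
      obtain ⟨w, -, hw⟩ := mem_image.mp h1
      exact ⟨w, hw⟩
    choose rep hrep using hrep
    set ext : (od → ℝ) →ₗ[ℝ] (V → ℝ) :=
      { toFun := fun F w => if h : (G.dist x w, G.dist y w) ∈ od then F ⟨_, h⟩ else 0
        map_add' := fun F F' => by
          ext w; simp only [Pi.add_apply]; split_ifs <;> simp
        map_smul' := fun a F => by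
          ext w; simp only [Pi.smul_apply, RingHom.id_apply]; split_ifs <;> simp } with hext
    set f : (od → ℝ) →ₗ[ℝ] (ev → ℝ) :=
      (LinearMap.funLeft ℝ ℝ rep) ∘ₗ (G.adjMatrix ℝ).mulVecLin ∘ₗ ext with hf
    -- A sends functions constant on types and supported on odd ones to functions constant on even
    -- types, and A is invertible because 0 is not an eigenvalue.
    have hinj : Function.Injective f := by
      rw [← LinearMap.ker_eq_bot, LinearMap.ker_eq_bot']
      intro F hF
      set g : ℕ → ℕ → ℝ := fun i j => if h : (i, j) ∈ od then F ⟨_, h⟩ else 0 with hg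
      have hgext : ∀ w, ext F w = g (G.dist x w) (G.dist y w) := fun w => rfl
      have hzero : G.adjMatrix ℝ *ᵥ ext F = 0 := by
        ext w
        rw [SimpleGraph.adjMatrix_mulVec_apply]
        simp only [hgext]
        by_cases hw : Even (G.dist x w)
        · have hwev : (G.dist x w, G.dist y w) ∈ ev := mem_filter.mpr ⟨hmem w, hw⟩
          have h1 := hrep ⟨_, hwev⟩
          rw [Prod.mk.injEq] at h1
          rw [H.sum_neighbor_two h2 g hxy h1.1.symm h1.2.symm]
          have h3 := congrFun hF ⟨_, hwev⟩
          simp only [hf, LinearMap.comp_apply, LinearMap.funLeft_apply, mulVecLin_apply,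
            SimpleGraph.adjMatrix_mulVec_apply, hgext] at h3
          exact h3
        · refine sum_eq_zero fun u hu => ?_
          rw [SimpleGraph.mem_neighborFinset] at hu
          have h1 := H.dist_adj hu x
          rw [SimpleGraph.dist_comm (u := w), SimpleGraph.dist_comm (u := u)] at h1
          have h3 : Even (G.dist x u) := by
            rw [Nat.not_even_iff_odd] at hw
            obtain ⟨r, hr⟩ := hw
            rw [Nat.even_iff]
            omega
          rw [hg]
          refine dif_neg fun h => ?_
          rw [hod, mem_filter] at h
          exact h.2 h3
      have hz := H.adjMatrix_mulVec_injective hzero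
      ext p
      obtain ⟨w, -, hw⟩ := mem_image.mp (mem_filter.mp p.2).1
      have h1 := congrFun hz w
      have h3 : (G.dist x w, G.dist y w) ∈ od := by
        have := p.2
        rwa [← hw] at this
      have h4 : ext F w = F ⟨_, h3⟩ := dif_pos h3
      rw [h4] at h1
      have h6 : (⟨_, h3⟩ : od) = p := Subtype.ext hw
      rw [h6] at h1
      exact h1
    have := card_le_of_injective ℝ f hinj
    simpa using this
  -- Shifting by (1,1) embeds the even types into the odd types other than (1,1). The critical
  -- shift, of (D-1, D-1) to (D, D), is realised by the supposed vertex z.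
  have hlt : #ev < #od := by
    have hone : (1, 1) ∈ od := by
      obtain ⟨w, hw, hw'⟩ := H.exists_equidistant (i := 1) le_rfl (by omega) hxy
      refine mem_filter.mpr ⟨?_, by simp⟩
      have := hmem w
      rwa [hw, hw'] at this
    have hsub : ev.image (fun p => (p.1 + 1, p.2 + 1)) ⊆ od.erase (1, 1) := by
      intro q hq
      obtain ⟨p, hp, rfl⟩ := mem_image.mp hq
      rw [hev, mem_filter] at hp
      obtain ⟨hp1, hp2⟩ := hp
      obtain ⟨w, -, rfl⟩ := mem_image.mp hp1
      simp only at hp2 ⊢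
      have t1 := H.dist_triangle x w y
      have t2 := H.dist_triangle x y w
      have t3 := H.dist_triangle y x w
      rw [SimpleGraph.dist_comm (u := w)] at t1
      rw [SimpleGraph.dist_comm (u := y) (v := x)] at t3
      have hr := hrel w
      have l1 := H.dist_le x w
      have l2 := H.dist_le y w
      rw [Nat.even_iff] at hp2 hr
      refine mem_erase.mpr ⟨?_, mem_filter.mpr ⟨?_, ?_⟩⟩
      · rw [Ne, Prod.mk.injEq]
        omega
      · rcases Nat.lt_trichotomy (G.dist x w) (G.dist y w) with h | h | h
        · obtain ⟨u, hu, hu'⟩ := H.exists_adj_farther (z := w) (y := y)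
            (by rw [SimpleGraph.dist_comm]; omega)
          have h3 := H.dist_adj hu x
          have h4 := H.dist_triangle x y u
          have h6 := H.dist_triangle y x u
          rw [SimpleGraph.dist_comm (u := w), SimpleGraph.dist_comm (u := u)] at hu' h3
          rw [SimpleGraph.dist_comm (u := y) (v := x)] at h6
          have e1 : G.dist x w + 1 = G.dist x u := by omega
          rw [e1, ← hu']
          exact hmem u
        · rw [← h]
          rcases Nat.lt_or_ge (G.dist x w + 1) G.diam with h3 | h3
          · obtain ⟨u, hu, hu'⟩ := H.exists_equidistant (i := G.dist x w + 1) (by omega) h3 hxy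
            have := hmem u
            rwa [hu, hu'] at this
          · have e1 : G.dist x w + 1 = G.diam := by omega
            have := hmem z
            rwa [hx, hy, ← e1] at this
        · obtain ⟨u, hu, hu'⟩ := H.exists_adj_farther (z := w) (y := x)
            (by rw [SimpleGraph.dist_comm]; omega)
          have h3 := H.dist_adj hu y
          have h6 := H.dist_triangle x y u
          rw [SimpleGraph.dist_comm (u := w), SimpleGraph.dist_comm (u := u)] at hu' h3
          have e1 : G.dist y w + 1 = G.dist y u := by omega
          rw [e1, ← hu']
          exact hmem u
      · rw [Nat.even_iff]
        omega
    have h3 := card_le_card hsub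
    rw [card_image_of_injective _ (fun p q h => by
      rw [Prod.mk.injEq] at h
      exact Prod.ext (by omega) (by omega)), card_erase_of_mem hone] at h3
    have h4 : 0 < #od := card_pos.mpr ⟨_, hone⟩
    omega
  omega

/-- Exchange of summation for a truncated distance sum. -/
theorem adjMatrix_levelPart_distMatrix {x : V} {v : V → ℝ} (i l : ℕ) (z : V) :
    (G.adjMatrix ℝ *ᵥ levelPart G x i (distMatrix G ℝ l *ᵥ v)) z
      = ∑ y, (#{w | G.Adj z w ∧ G.dist x w = i ∧ G.dist w y = l} : ℝ) * v y := by
  rw [SimpleGraph.adjMatrix_mulVec_apply, SimpleGraph.neighborFinset_eq_filter, sum_filter]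
  simp only [levelPart_apply, distMatrix_mulVec_apply, card_filter]
  push_cast
  simp only [sum_mul]
  rw [sum_comm]
  refine sum_congr rfl fun w _ => ?_
  by_cases h1 : G.Adj z w <;> by_cases h2 : G.dist x w = i <;> simp [h1, h2]

theorem sum_mul_eq_of_mem_localSpace {x : V} {v : V → ℝ} (hv : v ∈ localSpace G ℝ x) {f : V → ℝ}
    {α β γ : ℝ} {i j : ℕ} {z : V}
    (h : ∀ y, G.dist x y = 2 → f y = α * (if G.dist z y = i then 1 else 0)
      + β * (if G.dist z y = j then 1 else 0) + γ) :
    ∑ y, f y * v y = α * (distMatrix G ℝ i *ᵥ v) z + β * (distMatrix G ℝ j *ᵥ v) z := by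
  have h0 := H.sum_eq_zero_of_mem_localSpace hv
  have h1 : ∑ y, f y * v y = α * (distMatrix G ℝ i *ᵥ v) z + β * (distMatrix G ℝ j *ᵥ v) z
      + γ * ∑ y, v y := by
    rw [distMatrix_mulVec_apply, distMatrix_mulVec_apply, mul_sum, mul_sum, mul_sum,
      ← sum_add_distrib, ← sum_add_distrib]
    refine sum_congr rfl fun y _ => ?_
    by_cases hy : G.dist x y = 2
    · rw [h y hy]
      split_ifs <;> ring
    · rw [apply_eq_zero_of_mem_localSpace hv hy]
      simp
  rw [h1, h0, mul_zero, add_zero]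

/-- The common part of the closer neighbourhoods and its complement. -/
theorem card_closer_split {x y z : V} {i : ℕ} (hx : G.dist x z = i + 1) (hy : G.dist y z = i + 1) :
    #{w | G.Adj z w ∧ G.dist x w = i ∧ G.dist y w = i}
      + #{w | G.Adj z w ∧ G.dist x w = i ∧ G.dist w y = i + 2} = c G (i + 1) := by
  have h1 := H.card_c z x
  rw [SimpleGraph.dist_comm (u := z), hx] at h1
  rw [← h1, ← card_union_of_disjoint]
  · congr 1
    ext w
    simp only [mem_union, mem_filter, mem_univ, true_and, SimpleGraph.dist_comm (u := w)]
    constructor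
    · rintro (h | h) <;> exact ⟨h.1, by omega⟩
    · rintro ⟨hw, h⟩
      have := H.dist_adj hw y
      rw [SimpleGraph.dist_comm (u := z), SimpleGraph.dist_comm (u := w)] at this
      have : G.dist y w = i ∨ G.dist y w = i + 2 := by omega
      rcases this with h' | h'
      · exact Or.inl ⟨hw, by omega, h'⟩
      · exact Or.inr ⟨hw, by omega, h'⟩
  · rw [disjoint_filter]
    rintro w - ⟨-, -, h⟩ ⟨-, -, h'⟩
    rw [SimpleGraph.dist_comm] at h'
    omega

/-- The coefficient of v y counts neighbours w of z at distance i from x and i+2 from y. It is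
c_{i+1}, c_{i+1} - γ_{i+1} or 0 as ∂(z,y) is i+3, i+1 or i-1. The middle value can be subtracted
throughout because the entries of v sum to zero. -/
theorem raise_upperVec {γ : ℕ → ℕ} (hγ : ∀ i, ∀ x y z : V, G.dist x y = 2 → G.dist x z = i + 1 →
      G.dist y z = i + 1 → #{w | G.Adj z w ∧ G.dist x w = i ∧ G.dist y w = i} = γ (i + 1))
    {x : V} {v : V → ℝ} (hv : v ∈ localSpace G ℝ x) {i : ℕ} (hi : 1 ≤ i) :
    levelPart G x (i + 1) (G.adjMatrix ℝ *ᵥ upperVec G x v i)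
      = (γ (i + 1) : ℝ) • upperVec G x v (i + 1)
        - ((c G (i + 1) : ℝ) - γ (i + 1)) • lowerVec G x v (i + 1) := by
  ext z
  simp only [upperVec, lowerVec, Pi.sub_apply, Pi.smul_apply, levelPart_apply, smul_eq_mul]
  by_cases hz : G.dist x z = i + 1
  · rw [if_pos hz, if_pos hz, if_pos hz, H.adjMatrix_levelPart_distMatrix,
      H.sum_mul_eq_of_mem_localSpace hv (α := γ (i + 1)) (β := -((c G (i + 1) : ℝ) - γ (i + 1)))
        (γ := (c G (i + 1) : ℝ) - γ (i + 1)) (i := i + 1 + 2) (j := i + 1 - 2) (z := z)]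
    · ring
    · intro y hy
      have t1 := H.dist_triangle z x y
      have t2 := H.dist_triangle x y z
      obtain ⟨m, h4⟩ := H.even_dist_add x z y
      rw [SimpleGraph.dist_comm (u := z) (v := x)] at t1
      rw [SimpleGraph.dist_comm (u := y)] at t2
      have : G.dist z y = i + 3 ∨ G.dist z y = i + 1 ∨ G.dist z y = i - 1 ∧ G.dist z y + 1 = i := by
        omega
      rcases this with h | h | ⟨h, h'⟩
      · rw [if_pos h, if_neg (by omega)]
        have hc := H.card_c z x
        rw [SimpleGraph.dist_comm (u := z), hz] at hc
        have e : univ.filter (fun w : V => G.Adj z w ∧ G.dist x w = i ∧ G.dist w y = i + 2)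
            = univ.filter (fun w : V => G.Adj z w ∧ G.dist w x + 1 = i + 1) := by
          ext w
          simp only [mem_filter, mem_univ, true_and]
          constructor
          · rintro ⟨h1, h2, -⟩
            exact ⟨h1, by rw [SimpleGraph.dist_comm]; omega⟩
          · rintro ⟨h1, h2⟩
            have t3 := H.dist_triangle w x y
            have t4 := H.dist_adj h1 y
            exact ⟨h1, by rw [SimpleGraph.dist_comm]; omega, by omega⟩
        rw [e, hc]
        ring
      · rw [if_neg (by omega), if_neg (by omega)]
        have hzy : G.dist y z = i + 1 := by rw [SimpleGraph.dist_comm, h]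
        have h1 := H.card_closer_split hz hzy
        rw [hγ i x y z hy hz hzy] at h1
        have h2 : (γ (i + 1) : ℝ) + #{w | G.Adj z w ∧ G.dist x w = i ∧ G.dist w y = i + 2}
            = c G (i + 1) := by exact_mod_cast h1
        linear_combination h2
      · rw [if_neg (by omega), if_pos (by omega)]
        have e : univ.filter (fun w : V => G.Adj z w ∧ G.dist x w = i ∧ G.dist w y = i + 2) = ∅ := by
          rw [filter_eq_empty_iff]
          rintro w - ⟨h1, -, h2⟩
          have := H.dist_adj h1 y
          omega
        rw [e]
        simp
  · rw [if_neg hz, if_neg hz, if_neg hz]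
    simp

/-- The analogous count, now with values 0, c_{i+2} - γ_{i+2} and b_{i+2}; for the middle value the
roles of x and y are exchanged. -/
theorem lower_lowerVec {γ : ℕ → ℕ} (hγ : ∀ i, ∀ x y z : V, G.dist x y = 2 → G.dist x z = i + 1 →
      G.dist y z = i + 1 → #{w | G.Adj z w ∧ G.dist x w = i ∧ G.dist y w = i} = γ (i + 1))
    {x : V} {v : V → ℝ} (hv : v ∈ localSpace G ℝ x) (i : ℕ) :
    levelPart G x (i + 2) (G.adjMatrix ℝ *ᵥ lowerVec G x v (i + 3))
      = ((b G (i + 2) : ℝ) - (c G (i + 2) - γ (i + 2))) • lowerVec G x v (i + 2)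
        - ((c G (i + 2) : ℝ) - γ (i + 2)) • upperVec G x v (i + 2) := by
  ext z
  simp only [upperVec, lowerVec, Pi.sub_apply, Pi.smul_apply, levelPart_apply, smul_eq_mul]
  by_cases hz : G.dist x z = i + 2
  · rw [if_pos hz, if_pos hz, if_pos hz, H.adjMatrix_levelPart_distMatrix,
      H.sum_mul_eq_of_mem_localSpace hv
        (α := (b G (i + 2) : ℝ) - (c G (i + 2) - γ (i + 2)))
        (β := -((c G (i + 2) : ℝ) - γ (i + 2)))
        (γ := (c G (i + 2) : ℝ) - γ (i + 2)) (i := i + 2 - 2) (j := i + 2 + 2) (z := z)]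
    · ring
    · intro y hy
      have t1 := H.dist_triangle z x y
      have t2 := H.dist_triangle x y z
      obtain ⟨m, h4⟩ := H.even_dist_add x z y
      rw [SimpleGraph.dist_comm (u := z) (v := x)] at t1
      rw [SimpleGraph.dist_comm (u := y)] at t2
      rw [show i + 3 - 2 = i + 1 by omega]
      have : G.dist z y = i + 4 ∨ G.dist z y = i + 2 ∨ G.dist z y = i := by
        omega
      rcases this with h | h | h
      · rw [if_neg (by omega), if_pos (by omega)]
        have e : univ.filter (fun w : V => G.Adj z w ∧ G.dist x w = i + 3 ∧ G.dist w y = i + 1) = ∅ := by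
          rw [filter_eq_empty_iff]
          rintro w - ⟨h1, -, h2⟩
          have := H.dist_adj h1 y
          omega
        rw [e]
        simp
      · rw [if_neg (by omega), if_neg (by omega)]
        have hzy : G.dist y z = i + 1 + 1 := by rw [SimpleGraph.dist_comm, h]
        have h1 := H.card_closer_split hzy hz
        rw [hγ (i + 1) y x z (by rw [SimpleGraph.dist_comm, hy]) hzy hz] at h1
        have e : univ.filter (fun w : V => G.Adj z w ∧ G.dist x w = i + 3 ∧ G.dist w y = i + 1)
            = univ.filter (fun w : V => G.Adj z w ∧ G.dist y w = i + 1 ∧ G.dist w x = i + 1 + 2) := by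
          ext w
          simp only [mem_filter, mem_univ, true_and, SimpleGraph.dist_comm (u := w)]
          tauto
        have h2 : (γ (i + 1 + 1) : ℝ)
            + #{w | G.Adj z w ∧ G.dist y w = i + 1 ∧ G.dist w x = i + 1 + 2}
            = c G (i + 1 + 1) := by exact_mod_cast h1
        rw [e]
        linear_combination h2
      · rw [if_pos (by omega), if_neg (by omega)]
        have hb := H.card_b z x
        rw [SimpleGraph.dist_comm (u := z), hz] at hb
        have e : univ.filter (fun w : V => G.Adj z w ∧ G.dist x w = i + 3 ∧ G.dist w y = i + 1)
            = univ.filter (fun w : V => G.Adj z w ∧ G.dist w x = i + 2 + 1) := by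
          ext w
          simp only [mem_filter, mem_univ, true_and]
          constructor
          · rintro ⟨h1, h2, -⟩
            exact ⟨h1, by rw [SimpleGraph.dist_comm]; omega⟩
          · rintro ⟨h1, h2⟩
            rw [SimpleGraph.dist_comm] at h2
            have t3 := H.dist_triangle x y w
            have t4 := H.dist_adj h1 y
            rw [SimpleGraph.dist_comm (u := y)] at t3
            exact ⟨h1, by omega, by omega⟩
        rw [e, hb]
        ring
  · rw [if_neg hz, if_neg hz, if_neg hz]
    simp

theorem upperVec_one {x : V} {v : V → ℝ} (hv : v ∈ localSpace G ℝ x) : upperVec G x v 1 = 0 := by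
  ext u
  rw [upperVec, levelPart_apply]
  split_ifs with hu
  · exact H.distMatrix_three_mulVec_eq_zero hv (SimpleGraph.dist_eq_one_iff_adj.mp hu)
  · rfl

/-- By `not_both_dist_diam`, a vertex at distance D from x is at distance D-2 from the whole second
subconstituent, so its entry is the total sum of v. -/
theorem lowerVec_diam (h2 : IsTwoHomogeneous G) {x : V} {v : V → ℝ} (hv : v ∈ localSpace G ℝ x) :
    lowerVec G x v G.diam = 0 := by
  have h5 := H.five_le
  ext z
  rw [lowerVec, levelPart_apply]
  split_ifs with hz
  · rw [distMatrix_mulVec_apply]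
    refine Eq.trans (sum_congr rfl fun y _ => ?_) (H.sum_eq_zero_of_mem_localSpace hv)
    by_cases hy : G.dist x y = 2
    · rw [if_pos]
      have t2 := H.dist_triangle x y z
      have l := H.dist_le z y
      obtain ⟨m, h4⟩ := H.even_dist_add x z y
      rw [SimpleGraph.dist_comm (u := y)] at t2
      by_contra hne
      refine H.not_both_dist_diam h2 hy hz ?_
      rw [SimpleGraph.dist_comm]
      omega
    · rw [apply_eq_zero_of_mem_localSpace hv hy, ite_self]
  · rfl

/-- Since γ_i > 0 for 2 ≤ i < D, `raise_upperVec` inductively makes each upper part a multiple of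
the lower part. The ladder of v is then A-invariant and lives on levels 2 to D-1, so its dimension
is at most D-2. -/
theorem fundamental_of_twoHomogeneous (h2 : IsTwoHomogeneous G) :
    fundamental G (eigenvalue G 1) (eigenvalue G (G.diam / 2)) = 0 := by
  have h5 := H.five_le
  have hγ : ∀ i, ∃ n, ∀ x y z : V, G.dist x y = 2 → G.dist x z = i → G.dist y z = i →
      #{w | G.Adj z w ∧ G.dist x w = i - 1 ∧ G.dist y w = i - 1} = n := fun i => h2 i i (i - 1) (i - 1)
  choose γ hγ using hγ
  have hγ' : ∀ i, ∀ x y z : V, G.dist x y = 2 → G.dist x z = i + 1 →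
      G.dist y z = i + 1 → #{w | G.Adj z w ∧ G.dist x w = i ∧ G.dist y w = i} = γ (i + 1) :=
    fun i x y z => hγ (i + 1) x y z
  have hpos : ∀ i, 2 ≤ i → i < G.diam → 0 < γ i := by
    intro i hi hi'
    obtain ⟨x, y, z, w, hxy, hxz, hyz, hw, hwx, hwy⟩ := H.exists_equidistant_adj hi hi'
    rw [← hγ i x y z hxy hxz hyz, card_pos]
    exact ⟨w, by simp [hw, hwx, hwy]⟩
  obtain ⟨x⟩ := H.nonempty
  refine H.fundamental_eq_zero (x := x) fun v hv => ?_
  have hspan : ∀ i, 1 ≤ i → i ≤ G.diam → ∃ κ : ℝ, upperVec G x v i = κ • lowerVec G x v i := by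
    intro i hi
    induction i, hi using Nat.le_induction with
    | base => exact fun _ => ⟨0, by rw [H.upperVec_one hv, zero_smul]⟩
    | succ i hi ih =>
      intro hle
      rcases hle.lt_or_eq with hlt | heq
      · obtain ⟨κ, hκ⟩ := ih (by omega)
        have hr := H.raise_upperVec hγ' hv hi
        have hg : (γ (i + 1) : ℝ) ≠ 0 := by exact_mod_cast (hpos (i + 1) (by omega) hlt).ne'
        obtain ⟨κ', hκ'⟩ : ∃ κ' : ℝ, levelPart G x (i + 1) (G.adjMatrix ℝ *ᵥ upperVec G x v i)
            = κ' • lowerVec G x v (i + 1) := by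
          rcases hi.lt_or_eq with h1 | h1
          · obtain ⟨j, rfl⟩ : ∃ j, i = j + 2 := ⟨i - 2, by omega⟩
            exact ⟨κ * c G (j + 1), by
              rw [hκ, mulVec_smul, map_smul, H.levelPart_adjMatrix_lowerVec hv.1, smul_smul]⟩
          · rw [← h1, H.upperVec_one hv, mulVec_zero, map_zero]
            exact ⟨0, by simp⟩
        rw [hκ'] at hr
        refine ⟨(γ (i + 1) : ℝ)⁻¹ * (κ' + (c G (i + 1) - γ (i + 1))), ?_⟩
        rw [mul_smul, add_smul, hr, sub_add_cancel, inv_smul_smul₀ hg]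
      · exact ⟨0, by rw [H.upperVec_eq_zero (by omega), zero_smul]⟩
  have hmem : ∀ i, lowerVec G x v i ∈ ladder G x v := fun i => Submodule.subset_span ⟨i, rfl⟩
  have hinv : ∀ w ∈ ladder G x v, G.adjMatrix ℝ *ᵥ w ∈ ladder G x v := by
    intro w hw
    refine H.adjMatrix_mulVec_mem_ladder hv (fun i => ?_) hw
    rcases le_or_gt (i + 2) G.diam with hi | hi
    · obtain ⟨κ, hκ⟩ := hspan (i + 2) (by omega) hi
      rw [H.lower_lowerVec hγ' hv, hκ]
      exact Submodule.sub_mem _ (Submodule.smul_mem _ _ (hmem _))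
        (Submodule.smul_mem _ _ (Submodule.smul_mem _ _ (hmem _)))
    · rw [H.levelPart_eq_zero x hi]
      exact Submodule.zero_mem _
  have hdim : Module.finrank ℝ (ladder G x v) + 2 ≤ G.diam := by
    have hle : ladder G x v
        ≤ Submodule.span ℝ ((Ico 2 G.diam).image (lowerVec G x v) : Finset (V → ℝ)) := by
      rw [ladder, Submodule.span_le]
      rintro _ ⟨i, rfl⟩
      rcases lt_or_ge i 2 with h | h
      · rw [H.lowerVec_eq_zero hv.1 h]
        exact Submodule.zero_mem _
      · rcases lt_trichotomy i G.diam with h' | h' | h'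
        · exact Submodule.subset_span (mem_coe.mpr (mem_image_of_mem _ (mem_Ico.mpr ⟨h, h'⟩)))
        · rw [h', H.lowerVec_diam h2 hv]
          exact Submodule.zero_mem _
        · rw [lowerVec, H.levelPart_eq_zero x h']
          exact Submodule.zero_mem _
    have h1 := (Submodule.finrank_mono hle).trans (finrank_span_finset_le_card _)
    have h3 := card_image_le (s := Ico 2 G.diam) (f := lowerVec G x v)
    rw [Nat.card_Ico] at h3
    omega
  have hvl : v ∈ ladder G x v := by
    have := hmem 2
    rwa [H.lowerVec_two hv.1] at this
  obtain ⟨θ, hθ, n1, n2, hΦ⟩ := H.exists_cosMatrix_mulVec_eq_zero hinv hvl hdim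
  exact H.localQuad_mul_eq_zero_of_root hθ n1 n2 hv
    (H.localQuad_eq_zero (mem_eigenvalues.mp hθ) (H.sq_lt_of_ne hθ n1 n2) hv hΦ)

end OddBipartite
end DRG

/-! ### 2-thinness of an antipodal 2-cover implies the fundamental equation. -/

namespace DRG
open Finset Matrix

variable {V : Type*} [Fintype V] [DecidableEq V] {G : SimpleGraph V} [DecidableRel G.Adj]

/-- The vectors orthogonal to all functions of the distances to `x` and to a neighbour of `x`. -/
noncomputable def edgeNull (G : SimpleGraph V) (x : V) : Submodule ℂ (V → ℂ) where
  carrier := {w | ∀ u, G.Adj x u → ∀ g : ℕ → ℕ → ℂ,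
    (fun z => g (G.dist x z) (G.dist u z)) ⬝ᵥ w = 0}
  add_mem' := fun h1 h2 u hu g => by rw [dotProduct_add, h1 u hu g, h2 u hu g, add_zero]
  zero_mem' := fun u hu g => dotProduct_zero _
  smul_mem' := fun a w h u hu g => by rw [dotProduct_smul, h u hu g, smul_zero]

/-- The orthogonal complement of a subspace for the standard Hermitian form. -/
noncomputable def perp (U : Submodule ℂ (V → ℂ)) : Submodule ℂ (V → ℂ) where
  carrier := {w | ∀ u ∈ U, star u ⬝ᵥ w = 0}
  add_mem' := fun h1 h2 u hu => by rw [dotProduct_add, h1 u hu, h2 u hu, add_zero]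
  zero_mem' := fun u hu => dotProduct_zero _
  smul_mem' := fun a w h u hu => by rw [dotProduct_smul, h u hu, smul_zero]

open scoped ComplexOrder in
theorem eq_zero_of_mem_perp {U : Submodule ℂ (V → ℂ)} {w : V → ℂ} (h1 : w ∈ U)
    (h2 : w ∈ perp U) : w = 0 :=
  dotProduct_star_self_eq_zero.mp (h2 w h1)

theorem exists_add_perp (U : Submodule ℂ (V → ℂ)) (v : V → ℂ) :
    ∃ y ∈ U, ∃ z ∈ perp U, v = y + z := by
  obtain ⟨y, hy, z, hz, e⟩ := Submodule.exists_add_mem_mem_orthogonal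
    (K := U.comap (WithLp.linearEquiv 2 ℂ (V → ℂ)).toLinearMap) (WithLp.toLp 2 v)
  refine ⟨WithLp.ofLp y, hy, WithLp.ofLp z, fun u hu => ?_, congrArg WithLp.ofLp e⟩
  have h1 := (Submodule.mem_orthogonal _ z).mp hz (WithLp.toLp 2 u) hu
  rw [EuclideanSpace.inner_eq_star_dotProduct, dotProduct_comm] at h1
  exact h1

namespace OddBipartite

variable (H : OddBipartite G)
include H

/-- The generators of T(x) are real symmetric matrices. -/
theorem isTModule_perp {x : V} {U : Submodule ℂ (V → ℂ)} (hU : IsTModule G x U) :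
    IsTModule G x (perp U) := by
  rw [H.isTModule_iff] at hU ⊢
  refine ⟨fun w hw u hu => ?_, fun i w hw u hu => ?_⟩
  · have h1 : G.adjMatrix ℂ *ᵥ star u = star (G.adjMatrix ℂ *ᵥ u) := by
      ext z
      simp [SimpleGraph.adjMatrix_mulVec_apply]
    rw [dotProduct_adjMatrix_mulVec, h1]
    exact hw _ (hU.1 u hu)
  · have h1 : levelPart G x i (star u) = star (levelPart G x i u) := by
      ext z
      simp only [levelPart_apply, Pi.star_apply]
      split_ifs <;> simp
    rw [← levelPart_dotProduct, h1]
    exact hw _ (hU.2 i u hu)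

theorem sum_neighbor_ite (P : V → Prop) [DecidablePred P] (a : ℂ) (y : V) :
    ∑ z ∈ G.neighborFinset y, (if P z then a else 0) = (#{w | G.Adj y w ∧ P w} : ℂ) * a := by
  rw [← sum_filter, sum_const, nsmul_eq_mul, SimpleGraph.neighborFinset_eq_filter, filter_filter]

/-- Neighbourhood sums of functions of the distances to the ends of an edge. -/
theorem sum_neighbor_edge {x u : V} (hu : G.Adj x u) (g : ℕ → ℕ → ℂ) {y : V}
    (hy : G.dist u y = G.dist x y + 1) :
    ∑ z ∈ G.neighborFinset y, g (G.dist x z) (G.dist u z)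
      = (c G (G.dist x y) : ℂ) * g (G.dist x y - 1) (G.dist x y)
        + b G (G.dist u y) * g (G.dist u y) (G.dist u y + 1)
        + (valency G - c G (G.dist x y) - b G (G.dist u y)) * g (G.dist u y) (G.dist x y) := by
  have hc := H.card_c y x
  have hb := H.card_b y u
  rw [SimpleGraph.dist_comm (u := y) (v := x)] at hc
  rw [SimpleGraph.dist_comm (u := y) (v := u)] at hb
  have h1 : ∑ z ∈ G.neighborFinset y, g (G.dist x z) (G.dist u z)
      = ∑ z ∈ G.neighborFinset y, (g (G.dist u y) (G.dist x y)
        + (if G.dist z x + 1 = G.dist x y then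
            g (G.dist x y - 1) (G.dist x y) - g (G.dist u y) (G.dist x y) else 0)
        + (if G.dist z u = G.dist u y + 1 then
            g (G.dist u y) (G.dist u y + 1) - g (G.dist u y) (G.dist x y) else 0)) := by
    refine sum_congr rfl fun z hz => ?_
    rw [SimpleGraph.mem_neighborFinset] at hz
    have a1 := H.dist_adj hz x
    have a2 := H.dist_adj hz u
    have a3 := H.dist_adj hu z
    rw [SimpleGraph.dist_comm (u := y), SimpleGraph.dist_comm (u := z)] at a1 a2
    rw [SimpleGraph.dist_comm (u := z) (v := x), SimpleGraph.dist_comm (u := z) (v := u)]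
    rcases a1 with a1 | a1
    · have e : G.dist x z = G.dist x y - 1 := by omega
      rw [if_pos (by omega), if_neg (by omega), e, show G.dist u z = G.dist x y by omega]
      ring
    · rw [if_neg (by omega), show G.dist x z = G.dist u y by omega]
      rcases a2 with a2 | a2
      · rw [if_neg (by omega), show G.dist u z = G.dist x y by omega]
        ring
      · rw [if_pos (by omega), a2]
        ring
  rw [h1, sum_add_distrib, sum_add_distrib, H.sum_neighbor_ite, H.sum_neighbor_ite, hc, hb,
    sum_const, H.degree_eq, nsmul_eq_mul]
  ring

/-- The test functions for an edge at x are closed under A, by `sum_neighbor_edge`, and under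
truncation to a level. The module is there to show that an irreducible module with a nonzero local
vector has nothing on levels 0 and 1. -/
theorem isTModule_edgeNull (x : V) : IsTModule G x (edgeNull G x) := by
  rw [H.isTModule_iff]
  refine ⟨fun w hw u hu g => ?_, fun i w hw u hu g => ?_⟩
  · rw [dotProduct_adjMatrix_mulVec]
    refine Eq.trans ?_ (hw u hu fun i j => if j = i + 1 then
      (c G i : ℂ) * g (i - 1) i + b G j * g j (j + 1) + (valency G - c G i - b G j) * g j i
      else (c G j : ℂ) * g j (j - 1) + b G i * g (i + 1) i + (valency G - c G j - b G i) * g j i)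
    congr 1
    ext y
    rw [SimpleGraph.adjMatrix_mulVec_apply]
    rcases H.dist_adj hu y with h | h
    · rw [if_neg (by omega)]
      exact H.sum_neighbor_edge hu.symm (fun i j => g j i) h
    · rw [if_pos h]
      exact H.sum_neighbor_edge hu g h
  · rw [← levelPart_dotProduct]
    refine Eq.trans ?_ (hw u hu fun i' j => if i' = i then g i' j else 0)
    rfl

theorem localSpace_le_edgeNull (x : V) : localSpace G ℂ x ≤ edgeNull G x := by
  intro v hv u hu g
  have h1 : (fun z => g (G.dist x z) (G.dist u z)) ⬝ᵥ v
      = g 2 1 * (distMatrix G ℂ 1 *ᵥ v) u + g 2 3 * (distMatrix G ℂ 3 *ᵥ v) u := by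
    rw [distMatrix_mulVec_apply, distMatrix_mulVec_apply, mul_sum, mul_sum, ← sum_add_distrib]
    refine sum_congr rfl fun z _ => ?_
    by_cases hz : G.dist x z = 2
    · have h2 := H.dist_adj hu z
      have : G.dist u z = 1 ∨ G.dist u z = 3 := by omega
      rcases this with h | h <;> simp [h, hz]
    · rw [apply_eq_zero_of_mem_localSpace hv hz]
      simp
  rw [h1, distMatrix_one, hv.2 u hu, H.distMatrix_three_mulVec_eq_zero hv hu]
  simp

/-- The indicators of x and of each neighbour of x are test functions. -/
theorem levelPart_eq_zero_of_mem_edgeNull {x : V} {w : V → ℂ} (hw : w ∈ edgeNull G x) {i : ℕ}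
    (hi : i < 2) : levelPart G x i w = 0 := by
  have h5 := H.five_le
  ext z
  rw [levelPart_apply]
  split_ifs with hz
  · have hi' : i = 0 ∨ i = 1 := by omega
    rcases hi' with rfl | rfl
    · obtain rfl := H.dist_eq_zero.mp hz
      obtain ⟨u, hu, -⟩ := H.exists_adj_farther (z := x) (y := x) (by simp; omega)
      have h1 := hw u hu fun i _ => if i = 0 then 1 else 0
      have h2 : (fun z => if G.dist x z = 0 then (1 : ℂ) else 0) = Pi.single x 1 := by
        ext z
        simp only [H.dist_eq_zero, Pi.single_apply, eq_comm]
      rw [h2, single_one_dotProduct] at h1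
      exact h1
    · have h1 := hw z (SimpleGraph.dist_eq_one_iff_adj.mp hz) fun _ j => if j = 0 then 1 else 0
      have h2 : (fun y => if G.dist z y = 0 then (1 : ℂ) else 0) = Pi.single z 1 := by
        ext y
        simp only [H.dist_eq_zero, Pi.single_apply, eq_comm]
      rw [h2, single_one_dotProduct] at h1
      exact h1
  · rfl

/-- In an antipodal 2-cover, a module without a component at distance zero has none at maximal
distance. -/
theorem levelPart_diam_eq_zero (hA : IsAntipodalTwoCover G) {x : V} {W : Submodule ℂ (V → ℂ)}
    (hW : IsTModule G x W) (h0 : ∀ w ∈ W, levelPart G x 0 w = 0) {w : V → ℂ} (hw : w ∈ W) :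
    levelPart G x G.diam w = 0 := by
  rw [H.isTModule_iff] at hW
  obtain ⟨x', hx', huniq⟩ := hA x
  obtain ⟨x'', -, huniq'⟩ := hA x'
  have e1 : levelPart G x G.diam w = Pi.single x' (w x') := by
    ext z
    rw [levelPart_apply, Pi.single_apply]
    by_cases hz : z = x'
    · rw [hz, if_pos hx', if_pos rfl]
    · rw [if_neg hz, if_neg fun h => hz (huniq z h)]
  -- Level D is the single antipode x' of x, and A_D carries the entry at x' back to x, where
  -- vectors of W vanish.
  have h1 := H.distMatrix_mulVec_mem hW.1 G.diam (hW.2 G.diam w hw)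
  have h2 := congrFun (h0 _ h1) x
  rw [levelPart_apply, if_pos (by simp), e1, distMatrix_mulVec_apply, sum_eq_single x'
    (fun z _ hz => by rw [Pi.single_eq_of_ne hz, ite_self]) (fun h => absurd (mem_univ _) h),
    if_pos hx', Pi.single_eq_same] at h2
  rw [e1, h2]
  simp

theorem finrank_le_of_thin {x : V} {W : Submodule ℂ (V → ℂ)} (hthin : IsThin G x W)
    (h0 : ∀ w ∈ W, ∀ i < 2, levelPart G x i w = 0)
    (hD : ∀ w ∈ W, levelPart G x G.diam w = 0) : Module.finrank ℂ W + 2 ≤ G.diam := by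
  have h5 := H.five_le
  have hgen : ∀ i, ∃ g : V → ℂ, i ≤ G.diam → ∀ w ∈ W, ∃ a : ℂ, levelPart G x i w = a • g := by
    intro i
    by_cases hi : i ≤ G.diam
    · obtain ⟨g, hg⟩ := finrank_le_one_iff.mp (hthin i hi)
      refine ⟨g, fun _ w hw => ?_⟩
      have hmem : levelPart G x i w ∈ component G x W i := by
        rw [component_eq_map]
        exact ⟨w, hw, rfl⟩
      obtain ⟨a, ha⟩ := hg ⟨_, hmem⟩
      exact ⟨a, (congrArg Subtype.val ha).symm⟩
    · exact ⟨0, fun h => absurd h hi⟩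
  choose g hg using hgen
  have hle : W ≤ Submodule.span ℂ ((Ico 2 G.diam).image g : Finset (V → ℂ)) := by
    intro w hw
    rw [← H.sum_levelPart x w]
    refine Submodule.sum_mem _ fun i hi => ?_
    rw [mem_range] at hi
    rcases lt_or_ge i 2 with h | h
    · rw [h0 w hw i h]
      exact Submodule.zero_mem _
    · rcases (Nat.lt_succ_iff.mp hi).lt_or_eq with h' | h'
      · obtain ⟨a, ha⟩ := hg i (by omega) w hw
        rw [ha]
        exact Submodule.smul_mem _ _
          (Submodule.subset_span (mem_coe.mpr (mem_image_of_mem _ (mem_Ico.mpr ⟨h, h'⟩))))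
      · rw [h', hD w hw]
        exact Submodule.zero_mem _
  have h1 := (Submodule.finrank_mono hle).trans (finrank_span_finset_le_card _)
  have h3 := card_image_le (s := Ico 2 G.diam) (f := g)
  rw [Nat.card_Ico] at h3
  omega

theorem endpoint_eq_two {x : V} {W : Submodule ℂ (V → ℂ)}
    (h0 : ∀ w ∈ W, ∀ i < 2, levelPart G x i w = 0) {v : V → ℂ} (hv : v ∈ W) (hv0 : v ≠ 0)
    (hv2 : levelPart G x 2 v = v) : endpoint G x W = 2 := by
  have h5 := H.five_le
  have hmem : 2 ∈ {i | i ≤ G.diam ∧ component G x W i ≠ ⊥} := by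
    refine ⟨by omega, fun h => hv0 ?_⟩
    rw [component_eq_map, Submodule.eq_bot_iff] at h
    rw [← hv2]
    exact h _ ⟨v, hv, rfl⟩
  refine le_antisymm (Nat.sInf_le hmem) ?_
  by_contra hlt
  have h1 := Nat.sInf_mem ⟨2, hmem⟩
  refine h1.2 ?_
  rw [component_eq_map, Submodule.eq_bot_iff]
  rintro _ ⟨w, hw, rfl⟩
  exact h0 w hw _ (not_le.mp hlt)

/-- Irreducibility puts W inside `edgeNull`, so W has endpoint 2 and is thin. Antipodality removes
level D, leaving dimension at most D-2, and a nontrivial eigenvalue is missing from v. -/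
theorem localQuad_mul_eq_zero_of_isIrreducible (hA : IsAntipodalTwoCover G) {x : V}
    (hx : IsTwoThin G x) {W : Submodule ℂ (V → ℂ)} (hW : IsIrreducibleTModule G x W) {v : V → ℂ}
    (hvW : v ∈ W) (hv : v ∈ localSpace G ℂ x) :
    localQuad G ℂ x (eigenvalue G 1) (localQuad G ℂ x (eigenvalue G (G.diam / 2)) v) = 0 := by
  by_cases hv0 : v = 0
  · rw [hv0, map_zero, map_zero]
  have hle : W ≤ edgeNull G x := by
    have hT : IsTModule G x (W ⊓ edgeNull G x) :=
      fun B hB w hw => ⟨hW.1 B hB w hw.1, H.isTModule_edgeNull x B hB w hw.2⟩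
    rcases hW.2.2 _ hT inf_le_left with h | h
    · exact absurd ((Submodule.eq_bot_iff _).mp h v ⟨hvW, H.localSpace_le_edgeNull x hv⟩) hv0
    · exact inf_eq_left.mp h
  have h0 : ∀ w ∈ W, ∀ i < 2, levelPart G x i w = 0 :=
    fun w hw i hi => H.levelPart_eq_zero_of_mem_edgeNull (hle hw) hi
  have hthin := hx W hW (H.endpoint_eq_two h0 hvW hv0 hv.1)
  have hdim := H.finrank_le_of_thin hthin h0
    fun w hw => H.levelPart_diam_eq_zero hA hW.1 (fun w hw => h0 w hw 0 (by norm_num)) hw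
  obtain ⟨θ, hθ, n1, n2, hΦ⟩ :=
    H.exists_cosMatrix_mulVec_eq_zero (H.isTModule_iff.mp hW.1).1 hvW hdim
  have hQ := H.localQuad_eq_zero (mem_eigenvalues.mp hθ) (H.sq_lt_of_ne hθ n1 n2) hv hΦ
  refine eq_zero_of_map fun f => ?_
  have h1 : f ∘ (0 : V → ℂ) = 0 := by ext; simp
  rw [map_localQuad, map_localQuad]
  exact H.localQuad_mul_eq_zero_of_root hθ n1 n2 (map_mem_localSpace f hv)
    (by rw [← map_localQuad, hQ, h1])

/-- Induction on the dimension: a reducible W splits into a submodule U and its orthogonal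
complement. The two components of a local vector are local, since locality is the vanishing of
operators that preserve both summands. -/
theorem localQuad_mul_eq_zero_of_thin (hA : IsAntipodalTwoCover G) {x : V} (hx : IsTwoThin G x)
    (n : ℕ) : ∀ W : Submodule ℂ (V → ℂ), IsTModule G x W → Module.finrank ℂ W = n →
      ∀ v ∈ W, v ∈ localSpace G ℂ x →
        localQuad G ℂ x (eigenvalue G 1) (localQuad G ℂ x (eigenvalue G (G.diam / 2)) v) = 0 := by
  induction n using Nat.strong_induction_on with
  | _ n ih =>
    intro W hW hn v hvW hv
    by_cases hirr : IsIrreducibleTModule G x W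
    · exact H.localQuad_mul_eq_zero_of_isIrreducible hA hx hirr hvW hv
    by_cases hbot : W = ⊥
    · rw [hbot, Submodule.mem_bot] at hvW
      rw [hvW, map_zero, map_zero]
    obtain ⟨U, hU, hUW, hU0, hU1⟩ : ∃ U, IsTModule G x U ∧ U ≤ W ∧ U ≠ ⊥ ∧ U ≠ W := by
      by_contra hcon
      push Not at hcon
      exact hirr ⟨hW, hbot, fun U hU hle => or_iff_not_imp_left.mpr (hcon U hU hle)⟩
    have hP : IsTModule G x (W ⊓ perp U) :=
      fun B hB w hw => ⟨hW B hB w hw.1, H.isTModule_perp hU B hB w hw.2⟩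
    have hPW : W ⊓ perp U ≠ W := by
      intro h
      refine hU0 ((Submodule.eq_bot_iff _).mpr fun u hu => ?_)
      exact eq_zero_of_mem_perp hu (inf_eq_left.mp h (hUW hu))
    obtain ⟨y, hy, z, hz, rfl⟩ := exists_add_perp U v
    have hzW : z ∈ W := by
      have := W.sub_mem hvW (hUW hy)
      rwa [add_sub_cancel_left] at this
    have hsplit : ∀ f : (V → ℂ) →ₗ[ℂ] (V → ℂ), (∀ w ∈ U, f w ∈ U) → (∀ w ∈ perp U, f w ∈ perp U) →
        f (y + z) = 0 → f y = 0 ∧ f z = 0 := by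
      intro f h1 h2 h3
      rw [map_add] at h3
      have h4 : f y = 0 := by
        refine eq_zero_of_mem_perp (h1 y hy) ?_
        rw [eq_neg_of_add_eq_zero_left h3]
        exact (perp U).neg_mem (h2 z hz)
      rw [h4, zero_add] at h3
      exact ⟨h4, h3⟩
    have hU' := H.isTModule_iff.mp hU
    have hP' := H.isTModule_iff.mp (H.isTModule_perp hU)
    have s1 := hsplit (levelPart G x 2 - LinearMap.id)
      (fun w hw => U.sub_mem (hU'.2 2 w hw) hw) (fun w hw => (perp U).sub_mem (hP'.2 2 w hw) hw)
      (by rw [LinearMap.sub_apply, hv.1, LinearMap.id_apply, sub_self])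
    have s2 := hsplit (levelPart G x 1 ∘ₗ (G.adjMatrix ℂ).mulVecLin)
      (fun w hw => hU'.2 1 _ (hU'.1 w hw)) (fun w hw => hP'.2 1 _ (hP'.1 w hw)) (by
        ext u
        rw [LinearMap.comp_apply, levelPart_apply, mulVecLin_apply]
        split_ifs with hu
        · exact hv.2 u (SimpleGraph.dist_eq_one_iff_adj.mp hu)
        · rfl)
    have hloc : ∀ w : V → ℂ, (levelPart G x 2 - LinearMap.id : (V → ℂ) →ₗ[ℂ] (V → ℂ)) w = 0 →
        (levelPart G x 1 ∘ₗ (G.adjMatrix ℂ).mulVecLin) w = 0 → w ∈ localSpace G ℂ x := by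
      intro w h1 h2
      refine ⟨sub_eq_zero.mp h1, fun u hu => ?_⟩
      have := congrFun h2 u
      rwa [LinearMap.comp_apply, levelPart_apply, mulVecLin_apply,
        if_pos (SimpleGraph.dist_eq_one_iff_adj.mpr hu)] at this
    have l1 : Module.finrank ℂ U < n := hn ▸ Submodule.finrank_lt_finrank_of_lt (lt_of_le_of_ne hUW hU1)
    have l2 : Module.finrank ℂ (W ⊓ perp U : Submodule ℂ (V → ℂ)) < n :=
      hn ▸ Submodule.finrank_lt_finrank_of_lt (lt_of_le_of_ne inf_le_left hPW)
    rw [map_add, map_add, ih _ l1 U hU rfl y hy (hloc y s1.1 s2.1),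
      ih _ l2 _ hP rfl z ⟨hzW, hz⟩ (hloc z s1.2 s2.2), add_zero]

theorem fundamental_of_twoThin (hA : IsAntipodalTwoCover G) {x : V} (hx : IsTwoThin G x) :
    fundamental G (eigenvalue G 1) (eigenvalue G (G.diam / 2)) = 0 := by
  refine H.fundamental_eq_zero (x := x) fun v hv => ?_
  set v' : V → ℂ := fun z => (v z : ℂ) with hv'
  have hre : Complex.reLm ∘ v' = v := by ext z; simp [hv']
  have him : Complex.imLm ∘ v' = 0 := by ext z; simp [hv']
  have hloc : v' ∈ localSpace G ℂ x := by
    constructor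
    · ext z
      rw [levelPart_apply, hv']
      by_cases hz : G.dist x z = 2
      · rw [if_pos hz]
      · simp only [if_neg hz, apply_eq_zero_of_mem_localSpace hv hz, Complex.ofReal_zero]
    · intro u hu
      have h1 := hv.2 u hu
      rw [SimpleGraph.adjMatrix_mulVec_apply] at h1 ⊢
      rw [hv', ← Complex.ofReal_sum, h1, Complex.ofReal_zero]
  have h1 := H.localQuad_mul_eq_zero_of_thin hA hx _ ⊤ (fun _ _ _ _ => trivial) rfl v' trivial hloc
  have h2 := congrArg (fun w => Complex.reLm ∘ w) h1
  simp only [map_localQuad, hre] at h2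
  rw [h2]
  ext z
  simp

end OddBipartite
end DRG

/-! ### The fundamental equation with Δ = 0 implies 2-homogeneity. -/

namespace DRG
open Finset Matrix

variable {V : Type*} [Fintype V] [DecidableEq V] {G : SimpleGraph V} [DecidableRel G.Adj]

/-- The number of common neighbours of `x` and `y` closer to `z` than a vertex at distance `i`. -/
noncomputable def closerCount (G : SimpleGraph V) [DecidableRel G.Adj] (i : ℕ) (x y z : V) : ℕ :=
  #{u | G.Adj x u ∧ G.Adj y u ∧ G.dist u z + 1 = i}

/-- The number of neighbours of `z` closer than `i` to both `x` and `y`. -/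
noncomputable def jointCount (G : SimpleGraph V) [DecidableRel G.Adj] (i : ℕ) (x y z : V) : ℕ :=
  #{w | G.Adj z w ∧ G.dist w x + 1 = i ∧ G.dist w y + 1 = i}

namespace OddBipartite

variable (H : OddBipartite G)
include H

theorem card_common {x y : V} (hxy : G.dist x y = 2) : #{u | G.Adj x u ∧ G.Adj y u} = c G 2 := by
  have h1 := H.card_c x y
  rw [hxy] at h1
  rw [← h1]
  congr 1
  ext u
  simp only [mem_filter, mem_univ, true_and, and_congr_right_iff]
  intro _
  rw [SimpleGraph.adj_comm, ← SimpleGraph.dist_eq_one_iff_adj]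
  omega

/-- A linear relation for `closerCount` when the local space is killed by a cosine matrix. -/
theorem closerCount_relation {θ : ℝ}
    (hΦ : ∀ x, ∀ v ∈ localSpace G ℝ x, cosMatrix G ℝ θ *ᵥ v = 0) {i : ℕ} {x y z : V}
    (hxy : G.dist x y = 2) (hxz : G.dist x z = i + 2) :
    b G 2 * ((cosine G θ i - cosine G θ (i + 2)) * (if G.dist y z = i then 1 else 0)
        - (cosine G θ (i + 2) - cosine G θ (i + 4)) * (if G.dist y z = i + 4 then 1 else 0))
      = closerCount G (i + 2) x y z *
          ((cosine G θ i - cosine G θ (i + 2)) * c G (i + 1)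
            + (cosine G θ (i + 2) - cosine G θ (i + 4)) * b G (i + 3))
        + (c G 2 * (-((cosine G θ (i + 2) - cosine G θ (i + 4)) * b G (i + 3)))
          - (c G 2 - 1) / b G 1 *
            (valency G * (-((cosine G θ (i + 2) - cosine G θ (i + 4)) * b G (i + 3)))
            + c G (i + 2) * ((cosine G θ i - cosine G θ (i + 2)) * c G (i + 1)
            + (cosine G θ (i + 2) - cosine G θ (i + 4)) * b G (i + 3)))) := by
  have h5 := H.five_le
  set p := cosine G θ i - cosine G θ (i + 2) with hp
  set q := cosine G θ (i + 2) - cosine G θ (i + 4) with hq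
  set f : ℕ → ℝ := fun d => p * (if d = i then 1 else 0) - q * (if d = i + 4 then 1 else 0) with hf
  -- Pairing with h expresses the proportionality of the lower and upper parts at z, so h is
  -- orthogonal to the local space. Pairing it with `projVec G x y` then gives the relation, because
  -- the correction term of that vector involves the common neighbours of x and y.
  set h : V → ℝ := levelPart G x 2 fun t => f (G.dist t z) with hh
  have hl : levelPart G x 2 h = h := by rw [hh, levelPart_levelPart, if_pos rfl]
  have horth : ∀ v ∈ localSpace G ℝ x, v ⬝ᵥ h = 0 := by
    intro v hv
    have h1 := congrFun (H.smul_lowerVec_eq hv (hΦ x v hv) i) z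
    simp only [lowerVec, upperVec, Pi.smul_apply, levelPart_apply, if_pos hxz, smul_eq_mul,
      Nat.add_sub_cancel, RCLike.ofReal_real_eq_id, id, distMatrix_mulVec_apply] at h1
    rw [hh, ← levelPart_dotProduct, hv.1, dotProduct]
    rw [← hp, ← hq, ← sub_eq_zero, mul_sum, mul_sum, ← sum_sub_distrib] at h1
    rw [← h1]
    refine sum_congr rfl fun t _ => ?_
    rw [hf, SimpleGraph.dist_comm (u := t)]
    simp only [show i + 2 + 2 = i + 4 by ring]
    split_ifs <;> ring
  have h1 := horth _ (H.projVec_mem hxy)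
  rw [projVec, sub_dotProduct, levelPart_dotProduct, hl, dotProduct_comm (G.adjMatrix ℝ *ᵥ _),
    dotProduct_adjMatrix_mulVec, single_one_dotProduct] at h1
  have hhy : h y = f (G.dist y z) := by rw [hh, levelPart_apply, if_pos hxy]
  rw [hhy] at h1
  have hA : ∀ u, G.Adj x u → (G.adjMatrix ℝ *ᵥ h) u
      = -(q * b G (i + 3)) + if G.dist u z + 1 = i + 2 then p * c G (i + 1) + q * b G (i + 3) else 0 := by
    intro u hu
    have h2 : (G.adjMatrix ℝ *ᵥ h) u = ∑ t ∈ G.neighborFinset u, f (G.dist t z) := by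
      rw [SimpleGraph.adjMatrix_mulVec_apply]
      refine sum_congr rfl fun t ht => ?_
      rw [SimpleGraph.mem_neighborFinset] at ht
      rw [hh, levelPart_apply]
      split_ifs with hxt
      · rfl
      · have h3 : x = t := by
          by_contra hne
          exact hxt (H.dist_eq_two hu.symm ht hne)
        rw [← h3, hxz, hf]
        simp
    rw [h2, H.sum_neighbor]
    have h3 := H.dist_adj hu z
    have h4 : G.dist u z = i + 1 ∨ G.dist u z = i + 3 := by omega
    rcases h4 with h4 | h4
    · rw [if_pos (by omega), h4, hf]
      simp only [Nat.add_sub_cancel, show ¬(i = i + 4) by omega, show ¬(i + 1 + 1 = i) by omega,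
        show ¬(i + 1 + 1 = i + 4) by omega, if_true, if_false]
      ring
    · rw [if_neg (by omega), h4, hf]
      simp only [show i + 3 - 1 = i + 2 by omega, show i + 3 + 1 = i + 4 by omega,
        show ¬(i + 4 = i) by omega, show ¬(i + 2 = i) by omega,
        show ¬(i + 2 = i + 4) by omega, if_true, if_false]
      ring
  have hsum : (G.adjMatrix ℝ *ᵥ h) ⬝ᵥ projCoeff G x y
      = ((c G 2 * -(q * b G (i + 3)) + closerCount G (i + 2) x y z *
          (p * c G (i + 1) + q * b G (i + 3)))
        - (c G 2 - 1) / b G 1 * (valency G * -(q * b G (i + 3))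
          + c G (i + 2) * (p * c G (i + 1) + q * b G (i + 3)))) / b G 2 := by
    have hc := H.card_c x z
    rw [hxz] at hc
    rw [← H.card_common hxy, closerCount, ← H.degree_eq x, ← hc, H.card_common hxy,
      SimpleGraph.neighborFinset_eq_filter, dotProduct]
    generalize ht : ((c G 2 : ℝ) - 1) / b G 1 = r
    rw [← H.card_common hxy]
    generalize p * c G (i + 1) + q * b G (i + 3) = s at *
    generalize -(q * b G (i + 3)) = s' at *
    simp only [card_filter]
    push_cast
    rw [sum_mul, sum_mul, sum_mul, sum_mul, ← sum_add_distrib, ← sum_add_distrib, mul_sum,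
      ← sum_sub_distrib, sum_div]
    refine sum_congr rfl fun u _ => ?_
    rw [projCoeff, ht]
    by_cases hu : G.Adj x u
    · rw [hA u hu]
      by_cases h3 : G.Adj y u <;> by_cases h4 : G.dist u z = i + 1 <;>
        simp only [show G.dist u z + 1 = i + 2 ↔ G.dist u z = i + 1 by omega, hu, h3, h4, true_and, false_and, if_true, if_false] <;> ring
    · simp [hu]
  have hb2 := (H.cast_b_pos (i := 2) (by omega)).ne'
  rw [hsum, sub_eq_zero, eq_div_iff hb2] at h1
  linear_combination h1

/-- At level i+2, when z is equidistant from x and y, both indicators in `closerCount_relation`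
vanish and the count times a number s is a constant depending only on i. If s were 0, a vertex y₀
two steps from x towards z would contradict the same relation. -/
theorem closerCount_eq {θ : ℝ} (hθ : θ = eigenvalue G 1 ∨ θ = eigenvalue G (G.diam / 2))
    (hΦ : ∀ x, ∀ v ∈ localSpace G ℝ x, cosMatrix G ℝ θ *ᵥ v = 0) {i : ℕ} {x y z x' y' z' : V}
    (hxy : G.dist x y = 2) (hxz : G.dist x z = i) (hyz : G.dist y z = i)
    (hxy' : G.dist x' y' = 2) (hxz' : G.dist x' z' = i) (hyz' : G.dist y' z' = i) :
    closerCount G i x y z = closerCount G i x' y' z' := by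
  have h5 := H.five_le
  match i with
  | 0 =>
    rw [H.dist_eq_zero] at hxz hyz
    subst hxz hyz
    simp at hxy
  | 1 =>
    have key : ∀ {x y z : V}, G.dist x z = 1 → G.dist y z = 1 → closerCount G 1 x y z = 1 := by
      intro x y z hx hy
      rw [closerCount, card_eq_one]
      refine ⟨z, ?_⟩
      ext u
      simp only [mem_filter, mem_univ, true_and, mem_singleton]
      rw [SimpleGraph.dist_eq_one_iff_adj] at hx hy
      constructor
      · rintro ⟨-, -, h⟩
        exact H.dist_eq_zero.mp (by omega)
      · rintro rfl
        exact ⟨hx, hy, by simp⟩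
    rw [key hxz hyz, key hxz' hyz']
  | i + 2 =>
    have r1 := H.closerCount_relation hΦ hxy hxz
    have r2 := H.closerCount_relation hΦ hxy' hxz'
    obtain ⟨y₀, hy₀, hy₀z⟩ := H.exists_dist_sub x z (i := 2) (by omega)
    have r3 := H.closerCount_relation hΦ hy₀ hxz
    have hle := H.dist_le x z
    have hne := sub_ne_zero.mpr (H.cosine_ne_cosine hθ (i := i) (by omega))
    have hb2 := (H.cast_b_pos (i := 2) (by omega)).ne'
    rw [if_neg (by omega), if_neg (by omega)] at r1 r2
    rw [if_pos (by omega), if_neg (by omega)] at r3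
    generalize (cosine G θ i - cosine G θ (i + 2)) * c G (i + 1)
      + (cosine G θ (i + 2) - cosine G θ (i + 4)) * b G (i + 3) = s at *
    have hs : s ≠ 0 := by
      rintro rfl
      have : (b G 2 : ℝ) * (cosine G θ i - cosine G θ (i + 2)) = 0 := by
        linear_combination r3 - r1
      exact (mul_ne_zero hb2 hne) this
    have h1 : (closerCount G (i + 2) x y z : ℝ) * s = closerCount G (i + 2) x' y' z' * s := by
      linear_combination r2 - r1
    exact_mod_cast mul_right_cancel₀ hs h1

/-- Double counting of pairs (u, w): u a common neighbour of x and y at distance i from z, and w a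
neighbour of z one step towards u. Such a w is automatically closer to both x and y. -/
theorem closerCount_double {i : ℕ} {x y z : V}
    (hxz : G.dist x z = i + 1) (hyz : G.dist y z = i + 1) :
    closerCount G (i + 1) x y z * c G i
      = ∑ w with G.Adj z w ∧ G.dist w x + 1 = i + 1 ∧ G.dist w y + 1 = i + 1,
        closerCount G i x y w := by
  have h1 := sum_card_bipartiteAbove_eq_sum_card_bipartiteBelow (fun u w : V => G.dist u w + 1 = i)
    (s := univ.filter fun u => G.Adj x u ∧ G.Adj y u ∧ G.dist u z + 1 = i + 1)
    (t := univ.filter fun w => G.Adj z w ∧ G.dist w x + 1 = i + 1 ∧ G.dist w y + 1 = i + 1)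
  have h2 : closerCount G (i + 1) x y z * c G i
      = ∑ u with G.Adj x u ∧ G.Adj y u ∧ G.dist u z + 1 = i + 1, c G i := by
    rw [sum_const, smul_eq_mul, closerCount]
  rw [h2]
  refine Eq.trans (sum_congr rfl fun u hu => ?_) (h1.trans (sum_congr rfl fun w hw => ?_))
  · rw [mem_filter] at hu
    obtain ⟨-, hxu, hyu, hu⟩ := hu
    have hc := H.card_c z u
    rw [SimpleGraph.dist_comm (u := z), show G.dist u z = i by omega] at hc
    rw [← hc, bipartiteAbove, filter_filter]
    congr 1
    ext w
    simp only [mem_filter, mem_univ, true_and]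
    rw [SimpleGraph.dist_comm (u := u)]
    constructor
    · rintro ⟨h, h'⟩
      have a1 := H.dist_adj hxu w
      have a2 := H.dist_adj hyu w
      have a3 := H.dist_adj h x
      have a4 := H.dist_adj h y
      rw [SimpleGraph.dist_comm (u := x), SimpleGraph.dist_comm (u := u)] at a1
      rw [SimpleGraph.dist_comm (u := y), SimpleGraph.dist_comm (u := u)] at a2
      rw [SimpleGraph.dist_comm (u := z)] at a3 a4
      exact ⟨⟨h, by omega, by omega⟩, h'⟩
    · rintro ⟨⟨h, -, -⟩, h'⟩
      exact ⟨h, h'⟩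
  · rw [mem_filter] at hw
    obtain ⟨-, hzw, hwx, hwy⟩ := hw
    rw [bipartiteBelow, filter_filter, closerCount]
    congr 1
    ext u
    simp only [mem_filter, mem_univ, true_and]
    constructor
    · rintro ⟨⟨h, h', -⟩, h''⟩
      exact ⟨h, h', h''⟩
    · rintro ⟨h, h', h''⟩
      have a1 := H.dist_adj h z
      have a2 := H.dist_adj hzw u
      rw [SimpleGraph.dist_comm (u := z), SimpleGraph.dist_comm (u := w)] at a2
      exact ⟨⟨h, h', by omega⟩, h''⟩

/-- Downward induction. At level D-1 every common neighbour of x and y is at distance D-2 or D from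
z, and only the antipode of z is at distance D, while c_2 ≥ 2. A zero at level i would pass to level
i+1 by `closerCount_double`. -/
theorem closerCount_pos (hA : IsAntipodalTwoCover G) (hc2 : 2 ≤ c G 2)
    (hconst : ∀ i, ∀ x y z x' y' z' : V, G.dist x y = 2 → G.dist x z = i → G.dist y z = i →
      G.dist x' y' = 2 → G.dist x' z' = i → G.dist y' z' = i →
        closerCount G i x y z = closerCount G i x' y' z') (j : ℕ) (hj : j + 2 ≤ G.diam) :
    ∀ x y z : V, G.dist x y = 2 → G.dist x z = G.diam - 1 - j → G.dist y z = G.diam - 1 - j →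
      0 < closerCount G (G.diam - 1 - j) x y z := by
  have h5 := H.five_le
  induction j with
  | zero =>
    intro x y z hxy hx hy
    obtain ⟨z', hz', huniq⟩ := hA z
    have h1 := H.card_common hxy
    have hsub : (univ.filter fun u => G.Adj x u ∧ G.Adj y u)
        ⊆ insert z' (univ.filter fun u => G.Adj x u ∧ G.Adj y u ∧ G.dist u z + 1 = G.diam - 1 - 0) := by
      intro u hu
      rw [mem_filter] at hu
      have a1 := H.dist_adj hu.2.1 z
      rw [mem_insert, mem_filter]
      by_cases h : G.dist u z + 1 = G.diam - 1 - 0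
      · exact Or.inr ⟨mem_univ _, hu.2.1, hu.2.2, h⟩
      · exact Or.inl (huniq u (by change G.dist z u = _; rw [SimpleGraph.dist_comm]; omega))
    have h2 := (card_le_card hsub).trans (card_insert_le _ _)
    rw [closerCount]
    omega
  | succ j ih =>
    intro x y z hxy hx hy
    by_contra h0
    rw [not_lt, Nat.le_zero] at h0
    obtain ⟨x', y', z', hxy', hx', hy'⟩ := H.exists_triple (i := G.diam - 1 - j) (by omega) (by omega)
    have h1 := ih (by omega) x' y' z' hxy' hx' hy'
    obtain ⟨i, hi⟩ : ∃ i, G.diam - 1 - j = i + 1 := ⟨G.diam - 1 - j - 1, by omega⟩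
    have hi' : G.diam - 1 - (j + 1) = i := by omega
    rw [hi] at hx' hy' h1
    rw [hi'] at hx hy h0
    have h2 := H.closerCount_double hx' hy'
    rw [sum_eq_zero] at h2
    · have h3 := H.c_pos (i := i) (by omega) (by omega)
      exact (Nat.mul_pos h1 h3).ne' h2
    · intro w hw
      rw [mem_filter] at hw
      rw [← h0]
      refine hconst i x' y' w x y z hxy' ?_ ?_ hxy hx hy
      · rw [SimpleGraph.dist_comm]; omega
      · rw [SimpleGraph.dist_comm]; omega

/-- As `closerCount` is constant on each level, `closerCount_double` reads closerCount_{i+2} c_{i+1}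
= jointCount_{i+2} closerCount_{i+1}, and the last factor is positive. -/
theorem jointCount_eq (hA : IsAntipodalTwoCover G) (hc2 : 2 ≤ c G 2)
    (hconst : ∀ i, ∀ x y z x' y' z' : V, G.dist x y = 2 → G.dist x z = i → G.dist y z = i →
      G.dist x' y' = 2 → G.dist x' z' = i → G.dist y' z' = i →
        closerCount G i x y z = closerCount G i x' y' z') {i : ℕ} {x y z x' y' z' : V}
    (hxy : G.dist x y = 2) (hxz : G.dist x z = i) (hyz : G.dist y z = i)
    (hxy' : G.dist x' y' = 2) (hxz' : G.dist x' z' = i) (hyz' : G.dist y' z' = i) :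
    jointCount G i x y z = jointCount G i x' y' z' := by
  have h5 := H.five_le
  match i with
  | 0 => simp [jointCount]
  | 1 =>
    have key : ∀ {x y z : V}, G.dist x y = 2 → jointCount G 1 x y z = 0 := by
      intro x y z hxy
      rw [jointCount, card_eq_zero, filter_eq_empty_iff]
      rintro w - ⟨-, h1, h2⟩
      obtain rfl := H.dist_eq_zero.mp (show G.dist w x = 0 by omega)
      omega
    rw [key hxy, key hxy']
  | i + 2 =>
    have hle := H.dist_le x z
    have key : ∀ {x y z : V}, G.dist x y = 2 → G.dist x z = i + 2 → G.dist y z = i + 2 →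
        ∀ x₀ y₀ z₀ : V, G.dist x₀ y₀ = 2 → G.dist x₀ z₀ = i + 1 → G.dist y₀ z₀ = i + 1 →
        closerCount G (i + 2) x y z * c G (i + 1)
          = jointCount G (i + 2) x y z * closerCount G (i + 1) x₀ y₀ z₀ := by
      intro x y z hxy hxz hyz x₀ y₀ z₀ hxy₀ hxz₀ hyz₀
      rw [H.closerCount_double hxz hyz, jointCount, ← smul_eq_mul, ← sum_const]
      refine sum_congr rfl fun w hw => ?_
      rw [mem_filter] at hw
      refine hconst (i + 1) x y w x₀ y₀ z₀ hxy ?_ ?_ hxy₀ hxz₀ hyz₀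
      · rw [SimpleGraph.dist_comm]; omega
      · rw [SimpleGraph.dist_comm]; omega
    obtain ⟨x₀, y₀, z₀, hxy₀, hx₀, hy₀⟩ := H.exists_triple (i := i + 1) (by omega) (by omega)
    have hpos := H.closerCount_pos hA hc2 hconst (G.diam - 1 - (i + 1)) (by omega) x₀ y₀ z₀ hxy₀
    rw [show G.diam - 1 - (G.diam - 1 - (i + 1)) = i + 1 by omega] at hpos
    have k1 := key hxy hxz hyz x₀ y₀ z₀ hxy₀ hx₀ hy₀
    have k2 := key hxy' hxz' hyz' x₀ y₀ z₀ hxy₀ hx₀ hy₀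
    rw [hconst (i + 2) x y z x' y' z' hxy hxz hyz hxy' hxz' hyz', k2] at k1
    exact (Nat.eq_of_mul_eq_mul_right (hpos hx₀ hy₀) k1).symm

/-- Neighbourhood sums at a vertex equidistant from two vertices at distance two. -/
theorem sum_neighbor_equidistant (g : ℕ → ℕ → ℂ) {i : ℕ} {x y z : V} (hxz : G.dist x z = i)
    (hyz : G.dist y z = i) :
    ∑ w ∈ G.neighborFinset z, g (G.dist x w) (G.dist y w)
      = valency G * g (i + 1) (i + 1) + c G i * (g (i - 1) (i + 1) - g (i + 1) (i + 1))
        + c G i * (g (i + 1) (i - 1) - g (i + 1) (i + 1))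
        + jointCount G i x y z * (g (i - 1) (i - 1) - g (i - 1) (i + 1) - g (i + 1) (i - 1)
          + g (i + 1) (i + 1)) := by
  have hcx := H.card_c z x
  have hcy := H.card_c z y
  rw [SimpleGraph.dist_comm (u := z), hxz] at hcx
  rw [SimpleGraph.dist_comm (u := z), hyz] at hcy
  have h1 : ∑ w ∈ G.neighborFinset z, g (G.dist x w) (G.dist y w)
      = ∑ w ∈ G.neighborFinset z, (g (i + 1) (i + 1)
        + (if G.dist w x + 1 = i then g (i - 1) (i + 1) - g (i + 1) (i + 1) else 0)
        + (if G.dist w y + 1 = i then g (i + 1) (i - 1) - g (i + 1) (i + 1) else 0)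
        + (if G.dist w x + 1 = i ∧ G.dist w y + 1 = i then
          g (i - 1) (i - 1) - g (i - 1) (i + 1) - g (i + 1) (i - 1) + g (i + 1) (i + 1) else 0)) := by
    refine sum_congr rfl fun w hw => ?_
    rw [SimpleGraph.mem_neighborFinset] at hw
    have a1 := H.dist_adj hw x
    have a2 := H.dist_adj hw y
    rw [SimpleGraph.dist_comm (u := z), hxz] at a1
    rw [SimpleGraph.dist_comm (u := z), hyz] at a2
    rw [SimpleGraph.dist_comm (u := x), SimpleGraph.dist_comm (u := y)]
    rcases a1 with a1 | a1 <;> rcases a2 with a2 | a2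
    · rw [if_pos a1.symm, if_pos a2.symm, if_pos ⟨a1.symm, a2.symm⟩,
        show G.dist w x = i - 1 by omega, show G.dist w y = i - 1 by omega]
      ring
    · rw [if_pos a1.symm, if_neg (by omega), if_neg (by omega),
        show G.dist w x = i - 1 by omega, a2]
      ring
    · rw [if_neg (by omega), if_pos a2.symm, if_neg (by omega),
        show G.dist w y = i - 1 by omega, a1]
      ring
    · rw [if_neg (by omega), if_neg (by omega), if_neg (by omega), a1, a2]
      ring
  rw [h1, sum_add_distrib, sum_add_distrib, sum_add_distrib, H.sum_neighbor_ite,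
    H.sum_neighbor_ite, H.sum_neighbor_ite, hcx, hcy, sum_const, H.degree_eq, nsmul_eq_mul,
    jointCount]

/-- Neighbourhood sums at a vertex whose distances to two vertices differ by two. -/
theorem sum_neighbor_far (g : ℕ → ℕ → ℂ) {i : ℕ} {x y z : V} (hxy : G.dist x y = 2)
    (hxz : G.dist x z = i) (hyz : G.dist y z = i + 2) :
    ∑ w ∈ G.neighborFinset z, g (G.dist x w) (G.dist y w)
      = valency G * g (i + 1) (i + 1) + c G i * (g (i - 1) (i + 1) - g (i + 1) (i + 1))
        + b G (i + 2) * (g (i + 1) (i + 3) - g (i + 1) (i + 1)) := by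
  have hcx := H.card_c z x
  have hcy := H.card_b z y
  rw [SimpleGraph.dist_comm (u := z), hxz] at hcx
  rw [SimpleGraph.dist_comm (u := z), hyz] at hcy
  have h1 : ∑ w ∈ G.neighborFinset z, g (G.dist x w) (G.dist y w)
      = ∑ w ∈ G.neighborFinset z, (g (i + 1) (i + 1)
        + (if G.dist w x + 1 = i then g (i - 1) (i + 1) - g (i + 1) (i + 1) else 0)
        + (if G.dist w y = i + 2 + 1 then g (i + 1) (i + 3) - g (i + 1) (i + 1) else 0)) := by
    refine sum_congr rfl fun w hw => ?_
    rw [SimpleGraph.mem_neighborFinset] at hw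
    have a1 := H.dist_adj hw x
    have a2 := H.dist_adj hw y
    have a3 := H.dist_triangle w x y
    rw [SimpleGraph.dist_comm (u := z), hxz] at a1
    rw [SimpleGraph.dist_comm (u := z), hyz] at a2
    rw [SimpleGraph.dist_comm (u := x), SimpleGraph.dist_comm (u := y)]
    rcases a1 with a1 | a1 <;> rcases a2 with a2 | a2
    · rw [if_pos a1.symm, if_neg (by omega), show G.dist w x = i - 1 by omega,
        show G.dist w y = i + 1 by omega]
      ring
    · omega
    · rw [if_neg (by omega), if_neg (by omega), a1, show G.dist w y = i + 1 by omega]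
      ring
    · rw [if_neg (by omega), if_pos (by omega), a1, show G.dist w y = i + 3 by omega]
      ring
  rw [h1, sum_add_distrib, sum_add_distrib, H.sum_neighbor_ite, H.sum_neighbor_ite, hcx, hcy,
    sum_const, H.degree_eq, nsmul_eq_mul]

/-- When the distances r and s differ by two, the neighbour counts are forced by the intersection
numbers; when they are equal, `jointCount` is the only remaining freedom. -/
theorem isTwoHomogeneous_of_jointCount
    (h : ∀ i, ∀ x y z x' y' z' : V, G.dist x y = 2 → G.dist x z = i → G.dist y z = i →
      G.dist x' y' = 2 → G.dist x' z' = i → G.dist y' z' = i →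
        jointCount G i x y z = jointCount G i x' y' z') : IsTwoHomogeneous G := by
  intro r s i j
  by_cases hex : ∃ x y z : V, G.dist x y = 2 ∧ G.dist x z = r ∧ G.dist y z = s
  swap
  · exact ⟨0, fun x y z h1 h2 h3 => absurd ⟨x, y, z, h1, h2, h3⟩ hex⟩
  obtain ⟨x, y, z, hxy, hxz, hyz⟩ := hex
  refine ⟨#{w | G.Adj z w ∧ G.dist x w = i ∧ G.dist y w = j}, fun x' y' z' hxy' hxz' hyz' => ?_⟩
  obtain ⟨g, hg⟩ : ∃ g : ℕ → ℕ → ℂ, ∀ a a', g a a' = if a = i ∧ a' = j then 1 else 0 :=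
    ⟨_, fun _ _ => rfl⟩
  have hcount : ∀ x y z : V, (#{w | G.Adj z w ∧ G.dist x w = i ∧ G.dist y w = j} : ℂ)
      = ∑ w ∈ G.neighborFinset z, g (G.dist x w) (G.dist y w) := by
    intro x y z
    simp only [hg]
    rw [H.sum_neighbor_ite, mul_one]
  have t1 := H.dist_triangle x y z
  have t2 := H.dist_triangle y x z
  have t3 := H.even_dist_add x y z
  rw [SimpleGraph.dist_comm (u := y) (v := x)] at t2
  rw [Nat.even_iff] at t3
  have hcases : s = r ∨ s = r + 2 ∨ r = s + 2 := by omega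
  suffices hsuff : (#{w | G.Adj z' w ∧ G.dist x' w = i ∧ G.dist y' w = j} : ℂ)
      = #{w | G.Adj z w ∧ G.dist x w = i ∧ G.dist y w = j} by exact_mod_cast hsuff
  rcases hcases with rfl | rfl | rfl
  · rw [hcount, hcount, H.sum_neighbor_equidistant _ hxz hyz,
      H.sum_neighbor_equidistant _ hxz' hyz', h s x y z x' y' z' hxy hxz hyz hxy' hxz' hyz']
  · rw [hcount, hcount, H.sum_neighbor_far _ hxy hxz hyz, H.sum_neighbor_far _ hxy' hxz' hyz']
  · rw [SimpleGraph.dist_comm] at hxy hxy'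
    rw [hcount, hcount, H.sum_neighbor_far (fun a a' => g a' a) hxy hyz hxz,
      H.sum_neighbor_far (fun a a' => g a' a) hxy' hyz' hxz']

/-- With Δ = 0 the fundamental expression is a product, and a vanishing factor at θ gives
`fundamental G θ θ = 0`. So Q_θ, and with it Φ_θ, vanishes on every local space for one extremal θ.
-/
theorem isTwoHomogeneous (h : fundamental G (eigenvalue G 1) (eigenvalue G (G.diam / 2)) = 0)
    (hΔ : Delta G = 0) : IsTwoHomogeneous G := by
  have h5 := H.five_le
  have hA := H.isAntipodalTwoCover h
  have hk := H.cast_valency_ge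
  have hb2 := H.cast_b_pos (i := 2) (by omega)
  have hb3 := H.cast_b_pos (i := 3) (by omega)
  have hprod := h
  rw [fundamental, hΔ, mul_zero, zero_mul, zero_mul, sub_zero] at hprod
  obtain ⟨θ, hθ, hθ0⟩ : ∃ θ, (θ = eigenvalue G 1 ∨ θ = eigenvalue G (G.diam / 2)) ∧
      (b G 2 : ℝ) * ((valency G : ℝ) - 2) - ((c G 2 : ℝ) - 1) * θ ^ 2 = 0 := by
    rcases mul_eq_zero.mp hprod with h1 | h1
    · exact ⟨_, Or.inl rfl, (mul_eq_zero.mp h1).resolve_left hb3.ne'⟩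
    · exact ⟨_, Or.inr rfl, h1⟩
  -- If c_2 = 1 the vanishing factor would be b_2(k-2) > 0.
  have hc2 : 2 ≤ c G 2 := by
    by_contra hlt
    have h1 : c G 2 = 1 := by
      have := H.c_pos (i := 2) (by omega) (by omega)
      omega
    rw [h1, Nat.cast_one, sub_self, zero_mul, sub_zero] at hθ0
    exact (mul_pos hb2 (by linarith : (0 : ℝ) < valency G - 2)).ne' hθ0
  have hfund : fundamental G θ θ = 0 := by
    rw [fundamental, hΔ, hθ0]
    ring
  have hΦ : ∀ x, ∀ v ∈ localSpace G ℝ x, cosMatrix G ℝ θ *ᵥ v = 0 := by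
    intro x v hv
    refine H.cosMatrix_mulVec_eq_zero (H.isEigenvalue_extremal hθ) hv ?_
    rw [H.localQuad_eq_zero_of_fundamental hfund hv, dotProduct_zero]
  exact H.isTwoHomogeneous_of_jointCount fun i x y z x' y' z' h1 h2 h3 h4 h6 h7 =>
    H.jointCount_eq hA hc2
      (fun i x y z x' y' z' h1 h2 h3 h4 h6 h7 => H.closerCount_eq hθ hΦ h1 h2 h3 h4 h6 h7)
      h1 h2 h3 h4 h6 h7

end OddBipartite
end DRG

/-! ### The equivalence, with the fundamental equation as the meeting point. -/

theorem mainTheorem4 {V : Type*} [Fintype V] [DecidableEq V]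
    (G : SimpleGraph V) [DecidableRel G.Adj]
    (hG : DRG.IsDistanceRegular G) (hbip : G.IsBipartite)
    (hD : 4 ≤ G.diam) (hodd : Odd G.diam) (hk : 3 ≤ DRG.valency G) :
    List.TFAE [
      DRG.IsTaut G ∨ DRG.IsTwoHomogeneous G,
      DRG.IsAntipodalTwoCover G ∧ ∀ x : V, DRG.IsTwoThin G x,
      DRG.IsAntipodalTwoCover G ∧ ∃ x : V, DRG.IsTwoThin G x] := by
  have H : DRG.OddBipartite G := ⟨hG, hbip, hD, hodd, hk⟩
  tfae_have 1 → 2 := by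
    intro h
    have hf : DRG.fundamental G (DRG.eigenvalue G 1) (DRG.eigenvalue G (G.diam / 2)) = 0 := by
      rcases h with h | h
      · rw [DRG.fundamental, sub_eq_zero]
        exact h.2
      · exact H.fundamental_of_twoHomogeneous h
    exact ⟨H.isAntipodalTwoCover hf, H.isTwoThin hf⟩
  tfae_have 2 → 3 := by
    rintro ⟨hA, hT⟩
    obtain ⟨x⟩ := H.nonempty
    exact ⟨hA, x, hT x⟩
  tfae_have 3 → 1 := by
    rintro ⟨hA, x, hT⟩
    have hf := H.fundamental_of_twoThin hA hT
    by_cases hΔ : DRG.Delta G = 0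
    · exact Or.inr (H.isTwoHomogeneous hf hΔ)
    · rw [DRG.fundamental, sub_eq_zero] at hf
      exact Or.inl ⟨hΔ, hf⟩
  tfae_finish
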